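/- **Setting.** Let $G$ be a real Lie group with Lie algebra $\mathfrak g_0$ and $\mathfrak g=\mathfrak g_0\otimes\mathbb C$. Suppose $G$ is real reductive of Harish-Chandra's class: $\mathfrak g_0$ is reductive, $\mathrm{Ad}(G)$ is contained in the connected complex adjoint group $\mathrm{Int}(\mathfrak g)$, and $G$ has finitely many connected components (the analytic subgroup of $[\mathfrak g_0,\mathfrak g_0]$ is not required to have finite center or to be closed). Let $\theta$ be a Cartan involution of $G$ whose group of fixed points $K$ is a maximal compact subgroup, and let $\mathfrak g_0=\mathfrak k_0\oplus\mathfrak p_0$ be the decomposition into the $\pm1$ eigenspaces of $\theta$. Fix a $G$-invariant and $\theta$-invariant symmetric bilinear form $\langle\cdot,\cdot\rangle$ on $\mathfrak g_0$, negative definite on $\mathfrak k_0$ and positive definite on $\mathfrak p_0$. Let $T\subset K$ be a maximal torus with Lie algebra $\mathfrak t_0$. Identify characters of $T$ with their differentials in $i\mathfrak t_0^*$, on which the form is positive definite. Let $\Delta(\mathfrak k,\mathfrak t)$ and $\Delta(\mathfrak g,\mathfrak t)$ be the nonzero weights of $T$ on $\mathfrak k=\mathfrak k_0\otimes\mathbb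 C$ and on $\mathfrak g$, counted with multiplicity, fix a positive system $\Delta^+(\mathfrak k,\mathfrak t)$, and let $2\rho_c$ be its sum. **Unitarily small parameters.** For a character $\mu$ of $T$ that is dominant for $\Delta^+(\mathfrak k,\mathfrak t)$, choose a positive system $\Delta^+$ of $\Delta(\mathfrak g,\mathfrak t)$ for which $\mu+2\rho_c$ is dominant. Let $2\rho$ be the sum of $\Delta^+$, counted with multiplicity, and let $C=\{\phi\in i\mathfrak t_0^*:\langle\phi,\gamma\rangle\ge0\text{ for all }\gamma\in\Delta^+\}$. Define $\lambda_u(\mu)\in C$ to be the point of $C$ closest to $\mu+2\rho_c-2\rho$; it does not depend on the choice of $\Delta^+$. Let $\Lambda_u$ be the set of all $\lambda_u(\mu)$. Extend $\lambda\in i\mathfrak t_0^*$ to $\mathfrak g_0=\mathfrak t_0\oplus[\mathfrak t_0,\mathfrak k_0]\oplus\mathfrak p_0$ by zero on the last two summands, and let $G(\lambda)$ be the isotropy group of this functional for the coadjoint action. Put $$\Lambda_u^z(G)=\{\lambda\in\Lambda_u : G(\lambda)=G\}.$$ **The group $Z_c/F_c$.** Let $Z$ be the identity component of the center of $G$ and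 $Z_c=Z\cap K$, with Lie algebra $\mathfrak z_{c,0}$. Let $G_c$ be the analytic subgroup of $G$ whose Lie algebra is the sum of the compact simple ideals of $[\mathfrak g_0,\mathfrak g_0]$ (those with negative definite Killing form), and let $F_c=Z(G_c)\cap Z\subset Z_c$, where $Z(G_c)$ is the center of $G_c$. Since $\mathfrak t_0=(\mathfrak t_0\cap[\mathfrak g_0,\mathfrak g_0])\oplus\mathfrak z_{c,0}$, a functional in $i\mathfrak z_{c,0}^*$ is regarded as an element of $i\mathfrak t_0^*$ by extending it by zero on $\mathfrak t_0\cap[\mathfrak g_0,\mathfrak g_0]$. **Proposition 6.13.** The set $\Lambda_u^z(G)$ of unitarily small parameters consists precisely of the differentials of the (unitary) characters of $Z_c/F_c$: an element $\lambda\in i\mathfrak t_0^*$ belongs to $\Lambda_u^z(G)$ if and only if $\lambda$ vanishes on $\mathfrak t_0\cap[\mathfrak g_0,\mathfrak g_0]$ and its restriction to $\mathfrak z_{c,0}$ is the differential of a character of $Z_c$ that is trivial on $F_c$. -/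

import Mathlib

open scoped Manifold ContDiff TensorProduct

noncomputable section

namespace RealReductive

instance leInfty_minSmoothness_three : ENat.LEInfty (minSmoothness ℝ 3) :=
  ⟨by rw [minSmoothness_of_isRCLikeNormedField]; exact ENat.LEInfty.out⟩

variable (E : Type*) [NormedAddCommGroup E] [NormedSpace ℝ E] [FiniteDimensional ℝ E]
variable (G : Type*) [TopologicalSpace G] [ChartedSpace E G] [Group G] [LieGroup 𝓘(ℝ, E) ∞ G]

/-- The real Lie algebra `𝔤₀` of the Lie group `G`, modelled on the finite dimensional real
vector space `E`: the tangent space at `1` with the bracket of left invariant vector fields. -/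
abbrev LieAlg : Type _ := GroupLieAlgebra 𝓘(ℝ, E) G

instance : FiniteDimensional ℝ (LieAlg E G) := inferInstanceAs (FiniteDimensional ℝ E)

/-- The complexification `𝔤 = ℂ ⊗ 𝔤₀`, a complex Lie algebra. -/
abbrev LieAlgC : Type _ := ℂ ⊗[ℝ] LieAlg E G

variable {G}

/-! ### One-parameter subgroups, differentials, the adjoint action -/

variable {E} in
/-- `γ` is the one-parameter subgroup `t ↦ exp (t X)`: the integral curve through `1` of the left
invariant vector field defined by `X`. -/
def IsOneParam (X : LieAlg E G) (γ : ℝ → G) : Prop :=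
  γ 0 = 1 ∧ IsMIntegralCurve (I := 𝓘(ℝ, E)) γ (mulInvariantVectorField X)

/-- The differential at `1` of an endomorphism of `G`, a linear map of `𝔤₀` to itself
(the tangent space at `f 1` is the one at `1`, since `f 1 = 1`). -/
def differential (f : G →* G) : LieAlg E G →ₗ[ℝ] LieAlg E G :=
  let D : E →L[ℝ] E := mfderiv 𝓘(ℝ, E) 𝓘(ℝ, E) f 1
  D.toLinearMap

/-- The adjoint action of `G` on `𝔤₀`: the differential of `x ↦ g x g⁻¹`. -/
def Ad (g : G) : LieAlg E G →ₗ[ℝ] LieAlg E G :=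
  differential E (MulAut.conj g).toMonoidHom

/-- The Lie algebra of a closed subgroup `H`, as a subspace of `𝔤₀`: all `X` with `exp (t X) ∈ H`
for all real `t`. (These `X` already form a subspace when `H` is closed, so that the span adds
nothing.) -/
def lieOf (H : Subgroup G) : Submodule ℝ (LieAlg E G) :=
  Submodule.span ℝ {X | ∃ γ : ℝ → G, IsOneParam X γ ∧ ∀ t, γ t ∈ H}

variable {E} in
/-- `φ` is the differential of the unitary character `χ` of the closed subgroup `H`, divided by
the imaginary unit: `χ (exp (t X)) = exp (i t φ(X))`. Here and below an imaginary valued linear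
functional `i φ` is represented by the real valued functional `φ`. -/
def IsDifferential (H : Subgroup G) (χ : H →ₜ* Circle) (φ : Module.Dual ℝ (lieOf E H)) : Prop :=
  ∀ (X : lieOf E H) (γ : ℝ → G), IsOneParam (X : LieAlg E G) γ →
    ∀ hγ : (∀ t, γ t ∈ H), ∀ t : ℝ, χ ⟨γ t, hγ t⟩ = Circle.exp (t * φ X)

/-! ### Real reductive groups in Harish-Chandra's class -/

/-- `φ = exp D` for endomorphisms `D`, `φ` of a finite dimensional complex vector space: the
exponential series converges to `φ`, coordinate by coordinate. -/
def IsExp {V : Type*} [AddCommGroup V] [Module ℂ V] (D φ : Module.End ℂ V) : Prop :=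
  ∀ (v : V) (l : Module.Dual ℂ V),
    HasSum (fun n : ℕ => ((n.factorial : ℂ)⁻¹) * l ((D ^ n) v)) (l (φ v))

variable (G) in
/-- The connected complex adjoint group `Int(𝔤)`: it is generated by all `exp (ad X)`, `X ∈ 𝔤`.
(The inverse of `exp (ad X)` is `exp (ad (-X))`, so the submonoid generated is a group.) -/
def complexAdjointGroup : Submonoid (Module.End ℂ (LieAlgC E G)) :=
  Submonoid.closure {φ | ∃ X : LieAlgC E G, IsExp (LieAlgebra.ad ℂ (LieAlgC E G) X) φ}

variable (G) in
/-- Harish-Chandra's class of real reductive groups: `𝔤₀` is reductive, every `Ad g` is an inner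
automorphism of the complexification `𝔤`, and `G` has finitely many connected components.
(Harish-Chandra also asks that the analytic subgroup with Lie algebra `[𝔤₀, 𝔤₀]` have finite
centre. That restriction is not imposed, so that this subgroup need not be closed in `G`.) -/
structure IsHarishChandraClass : Prop where
  /-- every ideal of `𝔤₀` has a complementary ideal -/
  reductive : ComplementedLattice (LieIdeal ℝ (LieAlg E G))
  inner : ∀ g : G, (Ad E g).baseChange ℂ ∈ complexAdjointGroup E G
  finite_components : Finite (ConnectedComponents G)

/-- `𝔨₀`, the `+1` eigenspace of the differential of `θ`. -/
def kPart (θ : G →* G) : Submodule ℝ (LieAlg E G) :=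
  Module.End.eigenspace (differential E θ) 1

/-- `𝔭₀`, the `-1` eigenspace of the differential of `θ`. -/
def pPart (θ : G →* G) : Submodule ℝ (LieAlg E G) :=
  Module.End.eigenspace (differential E θ) (-1)

/-- `θ` is a smooth involution of `G` whose group of fixed points is the maximal compact
subgroup `K`. -/
structure IsCartanInvolution (K : Subgroup G) (θ : G →* G) : Prop where
  smooth : ContMDiff 𝓘(ℝ, E) 𝓘(ℝ, E) ∞ θ
  involutive : Function.Involutive θ
  fixed : ∀ g : G, g ∈ K ↔ θ g = g
  maximal_compact : Maximal (fun S : Subgroup G => IsCompact (S : Set G)) K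

variable {E} in
/-- `B` is a symmetric bilinear form on `𝔤₀`, invariant under `G` and `θ`, negative definite on
`𝔨₀` and positive definite on `𝔭₀` (hence nondegenerate, because `𝔤₀ = 𝔨₀ ⊕ 𝔭₀`). -/
structure IsInvariantForm (θ : G →* G) (B : LinearMap.BilinForm ℝ (LieAlg E G)) : Prop where
  symm : ∀ X Y, B X Y = B Y X
  ad_invariant : ∀ (g : G) (X Y), B (Ad E g X) (Ad E g Y) = B X Y
  theta_invariant : ∀ X Y, B (differential E θ X) (differential E θ Y) = B X Y
  neg_def : ∀ X ∈ kPart E θ, X ≠ 0 → B X X < 0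
  pos_def : ∀ X ∈ pPart E θ, X ≠ 0 → 0 < B X X

/-- Compact connected abelian subgroups. -/
def IsTorus {G : Type*} [TopologicalSpace G] [Group G] (T : Subgroup G) : Prop :=
  IsCompact (T : Set G) ∧ IsConnected (T : Set G) ∧ ∀ x ∈ T, ∀ y ∈ T, x * y = y * x

/-- Maximal tori of `K`. -/
def IsMaximalTorus {G : Type*} [TopologicalSpace G] [Group G] (K T : Subgroup G) : Prop :=
  Maximal (fun S : Subgroup G => S ≤ K ∧ IsTorus S) T

/-! ### Weights, roots, positive systems

Here `T` is the maximal torus, `𝔱₀ = lieOf E T`, and the real dual of `𝔱₀` represents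
`i 𝔱₀^*` (the functional `α` stands for `i α`). -/

/-- The weights of the characters of `T`: a lattice of functionals on `𝔱₀`. -/
def characterLattice (T : Subgroup G) : Set (Module.Dual ℝ (lieOf E T)) :=
  {μ | ∃ χ : T →ₜ* Circle, IsDifferential T χ μ}

variable {E} in
/-- The weight space of weight `i α` in the complexification of the subspace `U` of `𝔤₀`. -/
def weightSpace (T : Subgroup G) (U : Submodule ℝ (LieAlg E G))
    (α : Module.Dual ℝ (lieOf E T)) : Submodule ℂ (LieAlgC E G) :=
  U.baseChange ℂ ⊓ ⨅ H : lieOf E T,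
    Module.End.eigenspace (LieAlgebra.ad ℂ (LieAlgC E G) ((1 : ℂ) ⊗ₜ[ℝ] (H : LieAlg E G)))
      (Complex.I * (α H : ℂ))

variable {E} in
/-- The set of nonzero weights of `T` in the complexification of `U`. The multiplicity of `α` is
the dimension of its weight space. The roots `Δ(𝔨, 𝔱)` are the case `U = 𝔨₀`, and `Δ(𝔤, 𝔱)` is the
case `U = 𝔤₀`. -/
def weights (T : Subgroup G) (U : Submodule ℝ (LieAlg E G)) : Set (Module.Dual ℝ (lieOf E T)) :=
  {α | α ≠ 0 ∧ weightSpace T U α ≠ ⊥}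

/-- `P` is a system of positive roots for `Δ`: the set of elements of `Δ` that are positive on
some element on which no element of `Δ` vanishes. -/
def IsPositiveSystem {V : Type*} [AddCommGroup V] [Module ℝ V] (Δ P : Set (Module.Dual ℝ V)) :
    Prop :=
  ∃ H : V, (∀ α ∈ Δ, α H ≠ 0) ∧ P = {α ∈ Δ | 0 < α H}

variable {E} in
/-- The sum of the elements of `P`, counted with their multiplicities as weights in `U`. -/
def twoRho (T : Subgroup G) (U : Submodule ℝ (LieAlg E G)) (P : Set (Module.Dual ℝ (lieOf E T))) :
    Module.Dual ℝ (lieOf E T) :=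
  ∑ᶠ α ∈ P, (Module.finrank ℂ (weightSpace T U α) : ℝ) • α

/-- The form on the dual of `V` that is dual to the nondegenerate form `Q` on `V`: if
`Q w · = ψ` then it takes the value `φ w` on `(φ, ψ)`. -/
def dualForm {V : Type*} [AddCommGroup V] [Module ℝ V] (Q : LinearMap.BilinForm ℝ V)
    (φ ψ : Module.Dual ℝ V) : ℝ :=
  φ (Function.invFun (fun w : V => (Q w : Module.Dual ℝ V)) ψ)

variable {E} in
/-- The positive definite inner product on `i 𝔱₀^*` obtained from `B`. Since `i φ` is represented
by `φ`, it is dual to the restriction of `-B` to `𝔱₀`. -/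
def ip (B : LinearMap.BilinForm ℝ (LieAlg E G)) (T : Subgroup G)
    (φ ψ : Module.Dual ℝ (lieOf E T)) : ℝ :=
  dualForm (-(B.restrict (lieOf E T))) φ ψ

variable {E} in
/-- The closed Weyl chamber of weights dominant for `P`. -/
def chamber (B : LinearMap.BilinForm ℝ (LieAlg E G)) (T : Subgroup G)
    (P : Set (Module.Dual ℝ (lieOf E T))) : Set (Module.Dual ℝ (lieOf E T)) :=
  {φ | ∀ γ ∈ P, 0 ≤ ip B T φ γ}

variable {E} in
/-- `c` is the projection of `v` on the closed convex cone `C`: the element of `C` closest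
to `v`. -/
def IsProjection (B : LinearMap.BilinForm ℝ (LieAlg E G)) (T : Subgroup G)
    (C : Set (Module.Dual ℝ (lieOf E T))) (v c : Module.Dual ℝ (lieOf E T)) : Prop :=
  c ∈ C ∧ ∀ c' ∈ C, ip B T (v - c) (v - c) ≤ ip B T (v - c') (v - c')

/-! ### The parameters `λ_u` -/

variable {E} in
/-- `l = λ_u(μ)`: for a positive system `P` of `Δ(𝔤, 𝔱)` making `μ + 2ρ_c` dominant, `l` is the
projection of `μ + 2ρ_c - 2ρ` on the chamber of `P`. Here `Pk` is the fixed positive system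
of `Δ(𝔨, 𝔱)`. (The projection does not depend on the choice of `P`.) -/
def IsLambdaU (θ : G →* G) (B : LinearMap.BilinForm ℝ (LieAlg E G)) (T : Subgroup G)
    (Pk : Set (Module.Dual ℝ (lieOf E T))) (μ l : Module.Dual ℝ (lieOf E T)) : Prop :=
  ∃ P, IsPositiveSystem (weights T (⊤ : Submodule ℝ (LieAlg E G))) P ∧
    μ + twoRho T (kPart E θ) Pk ∈ chamber B T P ∧
    IsProjection B T (chamber B T P)
      (μ + twoRho T (kPart E θ) Pk - twoRho T (⊤ : Submodule ℝ (LieAlg E G)) P) l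

variable {E} in
/-- The set `Λ_u` of all `λ_u(μ)`, where `μ` is a weight of `T` dominant for `Pk`. -/
def LambdaU (θ : G →* G) (B : LinearMap.BilinForm ℝ (LieAlg E G)) (T : Subgroup G)
    (Pk : Set (Module.Dual ℝ (lieOf E T))) : Set (Module.Dual ℝ (lieOf E T)) :=
  {l | ∃ μ ∈ characterLattice E T, μ ∈ chamber B T Pk ∧ IsLambdaU θ B T Pk μ l}

/-- `l'` is the extension of `l` from `𝔱₀` to `𝔤₀ = 𝔱₀ ⊕ [𝔱₀, 𝔨₀] ⊕ 𝔭₀` that vanishes on the other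
two summands. -/
def IsZeroExtension (θ : G →* G) (T : Subgroup G) (l : Module.Dual ℝ (lieOf E T))
    (l' : Module.Dual ℝ (LieAlg E G)) : Prop :=
  (∀ H : lieOf E T, l' H = l H) ∧
    (∀ H ∈ lieOf E T, ∀ X ∈ kPart E θ, l' ⁅H, X⁆ = 0) ∧
    ∀ X ∈ pPart E θ, l' X = 0

/-- The isotropy group `G(l')` of a linear functional on `𝔤₀` for the coadjoint action. -/
def isotropy (l' : Module.Dual ℝ (LieAlg E G)) : Set G :=
  {g | ∀ X, l' (Ad E g⁻¹ X) = l' X}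

variable {E} in
/-- The set `Λ_u^z(G)` of unitarily small parameters: those `l` in `Λ_u` with `G(l) = G`. -/
def LambdaUz (θ : G →* G) (B : LinearMap.BilinForm ℝ (LieAlg E G)) (T : Subgroup G)
    (Pk : Set (Module.Dual ℝ (lieOf E T))) : Set (Module.Dual ℝ (lieOf E T)) :=
  {l | l ∈ LambdaU θ B T Pk ∧ ∃ l', IsZeroExtension E θ T l l' ∧ isotropy E l' = Set.univ}

/-! ### The groups `Z_c` and `F_c` -/

variable (G) in
/-- `Z`, the identity component of the centre of `G`. -/
def centerIdentity : Subgroup G :=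
  haveI : IsTopologicalGroup G := topologicalGroup_of_lieGroup 𝓘(ℝ, E) ∞
  (Subgroup.connectedComponentOfOne (Subgroup.center G)).map (Subgroup.center G).subtype

/-- `Z_c = Z ∩ K`, the compact part of `Z`. -/
def Zc (K : Subgroup G) : Subgroup G := centerIdentity E G ⊓ K

variable (G) in
/-- The sum `𝔤_{c,0}` of the compact simple factors of `[𝔤₀, 𝔤₀]`: the sum of those ideals of `𝔤₀`
inside `[𝔤₀, 𝔤₀]` that are simple Lie algebras with negative definite Killing form. -/
def compactFactors : LieIdeal ℝ (LieAlg E G) :=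
  sSup {J | J ≤ ⁅(⊤ : LieIdeal ℝ (LieAlg E G)), (⊤ : LieIdeal ℝ (LieAlg E G))⁆ ∧
    LieAlgebra.IsSimple ℝ J ∧ ∀ X : J, X ≠ 0 → killingForm ℝ J X X < 0}

variable (G) in
/-- The analytic subgroup `G_c` of `G` with Lie algebra `𝔤_{c,0}`: it is generated by the
exponentials of the elements of `𝔤_{c,0}`. -/
def Gc : Subgroup G :=
  Subgroup.closure {g | ∃ X ∈ compactFactors E G, ∃ γ : ℝ → G, IsOneParam X γ ∧ γ 1 = g}

variable (G) in
/-- `F_c = Z(G_c) ∩ Z`. -/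
def Fc : Subgroup G :=
  (Subgroup.center (Gc E G)).map (Gc E G).subtype ⊓ centerIdentity E G

instance Fc_normal (K : Subgroup G) : ((Fc E G).subgroupOf (Zc E K)).Normal where
  conj_mem n hn g := by
    have hg : (g : G) ∈ Subgroup.center G := by
      obtain ⟨z, -, hz⟩ := g.2.1
      rw [← hz]
      exact z.2
    have h : g * n * g⁻¹ = n := by
      apply Subtype.ext
      simp only [Subgroup.coe_mul, Subgroup.coe_inv]
      rw [← (Subgroup.mem_center_iff.mp hg) (n : G)]
      simp
    rwa [h]

/-- The quotient map `Z_c → Z_c / F_c`. -/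
def toZcModFc (K : Subgroup G) : Zc E K →ₜ* (Zc E K ⧸ (Fc E G).subgroupOf (Zc E K)) where
  toMonoidHom := QuotientGroup.mk' _
  continuous_toFun := continuous_quot_mk

/-- The differentials of the characters of `Z_c / F_c`, as functionals on `𝔱₀`: the differential
`φ` of a character of `Z_c / F_c`, pulled back to `Z_c`, is a functional on the Lie algebra
of `Z_c`, and it is extended to `𝔱₀` by zero on `𝔱₀ ∩ [𝔤₀, 𝔤₀]`. -/
def centralDifferentials (K T : Subgroup G) : Set (Module.Dual ℝ (lieOf E T)) :=
  {l | ∃ (χ : (Zc E K ⧸ (Fc E G).subgroupOf (Zc E K)) →ₜ* Circle)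
      (φ : Module.Dual ℝ (lieOf E (Zc E K))),
    IsDifferential (Zc E K) (χ.comp (toZcModFc E K)) φ ∧
    (∀ X (hz : X ∈ lieOf E (Zc E K)) (ht : X ∈ lieOf E T), l ⟨X, ht⟩ = φ ⟨X, hz⟩) ∧
    ∀ H : lieOf E T,
      (H : LieAlg E G) ∈ ⁅(⊤ : LieIdeal ℝ (LieAlg E G)), (⊤ : LieIdeal ℝ (LieAlg E G))⁆ → l H = 0}

end RealReductive

end

open RealReductive

/-!
Functionals on `𝔱₀` that vanish on `𝔱₀ ∩ [𝔤₀, 𝔤₀]` are orthogonal to all roots, and they are exactly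
those whose extension by zero is fixed by `G`: the extension is represented by a central element,
and central elements are fixed by `Ad G` because `Ad G` consists of inner automorphisms of the
complexification (`IsHarishChandraClass.Ad_eq_self`, `lie_eq_zero_of_isotropy_eq_univ`,
`exists_isZeroExtension`). What has to be decided is which of them have the form `λ_u(μ)`.

The answer is governed by the ideal `𝔲 = {X ∈ 𝔨₀ | [X, 𝔭₀] = 0}`
(`IsCartanDecomposition.centralIdeal`). The part of `𝔲` in `[𝔤₀, 𝔤₀]` is the Lie algebra of `G_c`
(`IsCartanDecomposition.sSup_le_centralIdeal`, `IsCartanDecomposition.centralIdeal_inf_le_sSup`), and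
the weights in `𝔭₀` vanish on `𝔱₀ ∩ 𝔲`. Moreover `2 ρ_c` is strictly dominant
(`IsCartanDecomposition.sum_finrank_mul_pos`), so that a positive system for which `μ + 2 ρ_c` is
dominant extends the given one of `𝔨₀` (`positiveSystem_eq_inter`). Hence `2 ρ_c - 2 ρ` is minus the
sum of the positive weights in `𝔭₀`, with multiplicity.

*From parameters to characters.* If `λ_u(μ) = λ` is orthogonal to the roots, then the projection of
`μ - λ` to `𝔱₀ ∩ 𝔲` may be added to `λ` without leaving the chamber, and the minimality of the
distance forces this projection to vanish: `μ = λ` on `𝔱₀ ∩ 𝔲` (`apply_eq_of_isLambdaU`). So the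
restriction to `Z_c` of the character of `T` with differential `μ` has differential `λ`. An element
of `F_c ⊆ G_c` is the exponential of some `X` in the Lie algebra of `G_c`
(`IsCompactIdeal.exists_expE_eq`), where `λ` vanishes, and the character is trivial on it
(`mem_centralDifferentials`). Surjectivity of the exponential map of `G_c`, whose compactness is not
known beforehand, is proved with discrete geodesics: a product of `n` exponentials whose energy is
minimal among the products of length `n` with the given value has equal factors.

*From characters to parameters.* If `λ` comes from a character of `Z_c / F_c`, then it is integral on
the elements of `𝔱₀ ∩ 𝔲` with trivial exponential (`apply_mem_of_mem_centralDifferentials`), and agrees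
there with the differential of a character of `T` (`exists_mem_characterLattice_eq`). The difference
is a real combination of weights in `𝔭₀`; removing integral parts leaves coefficients in `[0, 1)`
(`exists_mem_characterLattice_sub_le`), and by Weyl conjugation the character may be taken dominant
(`exists_dominant_sub_le`). Then `μ - λ` is at most the sum of the positive values of the weights
in `𝔭₀`, which says that `μ + 2 ρ_c - 2 ρ - λ` makes an obtuse angle with the chamber, that is,
`λ_u(μ) = λ` (`isLambdaU_of_sub_le`).

The theory of the exponential map that this requires (one-parameter subgroups, the adjoint
representation, closed abelian subgroups and their characters, maximal tori) is developed from the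
integral curves of invariant vector fields and the group law in the chart at the identity.
-/

noncomputable section

namespace RealReductive

set_option linter.unusedSectionVars false

open Filter Topology Set

variable {E : Type*} [NormedAddCommGroup E] [NormedSpace ℝ E] [FiniteDimensional ℝ E]
variable {G : Type*} [TopologicalSpace G] [ChartedSpace E G] [Group G] [LieGroup 𝓘(ℝ, E) ∞ G]

/-! ### The group law in the chart at the identity -/

variable (E) in
/-- The preferred chart at `1`, as a map `G → E`. -/
def chart (g : G) : E := extChartAt 𝓘(ℝ, E) (1 : G) g

variable (G) in
/-- The inverse of the preferred chart at `1`. -/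
def chartSymm (x : E) : G := (extChartAt 𝓘(ℝ, E) (1 : G)).symm x

variable (E G) in
/-- The domain of the preferred chart at `1`. -/
def chartSource : Set G := (extChartAt 𝓘(ℝ, E) (1 : G)).source

lemma isOpen_chartSource : IsOpen (chartSource E G) := isOpen_extChartAt_source _

lemma one_mem_chartSource : (1 : G) ∈ chartSource E G := mem_extChartAt_source _

lemma chartSource_mem_nhds_one : chartSource E G ∈ 𝓝 (1 : G) :=
  isOpen_chartSource.mem_nhds one_mem_chartSource

lemma chartSymm_chart {g : G} (hg : g ∈ chartSource E G) : chartSymm G (chart E g) = g :=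
  (extChartAt 𝓘(ℝ, E) (1 : G)).left_inv hg

lemma chartSymm_chart_one : chartSymm G (chart E (1 : G)) = 1 :=
  chartSymm_chart one_mem_chartSource

lemma contMDiffAt_chart {g : G} (hg : g ∈ chartSource E G) :
    ContMDiffAt 𝓘(ℝ, E) 𝓘(ℝ, E) ∞ (chart E : G → E) g := by
  have : IsManifold 𝓘(ℝ, E) ∞ G := LieGroup.toContMDiffMul.toIsManifold
  exact contMDiffAt_extChartAt' (by rwa [chartSource, extChartAt_source] at hg)

lemma eventually_chart_chartSymm : ∀ᶠ x in 𝓝 (chart E (1 : G)), chart E (chartSymm G x) = x := by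
  filter_upwards [extChartAt_target_mem_nhds (I := 𝓘(ℝ, E)) (1 : G)] with x hx
  exact (extChartAt 𝓘(ℝ, E) (1 : G)).right_inv hx

lemma contMDiffAt_chartSymm :
    ContMDiffAt 𝓘(ℝ, E) 𝓘(ℝ, E) ∞ (chartSymm G : E → G) (chart E (1 : G)) := by
  have : IsManifold 𝓘(ℝ, E) ∞ G := LieGroup.toContMDiffMul.toIsManifold
  exact (contMDiffOn_extChartAt_symm (1 : G)).contMDiffAt
    (extChartAt_target_mem_nhds (I := 𝓘(ℝ, E)) (1 : G))

lemma continuousAt_chartSymm : ContinuousAt (chartSymm G : E → G) (chart E (1 : G)) :=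
  contMDiffAt_chartSymm.continuousAt

lemma continuousAt_chart {g : G} (hg : g ∈ chartSource E G) : ContinuousAt (chart E : G → E) g :=
  (contMDiffAt_chart hg).continuousAt

/-- A map with values in a normed space has the same derivative at `1` as its expression
in the chart. -/
lemma mfderiv_one_eq_fderiv {F : Type*} [NormedAddCommGroup F] [NormedSpace ℝ F] {h : G → F}
    (hh : MDifferentiableAt 𝓘(ℝ, E) 𝓘(ℝ, F) h 1) :
    (mfderiv 𝓘(ℝ, E) 𝓘(ℝ, F) h 1 : E →L[ℝ] F) =
      fderiv ℝ (fun x => h (chartSymm G x)) (chart E (1 : G)) := by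
  refine hh.mfderiv.trans ?_
  simp only [writtenInExtChartAt, extChartAt_model_space_eq_id, ModelWithCorners.range_eq_univ,
    fderivWithin_univ]
  rfl

variable (E G) in
/-- Multiplication in the chart at `1`. -/
def mulChart (p : E × E) : E := chart E (chartSymm G p.1 * chartSymm G p.2)

lemma contMDiffAt_chartSymm_comp {V : Type*} [NormedAddCommGroup V] [NormedSpace ℝ V] {f : V → E}
    {v : V} (hf : ContDiffAt ℝ ∞ f v) (h1 : f v = chart E (1 : G)) :
    ContMDiffAt 𝓘(ℝ, V) 𝓘(ℝ, E) ∞ (fun w => chartSymm G (f w)) v :=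
  ContMDiffAt.comp v (by rw [h1]; exact contMDiffAt_chartSymm) hf.contMDiffAt

lemma contDiffAt_mulChart :
    ContDiffAt ℝ ∞ (mulChart E G) (chart E (1 : G), chart E (1 : G)) := by
  rw [← contMDiffAt_iff_contDiffAt]
  have h1 : ContMDiffAt 𝓘(ℝ, E × E) 𝓘(ℝ, E) ∞ (fun p : E × E => chartSymm G p.1)
      (chart E (1 : G), chart E (1 : G)) := contMDiffAt_chartSymm_comp contDiffAt_fst rfl
  have h2 : ContMDiffAt 𝓘(ℝ, E × E) 𝓘(ℝ, E) ∞ (fun p : E × E => chartSymm G p.2)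
      (chart E (1 : G), chart E (1 : G)) := contMDiffAt_chartSymm_comp contDiffAt_snd rfl
  refine ContMDiffAt.comp (I' := 𝓘(ℝ, E)) _ ?_ (h1.mul h2)
  refine contMDiffAt_chart ?_
  simp only [chartSymm_chart_one, mul_one]
  exact one_mem_chartSource

variable (E G) in
/-- Conjugation `x y x⁻¹` in the chart at `1`. -/
def conjChart (p : E × E) : E :=
  chart E (chartSymm G p.1 * chartSymm G p.2 * (chartSymm G p.1)⁻¹)

lemma contDiffAt_conjChart :
    ContDiffAt ℝ ∞ (conjChart E G) (chart E (1 : G), chart E (1 : G)) := by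
  rw [← contMDiffAt_iff_contDiffAt]
  have h1 : ContMDiffAt 𝓘(ℝ, E × E) 𝓘(ℝ, E) ∞ (fun p : E × E => chartSymm G p.1)
      (chart E (1 : G), chart E (1 : G)) := contMDiffAt_chartSymm_comp contDiffAt_fst rfl
  have h2 : ContMDiffAt 𝓘(ℝ, E × E) 𝓘(ℝ, E) ∞ (fun p : E × E => chartSymm G p.2)
      (chart E (1 : G), chart E (1 : G)) := contMDiffAt_chartSymm_comp contDiffAt_snd rfl
  refine ContMDiffAt.comp (I' := 𝓘(ℝ, E)) _ ?_ ((h1.mul h2).mul h1.inv)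
  refine contMDiffAt_chart ?_
  simp only [chartSymm_chart_one, mul_one, inv_one]
  exact one_mem_chartSource

variable (E G) in
/-- The left invariant vector fields in the chart at `1`: the field with value `X` at `1` is
`x ↦ fieldChart x X`. -/
def fieldChart (x : E) : E →L[ℝ] E :=
  (fderiv ℝ (mulChart E G) (x, chart E (1 : G))).comp (ContinuousLinearMap.inr ℝ E E)

lemma contDiffAt_fieldChart : ContDiffAt ℝ ∞ (fieldChart E G) (chart E (1 : G)) := by
  have h : ContDiffAt ℝ ∞ (fderiv ℝ (mulChart E G)) (chart E (1 : G), chart E (1 : G)) :=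
    contDiffAt_mulChart.fderiv_right (by simp)
  have h2 : ContDiffAt ℝ ∞ (fun x : E => fderiv ℝ (mulChart E G) (x, chart E (1 : G)))
      (chart E (1 : G)) := ContDiffAt.comp (chart E (1 : G)) (g := fderiv ℝ (mulChart E G))
        (f := fun x : E => (x, chart E (1 : G))) h (by fun_prop)
  exact h2.clm_comp contDiffAt_const

lemma eventually_fieldChart_eq : ∀ᶠ x in 𝓝 (chart E (1 : G)),
    HasFDerivAt (fun y => mulChart E G (x, y)) (fieldChart E G x) (chart E (1 : G)) := by
  have h : ∀ᶠ p in 𝓝 (chart E (1 : G), chart E (1 : G)), DifferentiableAt ℝ (mulChart E G) p := by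
    have := (contDiffAt_mulChart (E := E) (G := G)).of_le (m := 1) (by simp)
    filter_upwards [this.eventually (by simp)] with p hp using hp.differentiableAt (by simp)
  have hc : Tendsto (fun x : E => (x, chart E (1 : G))) (𝓝 (chart E (1 : G)))
      (𝓝 (chart E (1 : G), chart E (1 : G))) := (by fun_prop : Continuous _).tendsto' _ _ rfl
  filter_upwards [hc.eventually h] with x hx
  exact HasFDerivAt.comp (chart E (1 : G)) (g := mulChart E G) (f := fun y => (x, y)) hx.hasFDerivAt
    (hasFDerivAt_prodMk_right x _)

lemma fieldChart_one : fieldChart E G (chart E (1 : G)) = ContinuousLinearMap.id ℝ E := by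
  have h := (eventually_fieldChart_eq (E := E) (G := G)).self_of_nhds
  refine h.unique ?_
  refine (hasFDerivAt_id _).congr_of_eventuallyEq ?_
  filter_upwards [eventually_chart_chartSymm (E := E) (G := G)] with y hy
  simp [mulChart, chartSymm_chart_one, hy]

lemma mdifferentiableAt_mul_left (g h : G) :
    MDifferentiableAt 𝓘(ℝ, E) 𝓘(ℝ, E) (fun x : G => g * x) h :=
  (contMDiff_mul_left (I := 𝓘(ℝ, E)) (n := ∞)).contMDiffAt.mdifferentiableAt (by simp)

/-- In the chart at `1` the left invariant vector field is given by `fieldChart`. -/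
lemma eventually_mfderiv_chart_mulInvariantVectorField : ∀ᶠ g in 𝓝 (1 : G), g ∈ chartSource E G ∧
    ∀ X : LieAlg E G, mfderiv 𝓘(ℝ, E) 𝓘(ℝ, E) (chart E : G → E) g (mulInvariantVectorField X g) =
      fieldChart E G (chart E g) X := by
  filter_upwards [chartSource_mem_nhds_one (E := E) (G := G),
    (continuousAt_chart (E := E) one_mem_chartSource).eventually
      (eventually_fieldChart_eq (E := E) (G := G))] with g hg hg'
  refine ⟨hg, fun X => ?_⟩
  have hd : MDifferentiableAt 𝓘(ℝ, E) 𝓘(ℝ, E) (chart E : G → E) g :=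
    (contMDiffAt_chart hg).mdifferentiableAt (by simp)
  have h1 : HasMFDerivAt 𝓘(ℝ, E) 𝓘(ℝ, E) (fun x : G => g * x) 1
      (mfderiv 𝓘(ℝ, E) 𝓘(ℝ, E) (fun x : G => g * x) 1) :=
    (mdifferentiableAt_mul_left g 1).hasMFDerivAt
  have hd' : HasMFDerivAt 𝓘(ℝ, E) 𝓘(ℝ, E) (chart E : G → E) (g * 1)
      (mfderiv 𝓘(ℝ, E) 𝓘(ℝ, E) (chart E : G → E) (g * 1)) := by
    refine MDifferentiableAt.hasMFDerivAt ?_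
    rwa [mul_one]
  have e : (mfderiv 𝓘(ℝ, E) 𝓘(ℝ, E) (chart E : G → E) (g * 1) : E →L[ℝ] E) =
      mfderiv 𝓘(ℝ, E) 𝓘(ℝ, E) (chart E : G → E) g := by rw [mul_one]
  have h2 := hd'.comp 1 h1
  have h3 := mfderiv_one_eq_fderiv h2.mdifferentiableAt
  rw [h2.mfderiv] at h3
  have h4 : (fun x => ((chart E : G → E) ∘ fun x => g * x) (chartSymm G x)) =
      fun y => mulChart E G (chart E g, y) := by
    funext y
    simp [mulChart, chartSymm_chart hg]
  rw [h4, hg'.fderiv] at h3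
  refine Eq.trans ?_ (congrArg (fun L : E →L[ℝ] E => L X) h3)
  exact (congrArg (fun L : E →L[ℝ] E => L (mulInvariantVectorField X g)) e).symm

/-! ### One-parameter subgroups and the exponential map -/

lemma contMDiff_one_mulInvariantVectorField (X : LieAlg E G) :
    ContMDiff 𝓘(ℝ, E) 𝓘(ℝ, E).tangent 1
      (fun g : G => (⟨g, mulInvariantVectorField X g⟩ : TangentBundle 𝓘(ℝ, E) G)) :=
  (contMDiff_mulInvariantVectorField X).of_le
    (by rw [minSmoothness_of_isRCLikeNormedField]; norm_num)

lemma mfderiv_mul_left_mulInvariantVectorField (g h : G) (X : LieAlg E G) :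
    mfderiv 𝓘(ℝ, E) 𝓘(ℝ, E) (fun x : G => g * x) h (mulInvariantVectorField X h) =
      (mulInvariantVectorField X (g * h) : TangentSpace 𝓘(ℝ, E) (g * h)) := by
  have e : (fun x : G => g * h * x) = (fun x : G => g * x) ∘ fun x : G => h * x := by
    funext x; simp [mul_assoc]
  have h1 := (mdifferentiableAt_mul_left (E := E) h 1).hasMFDerivAt
  have h2 := (mdifferentiableAt_mul_left (E := E) g (h * 1)).hasMFDerivAt
  have h3 := (h2.comp 1 h1).mfderiv
  rw [← e] at h3
  have e' : (mfderiv 𝓘(ℝ, E) 𝓘(ℝ, E) (fun x : G => g * x) (h * 1) : E →L[ℝ] E) =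
      mfderiv 𝓘(ℝ, E) 𝓘(ℝ, E) (fun x : G => g * x) h := by rw [mul_one]
  refine Eq.trans ?_ (congrArg (fun L : E →L[ℝ] E => L X) h3).symm
  exact (congrArg (fun L : E →L[ℝ] E => L (mulInvariantVectorField X h)) e').symm

lemma isMIntegralCurveOn_mul_left {X : LieAlg E G} {γ : ℝ → G} {s : Set ℝ}
    (h : IsMIntegralCurveOn (I := 𝓘(ℝ, E)) γ (mulInvariantVectorField X) s) (g : G) :
    IsMIntegralCurveOn (I := 𝓘(ℝ, E)) (fun t => g * γ t) (mulInvariantVectorField X) s := by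
  intro t ht
  have := ((mdifferentiableAt_mul_left (E := E) g (γ t)).hasMFDerivAt).comp_hasMFDerivWithinAt t
    (h t ht)
  refine this.congr_mfderiv ?_
  refine ContinuousLinearMap.ext fun a => ?_
  have h2 := mfderiv_mul_left_mulInvariantVectorField g (γ t) X
  refine ((mfderiv 𝓘(ℝ, E) 𝓘(ℝ, E) (fun x : G => g * x) (γ t)).map_smul a _).trans ?_
  rw [h2]
  rfl

lemma isMIntegralCurve_mul_left {X : LieAlg E G} {γ : ℝ → G}
    (h : IsMIntegralCurve (I := 𝓘(ℝ, E)) γ (mulInvariantVectorField X)) (g : G) :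
    IsMIntegralCurve (I := 𝓘(ℝ, E)) (fun t => g * γ t) (mulInvariantVectorField X) := by
  rw [isMIntegralCurve_iff_isMIntegralCurveOn] at h ⊢
  exact isMIntegralCurveOn_mul_left h g

/-- One-parameter subgroups are defined for all times: left translation carries an integral curve
through `1` to every other point, so that the existence time is uniform. -/
lemma exists_isOneParam [T2Space G] (X : LieAlg E G) : ∃ γ : ℝ → G, IsOneParam X γ := by
  have : IsManifold 𝓘(ℝ, E) ∞ G := LieGroup.toContMDiffMul.toIsManifold
  have : IsManifold 𝓘(ℝ, E) 1 G := IsManifold.of_le (n := ∞) (by simp)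
  have hv := contMDiff_one_mulInvariantVectorField X
  obtain ⟨γ, hγ0, hγ⟩ := exists_isMIntegralCurveAt_of_contMDiffAt_boundaryless (t₀ := 0)
    (hv.contMDiffAt (x := (1 : G)))
  obtain ⟨ε, hε, h⟩ := isMIntegralCurveAt_iff'.mp hγ
  rw [Real.ball_eq_Ioo, zero_sub, zero_add] at h
  obtain ⟨γ', h0, h'⟩ := exists_isMIntegralCurve_of_isMIntegralCurveOn hv hε
    (fun x => ⟨fun t => x * γ t, by simp [hγ0], isMIntegralCurveOn_mul_left h x⟩) 1
  exact ⟨γ', h0, h'⟩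

lemma IsMIntegralCurve.eq_mul_of_invariant [T2Space G] {X : LieAlg E G} {γ γ' : ℝ → G}
    (h : IsMIntegralCurve (I := 𝓘(ℝ, E)) γ (mulInvariantVectorField X))
    (h' : IsMIntegralCurve (I := 𝓘(ℝ, E)) γ' (mulInvariantVectorField X)) (t₀ : ℝ)
    (h0 : γ t₀ = γ' t₀) : γ = γ' := by
  have : IsManifold 𝓘(ℝ, E) ∞ G := LieGroup.toContMDiffMul.toIsManifold
  have : IsManifold 𝓘(ℝ, E) 1 G := IsManifold.of_le (n := ∞) (by simp)
  exact isMIntegralCurve_Ioo_eq_of_contMDiff_boundaryless (t₀ := t₀)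
    (contMDiff_one_mulInvariantVectorField X) h h' h0

lemma IsOneParam.unique [T2Space G] {X : LieAlg E G} {γ γ' : ℝ → G} (h : IsOneParam X γ)
    (h' : IsOneParam X γ') : γ = γ' :=
  IsMIntegralCurve.eq_mul_of_invariant h.2 h'.2 0 (h.1.trans h'.1.symm)

variable [T2Space G]

/-- The exponential map of `G`. -/
def expG (X : LieAlg E G) : G := (exists_isOneParam X).choose 1

lemma IsOneParam.comp_mul {X : LieAlg E G} {γ : ℝ → G} (h : IsOneParam X γ) (c : ℝ) :
    IsOneParam (c • X) (fun t => γ (t * c)) := by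
  refine ⟨by simp [h.1], ?_⟩
  rw [mulInvariantVectorField_smul]
  exact h.2.comp_mul c

lemma IsOneParam.eq_expG {X : LieAlg E G} {γ : ℝ → G} (h : IsOneParam X γ) (t : ℝ) :
    γ t = expG (t • X) := by
  have := (h.comp_mul t).unique (exists_isOneParam (t • X)).choose_spec
  have := congrFun this 1
  simpa [expG] using this

lemma isOneParam_expG (X : LieAlg E G) : IsOneParam X (fun t => expG (t • X)) := by
  obtain ⟨γ, h⟩ := exists_isOneParam X
  have : γ = fun t => expG (t • X) := funext h.eq_expG
  rwa [← this]

@[simp] lemma expG_zero : expG (0 : LieAlg E G) = 1 := by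
  have := (isOneParam_expG (0 : LieAlg E G)).1
  simpa using this

lemma expG_add_smul (X : LieAlg E G) (s t : ℝ) :
    expG ((s + t) • X) = expG (s • X) * expG (t • X) := by
  have h := isMIntegralCurve_mul_left (isOneParam_expG X).2 (expG (s • X))
  have h2 := (isOneParam_expG X).2.comp_add s
  have := IsMIntegralCurve.eq_mul_of_invariant h2 h 0 (by simp)
  have := congrFun this t
  simpa [add_comm] using this

lemma expG_neg (X : LieAlg E G) : expG (-X) = (expG X)⁻¹ := by
  have := expG_add_smul X (-1) 1
  simp only [neg_add_cancel, zero_smul, expG_zero, neg_smul, one_smul] at this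
  exact eq_inv_of_mul_eq_one_left this.symm

lemma expG_nsmul (n : ℕ) (X : LieAlg E G) : expG ((n : ℝ) • X) = expG X ^ n := by
  induction n with
  | zero => simp
  | succ n ih =>
    rw [Nat.cast_succ, expG_add_smul, ih, one_smul, pow_succ]

lemma continuous_expG_smul (X : LieAlg E G) : Continuous fun t : ℝ => expG (t • X) := by
  have : IsManifold 𝓘(ℝ, E) ∞ G := LieGroup.toContMDiffMul.toIsManifold
  have : IsManifold 𝓘(ℝ, E) 1 G := IsManifold.of_le (n := ∞) (by simp)
  exact (isOneParam_expG X).2.continuous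

/-! ### The exponential map in the chart -/

variable (E G) in
/-- The Lie algebra is, as a vector space, the model space `E`. -/
def lieEquiv : LieAlg E G ≃ₗ[ℝ] E := LinearEquiv.refl ℝ E

variable (E G) in
/-- The exponential map as a map on the model space. -/
def expE (x : E) : G := expG ((lieEquiv E G).symm x)

lemma expE_lieEquiv (X : LieAlg E G) : expE E G (lieEquiv E G X) = expG X := rfl

lemma expE_zero : expE E G 0 = 1 := by simp [expE]

lemma continuous_expE_smul (x : E) : Continuous fun t : ℝ => expE E G (t • x) := by
  simpa [expE] using continuous_expG_smul ((lieEquiv E G).symm x)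

lemma hasDerivAt_chart_expE_smul : ∀ᶠ g in 𝓝 (1 : G), g ∈ chartSource E G ∧
    ∀ (x : E) (t : ℝ), expE E G (t • x) = g →
      HasDerivAt (fun s : ℝ => chart E (expE E G (s • x))) (fieldChart E G (chart E g) x) t := by
  filter_upwards [eventually_mfderiv_chart_mulInvariantVectorField (E := E) (G := G)]
    with g ⟨hg, hg'⟩
  refine ⟨hg, fun x t hx => ?_⟩
  subst hx
  have h1 := (isOneParam_expG ((lieEquiv E G).symm x)).2 t
  have e : (fun t : ℝ => expG (t • (lieEquiv E G).symm x)) = fun t : ℝ => expE E G (t • x) := by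
    funext t; simp [expE]
  rw [e] at h1
  have hd : MDifferentiableAt 𝓘(ℝ, E) 𝓘(ℝ, E) (chart E : G → E) (expE E G (t • x)) :=
    (contMDiffAt_chart hg).mdifferentiableAt (by simp)
  let L : E →L[ℝ] E := mfderiv 𝓘(ℝ, E) 𝓘(ℝ, E) (chart E : G → E) (expE E G (t • x))
  let v : E := mulInvariantVectorField ((lieEquiv E G).symm x) (expE E G (t • x))
  have h2 : HasFDerivAt (fun s : ℝ => chart E (expE E G (s • x)))
      (L.comp (ContinuousLinearMap.smulRight (1 : ℝ →L[ℝ] ℝ) v)) t :=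
    (hd.hasMFDerivAt.comp t h1).hasFDerivAt
  have h3 : L v = fieldChart E G (chart E (expE E G (t • x))) x :=
    hg' ((lieEquiv E G).symm x)
  have h4 := h2.hasDerivAt
  rwa [ContinuousLinearMap.comp_apply, ContinuousLinearMap.smulRight_apply,
    one_apply_eq_self, one_smul, h3] at h4

/-- For small `x` the curve `t ↦ exp (t x)`, `0 ≤ t ≤ 1`, stays in a prescribed neighbourhood of
`1` inside which the chart and the coordinate formula for invariant fields are valid. -/
lemma exists_expE_smul_mem {U : Set G} (hU : U ∈ 𝓝 (1 : G)) : ∃ r > 0, ∀ x : E, ‖x‖ < r →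
    ∀ t ∈ Icc (0 : ℝ) 1, expE E G (t • x) ∈ U := by
  -- shrink to a set of the form `{g | ‖φ g - φ 1‖ < ρ}`
  have hA : ∀ᶠ x in 𝓝 (chart E (1 : G)), ‖fieldChart E G x‖ < 2 := by
    have hc : ContinuousAt (fun x => ‖fieldChart E G x‖) (chart E (1 : G)) :=
      (contDiffAt_fieldChart (E := E) (G := G)).continuousAt.norm
    refine hc.eventually_lt continuousAt_const ?_
    rw [fieldChart_one]
    exact ContinuousLinearMap.norm_id_le.trans_lt one_lt_two
  have hgood : ∀ᶠ g in 𝓝 (1 : G), g ∈ U ∧ (g ∈ chartSource E G ∧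
    ∀ (x : E) (t : ℝ), expE E G (t • x) = g →
      HasDerivAt (fun s : ℝ => chart E (expE E G (s • x))) (fieldChart E G (chart E g) x) t) :=
    (show ∀ᶠ g in 𝓝 (1 : G), g ∈ U from hU).and hasDerivAt_chart_expE_smul
  have hs := continuousAt_chartSymm (E := E) (G := G)
  rw [ContinuousAt, chartSymm_chart_one] at hs
  obtain ⟨ρ, hρ, hball⟩ := Metric.eventually_nhds_iff_ball.mp
    (((hs.eventually hgood).and hA).and (eventually_chart_chartSymm (E := E) (G := G)))
  have hcont : ContinuousOn (chartSymm G : E → G) (Metric.ball (chart E (1 : G)) ρ) := by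
    intro x hx
    have hx' : chartSymm G x ∈ chartSource E G := (hball x hx).1.1.2.1
    have htar : x ∈ (extChartAt 𝓘(ℝ, E) (1 : G)).target := by
      have := (extChartAt 𝓘(ℝ, E) (1 : G)).map_source hx'
      have h3 : extChartAt 𝓘(ℝ, E) (1 : G) (chartSymm G x) = x := (hball x hx).2
      rwa [h3] at this
    exact (continuousAt_extChartAt_symm'' htar).continuousWithinAt
  set W : Set G := chartSource E G ∩ chart E ⁻¹' Metric.ball (chart E (1 : G)) ρ with hW
  have hWU : W ⊆ U := by
    intro g hg
    have := (hball _ hg.2).1.1.1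
    rwa [chartSymm_chart hg.1] at this
  have hWo : IsOpen W := by
    have := (continuousOn_extChartAt (I := 𝓘(ℝ, E)) (1 : G)).isOpen_inter_preimage
      (isOpen_extChartAt_source (1 : G)) (Metric.isOpen_ball (x := chart E (1 : G)) (ε := ρ))
    exact this
  refine ⟨ρ / 4, by positivity, fun x hx => ?_⟩
  suffices h : ∀ t ∈ Icc (0 : ℝ) 1, expE E G (t • x) ∈ W from fun t ht => hWU (h t ht)
  by_contra! hne
  obtain ⟨t₁, ht₁, ht₁'⟩ := hne
  -- the first time at which the curve leaves `W`
  let S : Set ℝ := Icc 0 1 ∩ (fun t : ℝ => expE E G (t • x)) ⁻¹' Wᶜ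
  have hSc : IsClosed S :=
    isClosed_Icc.inter (hWo.isClosed_compl.preimage (continuous_expE_smul x))
  have hSne : S.Nonempty := ⟨t₁, ht₁, ht₁'⟩
  have hSb : BddBelow S := ⟨0, fun t ht => ht.1.1⟩
  set T := sInf S with hT
  have hTS : T ∈ S := hSc.csInf_mem hSne hSb
  have hbefore : ∀ t ∈ Ico (0 : ℝ) T, expE E G (t • x) ∈ W := by
    intro t ht
    by_contra h
    exact (not_le.mpr ht.2) (csInf_le hSb ⟨⟨ht.1, ht.2.le.trans hTS.1.2⟩, h⟩)
  have h0W : expE E G ((0 : ℝ) • x) ∈ W := by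
    rw [zero_smul, expE_zero]
    exact ⟨one_mem_chartSource, Metric.mem_ball_self hρ⟩
  have hT0 : 0 < T := by
    rcases hTS.1.1.lt_or_eq with h | h
    · exact h
    · exact absurd h0W (by rw [h]; exact hTS.2)
  have hbound : ∀ t ∈ Ico (0 : ℝ) T,
      expE E G (t • x) ∈ chartSymm G '' Metric.closedBall (chart E (1 : G)) (ρ / 2) := by
    intro t ht
    refine ⟨chart E (expE E G (t • x)), ?_, chartSymm_chart (hbefore t ht).1⟩
    have key : ∀ u ∈ Icc (0 : ℝ) t, HasDerivWithinAt (fun s : ℝ => chart E (expE E G (s • x)))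
        (fieldChart E G (chart E (expE E G (u • x))) x) (Icc 0 t) u := by
      intro u hu
      have hu' := hbefore u ⟨hu.1, hu.2.trans_lt ht.2⟩
      have := (hball _ hu'.2).1.1.2.2 x u (chartSymm_chart hu'.1).symm
      rw [chartSymm_chart hu'.1] at this
      exact this.hasDerivWithinAt
    have := norm_image_sub_le_of_norm_deriv_le_segment' key (C := 2 * ‖x‖) (fun u hu => by
      have hu' := hbefore u ⟨hu.1, hu.2.trans ht.2⟩
      exact (ContinuousLinearMap.le_opNorm _ _).trans
        (mul_le_mul_of_nonneg_right (hball _ hu'.2).1.2.le (norm_nonneg _))) t ⟨ht.1, le_rfl⟩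
    rw [zero_smul, expE_zero, sub_zero] at this
    rw [mem_closedBall_iff_norm]
    refine this.trans ?_
    have : t ≤ 1 := ht.2.le.trans hTS.1.2
    nlinarith [norm_nonneg x, ht.1]
  have hK : IsClosed (chartSymm G '' Metric.closedBall (chart E (1 : G)) (ρ / 2)) := by
    have : ProperSpace E := FiniteDimensional.proper_real E
    exact ((isCompact_closedBall _ _).image_of_continuousOn
      (hcont.mono (Metric.closedBall_subset_ball (by linarith)))).isClosed
  have hTK : expE E G (T • x) ∈ chartSymm G '' Metric.closedBall (chart E (1 : G)) (ρ / 2) := by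
    refine hK.mem_of_tendsto (b := 𝓝[<] T)
      ((continuous_expE_smul x).continuousAt.tendsto.mono_left nhdsWithin_le_nhds) ?_
    filter_upwards [Ioo_mem_nhdsLT hT0] with t ht using hbound t ⟨ht.1.le, ht.2⟩
  obtain ⟨y, hy, hyT⟩ := hTK
  have hy' := Metric.closedBall_subset_ball (by linarith : ρ / 2 < ρ) hy
  refine hTS.2 ⟨?_, ?_⟩
  · change expE E G (T • x) ∈ _
    rw [← hyT]
    exact (hball y hy').1.1.2.1
  · rw [mem_preimage]
    change chart E (expE E G (T • x)) ∈ _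
    rw [← hyT, (hball y hy').2]
    exact hy'

/-- The exponential map is strictly differentiable at `0`, with the identity as derivative. -/
theorem hasStrictFDerivAt_chart_expE :
    HasStrictFDerivAt (fun x : E => chart E (expE E G x : G)) (ContinuousLinearMap.id ℝ E) 0 := by
  rw [hasStrictFDerivAt_iff_isLittleO, Asymptotics.isLittleO_iff]
  intro c hc
  set η := c / 4 with hη
  have hη0 : 0 < η := by positivity
  obtain ⟨L, s, hs, hL⟩ := ((contDiffAt_fieldChart (E := E) (G := G)).of_le
    (m := 1) (by simp)).exists_lipschitzOnWith
  have hA : ∀ᶠ x in 𝓝 (chart E (1 : G)), ‖fieldChart E G x - ContinuousLinearMap.id ℝ E‖ < η := by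
    have hc : ContinuousAt (fun x => ‖fieldChart E G x - ContinuousLinearMap.id ℝ E‖)
        (chart E (1 : G)) :=
      ((contDiffAt_fieldChart (E := E) (G := G)).continuousAt.sub continuousAt_const).norm
    refine hc.eventually_lt continuousAt_const ?_
    rw [fieldChart_one, sub_self, norm_zero]
    exact hη0
  have hU := (hasDerivAt_chart_expE_smul (E := E) (G := G)).and
    ((continuousAt_chart (one_mem_chartSource (E := E) (G := G))).eventually
      ((show ∀ᶠ x in 𝓝 (chart E (1 : G)), x ∈ s from hs).and hA))
  obtain ⟨r, hr, hrU⟩ := exists_expE_smul_mem (E := E) (G := G) hU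
  have hr' : 0 < min r (min (1 / (L + 1)) (η / (L + 1))) := by positivity
  have hmem : Metric.ball (0 : E) (min r (min (1 / (L + 1)) (η / (L + 1)))) ∈ 𝓝 (0 : E) :=
    Metric.ball_mem_nhds _ hr'
  filter_upwards [prod_mem_nhds hmem hmem] with ⟨x, y⟩ ⟨hx, hy⟩
  simp only [mem_ball_zero_iff] at hx hy
  have hx1 := hx.trans_le (min_le_left _ _)
  have hy1 := hy.trans_le (min_le_left _ _)
  have hLy1 : L * ‖y‖ ≤ 1 := by
    have h := (hy.trans_le ((min_le_right _ _).trans (min_le_left _ _))).le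
    rw [le_div_iff₀ (by positivity)] at h
    nlinarith [norm_nonneg y]
  have hLy2 : L * ‖y‖ ≤ η := by
    have h := (hy.trans_le ((min_le_right _ _).trans (min_le_right _ _))).le
    rw [le_div_iff₀ (by positivity)] at h
    nlinarith [norm_nonneg y]
  set cx : ℝ → E := fun t => chart E (expE E G (t • x)) with hcx
  set cy : ℝ → E := fun t => chart E (expE E G (t • y)) with hcy
  set D : ℝ → E := fun t => cx t - cy t - t • (x - y) with hD
  set D' : ℝ → E := fun t => fieldChart E G (cx t) x - fieldChart E G (cy t) y - (x - y) with hD'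
  have hder : ∀ t ∈ Icc (0 : ℝ) 1, HasDerivAt D (D' t) t := by
    intro t ht
    have h1 := (hrU x hx1 t ht).1.2 x t rfl
    have h2 := (hrU y hy1 t ht).1.2 y t rfl
    have h3 : HasDerivAt (fun t : ℝ => t • (x - y)) ((1 : ℝ) • (x - y)) t :=
      (hasDerivAt_id t).smul_const _
    rw [one_smul] at h3
    exact (h1.sub h2).sub h3
  have hbd : ∀ t ∈ Ico (0 : ℝ) 1, ‖D' t‖ ≤ 1 * ‖D t‖ + 2 * η * ‖x - y‖ := by
    intro t ht
    have ht' : t ∈ Icc (0 : ℝ) 1 := ⟨ht.1, ht.2.le⟩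
    obtain ⟨hxs, hxA⟩ := (hrU x hx1 t ht').2
    obtain ⟨hys, hyA⟩ := (hrU y hy1 t ht').2
    have e : D' t = (fieldChart E G (cx t) - ContinuousLinearMap.id ℝ E) (x - y) +
        (fieldChart E G (cx t) - fieldChart E G (cy t)) y := by
      simp only [hD', sub_apply, map_sub, ContinuousLinearMap.id_apply]
      abel
    have h1 : ‖(fieldChart E G (cx t) - ContinuousLinearMap.id ℝ E) (x - y)‖ ≤ η * ‖x - y‖ :=
      (ContinuousLinearMap.le_opNorm _ _).trans (mul_le_mul_of_nonneg_right hxA.le (norm_nonneg _))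
    have h2 : ‖(fieldChart E G (cx t) - fieldChart E G (cy t)) y‖ ≤
        (L * ‖cx t - cy t‖) * ‖y‖ :=
      (ContinuousLinearMap.le_opNorm _ _).trans
        (mul_le_mul_of_nonneg_right (hL.norm_sub_le hxs hys) (norm_nonneg _))
    have h3 : ‖cx t - cy t‖ ≤ ‖D t‖ + ‖x - y‖ := by
      have : cx t - cy t = D t + t • (x - y) := by simp [hD]
      rw [this]
      refine (norm_add_le _ _).trans ?_
      rw [norm_smul, Real.norm_of_nonneg ht.1]
      nlinarith [norm_nonneg (x - y), ht.2]
    have hL0 : (0 : ℝ) ≤ L := L.2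
    have h4 : (L * ‖cx t - cy t‖) * ‖y‖ ≤ L * ‖y‖ * (‖D t‖ + ‖x - y‖) := by
      rw [mul_right_comm]
      exact mul_le_mul_of_nonneg_left h3 (by positivity)
    rw [e]
    refine (norm_add_le _ _).trans ?_
    nlinarith [norm_nonneg (D t), norm_nonneg (x - y), norm_nonneg y]
  have hD0 : ‖D 0‖ ≤ 0 := by simp [hD, hcx, hcy]
  have := norm_le_gronwallBound_of_norm_deriv_right_le
    (fun t ht => (hder t ht).continuousAt.continuousWithinAt)
    (fun t ht => (hder t ⟨ht.1, ht.2.le⟩).hasDerivWithinAt) hD0 hbd 1 ⟨zero_le_one, le_rfl⟩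
  rw [gronwallBound_of_K_ne_0 one_ne_zero] at this
  have e1 : D 1 = chart E (expE E G x) - chart E (expE E G y) - (x - y) := by
    simp [hD, hcx, hcy]
  rw [e1] at this
  simp only [ContinuousLinearMap.id_apply]
  refine this.trans ?_
  have he : Real.exp 1 < 3 := Real.exp_one_lt_three
  simp only [sub_zero, mul_one, div_one, zero_mul, zero_add]
  nlinarith [norm_nonneg (x - y), mul_nonneg hη0.le (norm_nonneg (x - y))]

lemma tendsto_expE_zero : Tendsto (expE E G) (𝓝 0) (𝓝 1) := by
  intro U hU
  obtain ⟨r, hr, h⟩ := exists_expE_smul_mem (E := E) hU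
  rw [mem_map]
  filter_upwards [Metric.ball_mem_nhds (0 : E) hr] with x hx
  simpa using h x (by simpa using hx) 1 ⟨zero_le_one, le_rfl⟩

/-! ### Maps into `G` strictly differentiable at a point over `1` -/

section StrictDeriv

variable {V : Type*} [NormedAddCommGroup V] [NormedSpace ℝ V]

/-- `f : V → G` maps `0` to `1` and is strictly differentiable there, with derivative `L` when
the tangent space of `G` at `1` is identified with `E`. -/
structure HasStrictDerivOne (f : V → G) (L : V →L[ℝ] E) : Prop where
  map_zero : f 0 = 1
  continuousAt : ContinuousAt f 0
  deriv : HasStrictFDerivAt (fun v => chart E (f v)) L 0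

lemma hasStrictDerivOne_expE : HasStrictDerivOne (expE E G) (ContinuousLinearMap.id ℝ E) where
  map_zero := expE_zero
  continuousAt := by
    rw [ContinuousAt, expE_zero]
    exact tendsto_expE_zero
  deriv := hasStrictFDerivAt_chart_expE

lemma HasStrictDerivOne.comp_clm {V' : Type*} [NormedAddCommGroup V'] [NormedSpace ℝ V']
    {f : V → G} {L : V →L[ℝ] E} (hf : HasStrictDerivOne f L) (A : V' →L[ℝ] V) :
    HasStrictDerivOne (fun v => f (A v)) (L.comp A) where
  map_zero := by rw [A.map_zero, hf.map_zero]
  continuousAt := ContinuousAt.comp (g := f) (by rw [A.map_zero]; exact hf.continuousAt)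
    A.continuous.continuousAt
  deriv := HasStrictFDerivAt.comp (g := fun v => chart E (f v)) (f := A) 0
    (by rw [A.map_zero]; exact hf.deriv) A.hasStrictFDerivAt

lemma hasStrictDerivOne_expE_clm (A : V →L[ℝ] E) : HasStrictDerivOne (fun v => expE E G (A v)) A :=
  hasStrictDerivOne_expE.comp_clm A

lemma HasStrictDerivOne.congr {f g : V → G} {L L' : V →L[ℝ] E} (hf : HasStrictDerivOne f L)
    (h : ∀ v, f v = g v) (h' : L = L') : HasStrictDerivOne g L' := by
  obtain rfl : f = g := funext h
  exact h' ▸ hf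

lemma hasStrictFDerivAt_mulChart : HasStrictFDerivAt (mulChart E G)
    (ContinuousLinearMap.fst ℝ E E + ContinuousLinearMap.snd ℝ E E)
    (chart E (1 : G), chart E (1 : G)) := by
  have h := (contDiffAt_mulChart (E := E) (G := G)).hasStrictFDerivAt (by simp)
  set D := fderiv ℝ (mulChart E G) (chart E (1 : G), chart E (1 : G)) with hD
  have hR : D.comp (ContinuousLinearMap.inr ℝ E E) = ContinuousLinearMap.id ℝ E := fieldChart_one
  have hL : D.comp (ContinuousLinearMap.inl ℝ E E) = ContinuousLinearMap.id ℝ E := by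
    have h1 : HasFDerivAt (fun x => mulChart E G (x, chart E (1 : G)))
        (D.comp (ContinuousLinearMap.inl ℝ E E)) (chart E (1 : G)) :=
      HasFDerivAt.comp (chart E (1 : G)) (g := mulChart E G) (f := fun x => (x, chart E (1 : G)))
        h.hasFDerivAt (hasFDerivAt_prodMk_left _ _)
    refine h1.unique ((hasFDerivAt_id _).congr_of_eventuallyEq ?_)
    filter_upwards [eventually_chart_chartSymm (E := E) (G := G)] with y hy
    simp [mulChart, chartSymm_chart_one, hy]
  have e : D = ContinuousLinearMap.fst ℝ E E + ContinuousLinearMap.snd ℝ E E := by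
    refine ContinuousLinearMap.ext fun p => ?_
    have h1 := congrArg (fun A : E →L[ℝ] E => A p.1) hL
    have h2 := congrArg (fun A : E →L[ℝ] E => A p.2) hR
    simp only [ContinuousLinearMap.comp_apply, ContinuousLinearMap.inl_apply,
      ContinuousLinearMap.inr_apply, ContinuousLinearMap.id_apply] at h1 h2
    have : p = (p.1, 0) + (0, p.2) := by simp
    rw [this, map_add, h1, h2]
    simp
  rwa [e] at h

lemma HasStrictDerivOne.mul {f g : V → G} {L M : V →L[ℝ] E} (hf : HasStrictDerivOne f L)
    (hg : HasStrictDerivOne g M) : HasStrictDerivOne (fun v => f v * g v) (L + M) where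
  map_zero := by rw [hf.map_zero, hg.map_zero, one_mul]
  continuousAt := by
    have : IsTopologicalGroup G := topologicalGroup_of_lieGroup 𝓘(ℝ, E) ∞
    exact hf.continuousAt.mul hg.continuousAt
  deriv := by
    have h1 : HasStrictFDerivAt (fun v => (chart E (f v), chart E (g v))) (L.prod M) 0 :=
      hf.deriv.prodMk hg.deriv
    have h2 : HasStrictFDerivAt (fun v => mulChart E G (chart E (f v), chart E (g v)))
        ((ContinuousLinearMap.fst ℝ E E + ContinuousLinearMap.snd ℝ E E).comp (L.prod M)) 0 := by
      refine HasStrictFDerivAt.comp (g := mulChart E G) 0 ?_ h1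
      rw [hf.map_zero, hg.map_zero]
      exact hasStrictFDerivAt_mulChart
    have e : (ContinuousLinearMap.fst ℝ E E + ContinuousLinearMap.snd ℝ E E).comp (L.prod M) =
        L + M := by ext v; simp
    rw [e] at h2
    refine h2.congr_of_eventuallyEq ?_
    have hs : ∀ {k : V → G}, ContinuousAt k 0 → k 0 = 1 → ∀ᶠ v in 𝓝 0, k v ∈ chartSource E G :=
      fun hk h0 => hk.eventually (by rw [h0]; exact chartSource_mem_nhds_one)
    filter_upwards [hs hf.continuousAt hf.map_zero, hs hg.continuousAt hg.map_zero] with v h h'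
    simp [mulChart, chartSymm_chart h, chartSymm_chart h']

lemma eventually_chartSymm_comp {f : V → G} {L : V →L[ℝ] E} (hf : HasStrictDerivOne f L) :
    ∀ᶠ v in 𝓝 0, chartSymm G (chart E (f v)) = f v := by
  filter_upwards [hf.continuousAt.eventually (p := fun g => g ∈ chartSource E G)
    (by rw [hf.map_zero]; exact chartSource_mem_nhds_one)] with v hv using chartSymm_chart hv

/-- If the derivative is onto, then the map covers a neighbourhood of `1`. -/
lemma HasStrictDerivOne.nhds_le_map [CompleteSpace V] {f : V → G} {L : V →L[ℝ] E}
    (hf : HasStrictDerivOne f L) (hL : Function.Surjective L) : 𝓝 (1 : G) ≤ map f (𝓝 0) := by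
  have : CompleteSpace E := FiniteDimensional.complete ℝ E
  have h1 := hf.deriv.map_nhds_eq_of_surj (LinearMap.range_eq_top.mpr hL)
  intro U hU
  rw [mem_map] at hU
  have h2 : (fun v => chart E (f v)) '' (f ⁻¹' U ∩
      {v | chartSymm G (chart E (f v)) = f v}) ∈ 𝓝 (chart E (1 : G)) := by
    rw [← hf.map_zero, ← h1]
    exact image_mem_map (inter_mem hU (eventually_chartSymm_comp hf))
  filter_upwards [(continuousAt_chart (one_mem_chartSource (E := E) (G := G))).preimage_mem_nhds h2,
    chartSource_mem_nhds_one (E := E) (G := G)] with g hg hgs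
  obtain ⟨v, ⟨hv, hv'⟩, hvg⟩ := hg
  rw [← chartSymm_chart hgs, ← hvg, hv']
  exact hv

/-- If the derivative is bounded below, then so is the map, and it is injective near `0`. -/
lemma HasStrictDerivOne.exists_antilipschitz {f : V → G} {L : V →L[ℝ] E}
    (hf : HasStrictDerivOne f L) {c : ℝ} (hc : 0 < c) (hL : ∀ v, c * ‖v‖ ≤ ‖L v‖) :
    ∀ᶠ p : V × V in 𝓝 (0, 0), c / 2 * ‖p.1 - p.2‖ ≤ ‖chart E (f p.1) - chart E (f p.2)‖ := by
  have h := hf.deriv.isLittleO.def (half_pos hc)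
  filter_upwards [h] with p hp
  have h1 := hL (p.1 - p.2)
  have h2 := norm_sub_norm_le (L (p.1 - p.2)) (chart E (f p.1) - chart E (f p.2))
  rw [norm_sub_rev (L _)] at h2
  linarith

end StrictDeriv

/-! ### Homomorphisms and one-parameter subgroups -/

/-- A homomorphism `ℝ → G` differentiable at `0` is a one-parameter subgroup. -/
lemma eq_expE_of_hom {γ : ℝ → G} {x : E} (h0 : γ 0 = 1) (hadd : ∀ s t, γ (s + t) = γ s * γ t)
    (hc : ContinuousAt γ 0) (hd : HasDerivAt (fun t => chart E (γ t)) x 0) (t : ℝ) :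
    γ t = expE E G (t • x) := by
  have hγ0 : ∀ u : ℝ, u = 0 → HasMFDerivAt 𝓘(ℝ, ℝ) 𝓘(ℝ, E) γ u
      (ContinuousLinearMap.smulRight (1 : ℝ →L[ℝ] ℝ) x) := by
    rintro u rfl
    refine ⟨hc, ?_⟩
    simp only [writtenInExtChartAt, extChartAt_model_space_eq_id, ModelWithCorners.range_eq_univ, h0]
    have h1 : HasFDerivAt (fun t => chart E (γ t))
        (ContinuousLinearMap.smulRight (1 : ℝ →L[ℝ] ℝ) x) 0 :=
      hd.hasFDerivAt.congr_fderiv (by ext; simp)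
    exact h1.hasFDerivWithinAt
  have hint : IsOneParam ((lieEquiv E G).symm x) γ := by
    refine ⟨h0, fun t => ?_⟩
    have h1 : HasMFDerivAt 𝓘(ℝ, ℝ) 𝓘(ℝ, ℝ) (fun s : ℝ => s - t) t (ContinuousLinearMap.id ℝ ℝ) :=
      ((hasFDerivAt_id t).sub_const t).hasMFDerivAt
    have h2 := HasMFDerivAt.comp (g := γ) (f := fun s : ℝ => s - t) t (hγ0 (t - t) (sub_self t)) h1
    have h3 : ∀ g : G, g = 1 → HasMFDerivAt 𝓘(ℝ, E) 𝓘(ℝ, E) (fun x : G => γ t * x) g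
        (mfderiv 𝓘(ℝ, E) 𝓘(ℝ, E) (fun x : G => γ t * x) 1 : E →L[ℝ] E) := by
      rintro g rfl
      exact (mdifferentiableAt_mul_left (γ t) 1).hasMFDerivAt
    have h4 := (h3 ((γ ∘ fun s : ℝ => s - t) t) (by simp [h0])).comp t h2
    have e : ((fun x : G => γ t * x) ∘ γ ∘ fun s : ℝ => s - t) = γ := by
      funext s
      simp [← hadd]
    rw [e] at h4
    refine h4.congr_mfderiv ?_
    refine ContinuousLinearMap.ext fun a => ?_
    exact (mfderiv 𝓘(ℝ, E) 𝓘(ℝ, E) (fun x : G => γ t * x) 1 : E →L[ℝ] E).map_smul a x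
  have := hint.eq_expG t
  rw [this, expE, map_smul]

/-! ### The adjoint representation -/

/-- In the chart at `1` the derivative of a smooth endomorphism of `G` is its differential. -/
lemma hasFDerivAt_chart_hom {f : G →* G} (hf : ContMDiff 𝓘(ℝ, E) 𝓘(ℝ, E) ∞ f) :
    HasFDerivAt (fun x => chart E (f (chartSymm G x)))
      (LinearMap.toContinuousLinearMap
        ((lieEquiv E G).toLinearMap ∘ₗ differential E f ∘ₗ (lieEquiv E G).symm.toLinearMap))
      (chart E (1 : G)) := by
  have h := ((hf.mdifferentiable (by simp)) 1).hasMFDerivAt.2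
  simp only [writtenInExtChartAt, map_one, ModelWithCorners.range_eq_univ] at h
  exact (hasFDerivWithinAt_univ.mp h)

/-- A smooth endomorphism of `G` intertwines the exponential map with its differential. -/
lemma map_expG {f : G →* G} (hf : ContMDiff 𝓘(ℝ, E) 𝓘(ℝ, E) ∞ f) (X : LieAlg E G) :
    f (expG X) = expG (differential E f X) := by
  have hd := hasFDerivAt_chart_hom hf
  set D := LinearMap.toContinuousLinearMap
        ((lieEquiv E G).toLinearMap ∘ₗ differential E f ∘ₗ (lieEquiv E G).symm.toLinearMap)
  have hs : HasStrictDerivOne (fun t : ℝ => expE E G (t • lieEquiv E G X)) _ :=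
    hasStrictDerivOne_expE_clm (ContinuousLinearMap.toSpanSingleton ℝ (lieEquiv E G X))
  have hcont := continuous_expE_smul (G := G) (lieEquiv E G X)
  have h1 : HasDerivAt (fun t : ℝ => chart E (expE E G (t • lieEquiv E G X)))
      (lieEquiv E G X) 0 := by
    simpa using hs.deriv.hasFDerivAt.hasDerivAt
  have hd' : HasFDerivAt (fun x => chart E (f (chartSymm G x))) D
      (chart E (expE E G ((0 : ℝ) • lieEquiv E G X))) := by
    rw [zero_smul, expE_zero]; exact hd
  have h2 := hd'.comp_hasDerivAt (0 : ℝ) h1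
  have h3 : HasDerivAt (fun t : ℝ => chart E (f (expE E G (t • lieEquiv E G X))))
      (D (lieEquiv E G X)) 0 := by
    refine h2.congr_of_eventuallyEq ?_
    filter_upwards [hcont.continuousAt.preimage_mem_nhds (x := 0)
      (by simpa [expE_zero] using chartSource_mem_nhds_one (E := E) (G := G))] with t ht
    simp only [Function.comp_apply]
    rw [chartSymm_chart ht]
  have h4 := eq_expE_of_hom (γ := fun t : ℝ => f (expE E G (t • lieEquiv E G X)))
    (by simp [expE_zero])
    (fun s t => by
      rw [← map_mul]
      simp only [expE, map_smul, expG_add_smul])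
    (hf.continuous.comp hcont).continuousAt h3 1
  simp only [one_smul] at h4
  exact h4

lemma expG_smul_injective {X Y : LieAlg E G} (h : ∀ t : ℝ, expG (t • X) = expG (t • Y)) :
    X = Y := by
  have key : ∀ Z : LieAlg E G, HasDerivAt (fun t : ℝ => chart E (expG (t • Z)))
      (lieEquiv E G Z) 0 := by
    intro Z
    have hs : HasStrictDerivOne (fun t : ℝ => expE E G (t • lieEquiv E G Z)) _ :=
      hasStrictDerivOne_expE_clm (ContinuousLinearMap.toSpanSingleton ℝ (lieEquiv E G Z))
    have h1 := hs.deriv.hasFDerivAt.hasDerivAt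
    rw [ContinuousLinearMap.toSpanSingleton_apply, one_smul] at h1
    exact h1
  have h2 := key Y
  simp only [← h] at h2
  exact (lieEquiv E G).injective ((key X).unique h2)

lemma contMDiff_conj (g : G) : ContMDiff 𝓘(ℝ, E) 𝓘(ℝ, E) ∞ (MulAut.conj g).toMonoidHom := by
  have h : ContMDiff 𝓘(ℝ, E) 𝓘(ℝ, E) ∞ (fun x : G => g * x * g⁻¹) :=
    (contMDiff_const.mul contMDiff_id).mul contMDiff_const
  exact h

lemma conj_expG (g : G) (X : LieAlg E G) : g * expG X * g⁻¹ = expG (Ad E g X) :=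
  map_expG (contMDiff_conj g) X

lemma Ad_mul (g h : G) (X : LieAlg E G) : Ad E (g * h) X = Ad E g (Ad E h X) := by
  refine expG_smul_injective fun t => ?_
  rw [← map_smul, ← map_smul, ← map_smul, ← conj_expG, ← conj_expG, ← conj_expG]
  group

lemma Ad_one (X : LieAlg E G) : Ad E (1 : G) X = X := by
  refine expG_smul_injective fun t => ?_
  rw [← map_smul, ← conj_expG]
  group

lemma Ad_inv_Ad (g : G) (X : LieAlg E G) : Ad E g⁻¹ (Ad E g X) = X := by
  rw [← Ad_mul, inv_mul_cancel, Ad_one]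

lemma Ad_Ad_inv (g : G) (X : LieAlg E G) : Ad E g (Ad E g⁻¹ X) = X := by
  rw [← Ad_mul, mul_inv_cancel, Ad_one]

lemma differential_Ad {f : G →* G} (hf : ContMDiff 𝓘(ℝ, E) 𝓘(ℝ, E) ∞ f) (g : G)
    (X : LieAlg E G) : differential E f (Ad E g X) = Ad E (f g) (differential E f X) := by
  refine expG_smul_injective fun t => ?_
  rw [← map_smul, ← map_smul, ← map_smul, ← map_smul, ← map_expG hf, ← conj_expG, ← conj_expG,
    ← map_expG hf]
  simp

variable (E) in
/-- The adjoint action as a map on the model space. -/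
def AdE (g : G) : E →L[ℝ] E :=
  LinearMap.toContinuousLinearMap
    ((lieEquiv E G).toLinearMap ∘ₗ Ad E g ∘ₗ (lieEquiv E G).symm.toLinearMap)

lemma AdE_apply (g : G) (x : E) : AdE E g x = lieEquiv E G (Ad E g ((lieEquiv E G).symm x)) := rfl

lemma AdE_mul (g h : G) : AdE E (g * h) = (AdE E g).comp (AdE E h) := by
  ext x
  simp [AdE_apply, Ad_mul]

lemma AdE_one : AdE E (1 : G) = ContinuousLinearMap.id ℝ E := by
  ext x
  simp [AdE_apply, Ad_one]

lemma conj_expE (g : G) (x : E) : g * expE E G x * g⁻¹ = expE E G (AdE E g x) :=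
  conj_expG g _

variable (E G) in
/-- The adjoint action in the chart at `1`. -/
def adChart (x : E) : E →L[ℝ] E :=
  (fderiv ℝ (conjChart E G) (x, chart E (1 : G))).comp (ContinuousLinearMap.inr ℝ E E)

lemma contDiffAt_adChart : ContDiffAt ℝ ∞ (adChart E G) (chart E (1 : G)) := by
  have h : ContDiffAt ℝ ∞ (fderiv ℝ (conjChart E G)) (chart E (1 : G), chart E (1 : G)) :=
    contDiffAt_conjChart.fderiv_right (by simp)
  have h2 : ContDiffAt ℝ ∞ (fun x : E => fderiv ℝ (conjChart E G) (x, chart E (1 : G)))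
      (chart E (1 : G)) := ContDiffAt.comp (chart E (1 : G)) (g := fderiv ℝ (conjChart E G))
        (f := fun x : E => (x, chart E (1 : G))) h (by fun_prop)
  exact h2.clm_comp contDiffAt_const

lemma tendsto_prodMk_left_chart : Tendsto (fun x : E => (x, chart E (1 : G)))
    (𝓝 (chart E (1 : G))) (𝓝 (chart E (1 : G), chart E (1 : G))) :=
  (by fun_prop : Continuous _).tendsto' _ _ rfl

lemma eventually_differentiableAt_of_contDiffAt {V F : Type*} [NormedAddCommGroup V]
    [NormedSpace ℝ V] [NormedAddCommGroup F] [NormedSpace ℝ F] {f : V → F} {v : V}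
    (hf : ContDiffAt ℝ ∞ f v) : ∀ᶠ p in 𝓝 v, DifferentiableAt ℝ f p := by
  filter_upwards [(hf.of_le (m := 1) (by simp)).eventually (by simp)] with p hp
  exact hp.differentiableAt (by simp)

lemma eventually_AdE_eq : ∀ᶠ x in 𝓝 (chart E (1 : G)),
    AdE E (chartSymm G x) = adChart E G x := by
  filter_upwards [tendsto_prodMk_left_chart.eventually (eventually_differentiableAt_of_contDiffAt
    (contDiffAt_conjChart (E := E) (G := G)))] with x hx
  have h1 : HasFDerivAt (fun y => conjChart E G (x, y)) (adChart E G x) (chart E (1 : G)) :=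
    HasFDerivAt.comp (chart E (1 : G)) (g := conjChart E G) (f := fun y => (x, y)) hx.hasFDerivAt
      (hasFDerivAt_prodMk_right x _)
  exact (hasFDerivAt_chart_hom (contMDiff_conj (chartSymm G x))).unique h1

lemma continuous_AdE : Continuous (AdE E : G → E →L[ℝ] E) := by
  have : IsTopologicalGroup G := topologicalGroup_of_lieGroup 𝓘(ℝ, E) ∞
  have h1 : ContinuousAt (AdE E : G → E →L[ℝ] E) 1 := by
    have hc := continuousAt_chart (one_mem_chartSource (E := E) (G := G))
    have h2 : ContinuousAt (fun g : G => adChart E G (chart E g)) 1 :=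
      ContinuousAt.comp (g := adChart E G) contDiffAt_adChart.continuousAt hc
    refine h2.congr ?_
    filter_upwards [hc.eventually eventually_AdE_eq, chartSource_mem_nhds_one (E := E) (G := G)]
      with g hg hgs
    rw [← hg, chartSymm_chart hgs]
  rw [continuous_iff_continuousAt]
  intro g
  have e : (AdE E : G → E →L[ℝ] E) = fun h => (AdE E g).comp (AdE E (g⁻¹ * h)) := by
    funext h
    rw [← AdE_mul, mul_inv_cancel_left]
  rw [e]
  have h3 : ContinuousAt (fun h => AdE E (g⁻¹ * h)) g := by
    refine ContinuousAt.comp (g := AdE E) (f := fun h => g⁻¹ * h) ?_ (by fun_prop)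
    rw [inv_mul_cancel]
    exact h1
  exact continuousAt_const.clm_comp h3

lemma adChart_one : adChart E G (chart E (1 : G)) = ContinuousLinearMap.id ℝ E := by
  rw [← eventually_AdE_eq.self_of_nhds, chartSymm_chart_one, AdE_one]

/-! ### The bracket is the derivative of the adjoint representation -/

/-- The Lie bracket of `𝔤₀` in terms of the invariant fields in the chart. -/
lemma lieEquiv_lie (X Y : LieAlg E G) : lieEquiv E G ⁅X, Y⁆ =
    fderiv ℝ (fieldChart E G) (chart E (1 : G)) (lieEquiv E G X) (lieEquiv E G Y) -
    fderiv ℝ (fieldChart E G) (chart E (1 : G)) (lieEquiv E G Y) (lieEquiv E G X) := by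
  have hI : IsManifold 𝓘(ℝ, E) ∞ G := LieGroup.toContMDiffMul.toIsManifold
  have hI1 : IsManifold 𝓘(ℝ, E) 1 G := IsManifold.of_le (n := ∞) (by simp)
  let V : LieAlg E G → E → E := fun Z => VectorField.mpullbackWithin 𝓘(ℝ, E) 𝓘(ℝ, E)
    (extChartAt 𝓘(ℝ, E) (1 : G)).symm (mulInvariantVectorField Z) (range 𝓘(ℝ, E))
  have hV : ∀ Z : LieAlg E G, V Z =ᶠ[𝓝 (chart E (1 : G))]
      fun x => fieldChart E G x (lieEquiv E G Z) := by
    intro Z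
    have hs := continuousAt_chartSymm (E := E) (G := G)
    rw [ContinuousAt, chartSymm_chart_one] at hs
    filter_upwards [hs.eventually
        (eventually_mfderiv_chart_mulInvariantVectorField (E := E) (G := G)),
      extChartAt_target_mem_nhds (I := 𝓘(ℝ, E)) (1 : G), eventually_chart_chartSymm (G := G)]
      with x hx hxt hxx
    have h1 := hx.2 Z
    rw [hxx] at h1
    refine Eq.trans ?_ h1
    have h2 := ContinuousLinearMap.inverse_eq
      (mfderivWithin_extChartAt_symm_comp_mfderiv_extChartAt (I := 𝓘(ℝ, E)) hxt)
      (mfderiv_extChartAt_comp_mfderivWithin_extChartAt_symm (I := 𝓘(ℝ, E)) hxt)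
    exact congrArg (fun L : E →L[ℝ] E => L (mulInvariantVectorField Z (chartSymm G x))) h2
  have hb : lieEquiv E G ⁅X, Y⁆ = VectorField.lieBracketWithin ℝ (V X) (V Y)
      ((extChartAt 𝓘(ℝ, E) (1 : G)).symm ⁻¹' univ ∩ range 𝓘(ℝ, E)) (chart E (1 : G)) := by
    let b : E := VectorField.lieBracketWithin ℝ (V X) (V Y)
      ((extChartAt 𝓘(ℝ, E) (1 : G)).symm ⁻¹' univ ∩ range 𝓘(ℝ, E)) (chart E (1 : G))
    have h1 : lieEquiv E G ⁅X, Y⁆ =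
      (mfderiv 𝓘(ℝ, E) 𝓘(ℝ, E) (extChartAt 𝓘(ℝ, E) (1 : G)) 1 : E →L[ℝ] E).inverse b := rfl
    have h2 : (mfderiv 𝓘(ℝ, E) 𝓘(ℝ, E) (extChartAt 𝓘(ℝ, E) (1 : G)) 1 : E →L[ℝ] E) =
      ContinuousLinearMap.id ℝ E := mfderiv_extChartAt_self
    have key : ∀ D : E →L[ℝ] E, D = ContinuousLinearMap.id ℝ E → D.inverse b = b := by
      rintro _ rfl
      rw [ContinuousLinearMap.inverse_id, ContinuousLinearMap.id_apply]
    exact h1.trans (key _ h2)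
  rw [hb, ModelWithCorners.range_eq_univ, preimage_univ, inter_self,
    VectorField.lieBracketWithin_univ, VectorField.lieBracket_eq]
  have hd : ∀ Z : LieAlg E G, fderiv ℝ (V Z) (chart E (1 : G)) =
      (fderiv ℝ (fieldChart E G) (chart E (1 : G))).flip (lieEquiv E G Z) := by
    intro Z
    rw [(hV Z).fderiv_eq]
    have := (contDiffAt_fieldChart (E := E) (G := G)).differentiableAt (by simp)
    refine HasFDerivAt.fderiv ?_
    refine (this.hasFDerivAt.clm_apply (hasFDerivAt_const (lieEquiv E G Z) _)).congr_fderiv ?_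
    ext; simp
  have hv : ∀ Z : LieAlg E G, V Z (chart E (1 : G)) = lieEquiv E G Z := by
    intro Z
    rw [(hV Z).self_of_nhds]
    change fieldChart E G (chart E (1 : G)) (lieEquiv E G Z) = _
    rw [fieldChart_one]
    rfl
  simp only [hd, hv, ContinuousLinearMap.flip_apply]

/-- The derivative of the adjoint representation at `1` is the bracket. -/
lemma fderiv_adChart (X Y : LieAlg E G) :
    fderiv ℝ (adChart E G) (chart E (1 : G)) (lieEquiv E G X) (lieEquiv E G Y) =
      lieEquiv E G ⁅X, Y⁆ := by
  set x₀ := chart E (1 : G) with hx₀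
  set M := mulChart E G with hM
  have hMs := contDiffAt_mulChart (E := E) (G := G)
  -- derivative of right translations
  let R : E → E →L[ℝ] E := fun x => (fderiv ℝ M (x₀, x)).comp (ContinuousLinearMap.inl ℝ E E)
  have hD2 : HasFDerivAt (fderiv ℝ M) (fderiv ℝ (fderiv ℝ M) (x₀, x₀)) (x₀, x₀) := by
    have h : ContDiffAt ℝ ∞ (fderiv ℝ M) (x₀, x₀) := hMs.fderiv_right (by simp)
    exact (h.differentiableAt (by simp)).hasFDerivAt
  have hR' : HasFDerivAt R ((ContinuousLinearMap.compL ℝ E (E × E) E).flip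
      (ContinuousLinearMap.inl ℝ E E) ∘L (fderiv ℝ (fderiv ℝ M) (x₀, x₀) ∘L
        ContinuousLinearMap.inr ℝ E E)) x₀ := by
    have h1 : HasFDerivAt (fun x => fderiv ℝ M (x₀, x)) (fderiv ℝ (fderiv ℝ M) (x₀, x₀) ∘L
        ContinuousLinearMap.inr ℝ E E) x₀ :=
      HasFDerivAt.comp x₀ (g := fderiv ℝ M) (f := fun x => (x₀, x)) hD2
        (hasFDerivAt_prodMk_right x₀ _)
    exact ((ContinuousLinearMap.compL ℝ E (E × E) E).flip
      (ContinuousLinearMap.inl ℝ E E)).hasFDerivAt.comp x₀ h1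
  have hF' : HasFDerivAt (fieldChart E G) ((ContinuousLinearMap.compL ℝ E (E × E) E).flip
      (ContinuousLinearMap.inr ℝ E E) ∘L (fderiv ℝ (fderiv ℝ M) (x₀, x₀) ∘L
        ContinuousLinearMap.inl ℝ E E)) x₀ := by
    have h1 : HasFDerivAt (fun x => fderiv ℝ M (x, x₀)) (fderiv ℝ (fderiv ℝ M) (x₀, x₀) ∘L
        ContinuousLinearMap.inl ℝ E E) x₀ :=
      HasFDerivAt.comp x₀ (g := fderiv ℝ M) (f := fun x => (x, x₀)) hD2
        (hasFDerivAt_prodMk_left _ _)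
    exact ((ContinuousLinearMap.compL ℝ E (E × E) E).flip
      (ContinuousLinearMap.inr ℝ E E)).hasFDerivAt.comp x₀ h1
  have hA' := ((contDiffAt_adChart (E := E) (G := G)).differentiableAt (by simp)).hasFDerivAt
  have hR1 : R x₀ = ContinuousLinearMap.id ℝ E := by
    have : fderiv ℝ M (x₀, x₀) = _ := hasStrictFDerivAt_mulChart.hasFDerivAt.fderiv
    ext v
    simp [R, this]
  -- `R_x Ad(x) = L_x` on tangent vectors at `1`
  have hid : ∀ᶠ x in 𝓝 x₀, (R x).comp (adChart E G x) = fieldChart E G x := by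
    have hcr : Tendsto (fun x : E => (x₀, x)) (𝓝 x₀) (𝓝 (x₀, x₀)) :=
      (by fun_prop : Continuous _).tendsto' _ _ rfl
    have hs := continuousAt_chartSymm (E := E) (G := G)
    rw [ContinuousAt, chartSymm_chart_one] at hs
    filter_upwards [hcr.eventually (eventually_differentiableAt_of_contDiffAt hMs),
      tendsto_prodMk_left_chart.eventually (eventually_differentiableAt_of_contDiffAt
        (contDiffAt_conjChart (E := E) (G := G))),
      eventually_fieldChart_eq (E := E) (G := G),
      hs.eventually (chartSource_mem_nhds_one (E := E) (G := G)),
      eventually_chart_chartSymm (E := E) (G := G)] with x h1 h2 h3 h4 h5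
    have hK : HasFDerivAt (fun y => conjChart E G (x, y)) (adChart E G x) x₀ :=
      HasFDerivAt.comp x₀ (g := conjChart E G) (f := fun y => (x, y)) h2.hasFDerivAt
        (hasFDerivAt_prodMk_right x _)
    have hK0 : conjChart E G (x, x₀) = x₀ := by
      simp [conjChart, hx₀, chartSymm_chart_one]
    have hRx : HasFDerivAt (fun z => M (z, x)) (R x) x₀ :=
      HasFDerivAt.comp x₀ (g := M) (f := fun z => (z, x)) h1.hasFDerivAt
        (hasFDerivAt_prodMk_left _ _)
    have hcomp : HasFDerivAt (fun y => M (conjChart E G (x, y), x)) ((R x).comp (adChart E G x))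
        x₀ := HasFDerivAt.comp x₀ (g := fun z => M (z, x)) (f := fun y => conjChart E G (x, y))
          (by rw [hK0]; exact hRx) hK
    refine hcomp.unique (h3.congr_of_eventuallyEq ?_)
    have hcs : ∀ᶠ y in 𝓝 x₀, chartSymm G x * chartSymm G y * (chartSymm G x)⁻¹ ∈
        chartSource E G := by
      have : IsTopologicalGroup G := topologicalGroup_of_lieGroup 𝓘(ℝ, E) ∞
      have hc : Tendsto (fun y => chartSymm G x * chartSymm G y * (chartSymm G x)⁻¹) (𝓝 x₀)
          (𝓝 (chartSymm G x * 1 * (chartSymm G x)⁻¹)) :=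
        (tendsto_const_nhds.mul hs).mul tendsto_const_nhds
      rw [mul_one, mul_inv_cancel] at hc
      exact hc.eventually (chartSource_mem_nhds_one (E := E) (G := G))
    filter_upwards [hcs] with y hy
    simp [hM, mulChart, conjChart, chartSymm_chart hy]
  have hprod := hR'.clm_comp hA'
  have h2 := hprod.congr_of_eventuallyEq (f₁ := fieldChart E G)
    (by filter_upwards [hid] with x hx using hx.symm)
  have h3 := h2.unique hF'
  have h4 := congrArg (fun L : E →L[ℝ] E →L[ℝ] E => L (lieEquiv E G X) (lieEquiv E G Y)) h3
  have hF : ∀ X Y : E, fderiv ℝ (fieldChart E G) x₀ X Y =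
      fderiv ℝ (fderiv ℝ M) (x₀, x₀) (X, 0) (0, Y) := by
    intro X Y
    rw [hF'.fderiv]
    rfl
  have hsymm : ∀ v w : E × E, fderiv ℝ (fderiv ℝ M) (x₀, x₀) v w =
      fderiv ℝ (fderiv ℝ M) (x₀, x₀) w v :=
    fun v w => (hMs.isSymmSndFDerivAt
      (by rw [minSmoothness_of_isRCLikeNormedField]; exact ENat.LEInfty.out)).eq v w
  rw [lieEquiv_lie, hF, hF]
  have hA1 : adChart E G x₀ = ContinuousLinearMap.id ℝ E := adChart_one
  simp only [hR1, hA1, ← hx₀, add_apply, ContinuousLinearMap.comp_apply,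
    ContinuousLinearMap.compL_apply, ContinuousLinearMap.flip_apply,
    ContinuousLinearMap.inl_apply, ContinuousLinearMap.inr_apply,
    ContinuousLinearMap.id_apply, ContinuousLinearMap.id_comp] at h4
  rw [hsymm (lieEquiv E G Y, 0), ← h4]
  abel

/-- The adjoint action moves along one-parameter subgroups by the bracket. -/
lemma hasDerivAt_AdE (X : LieAlg E G) (y : E) (t : ℝ) :
    HasDerivAt (fun s : ℝ => AdE E (expG (s • X)) y)
      (AdE E (expG (t • X)) (lieEquiv E G ⁅X, (lieEquiv E G).symm y⁆)) t := by
  have h0 : HasDerivAt (fun s : ℝ => AdE E (expG (s • X)) y)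
      (lieEquiv E G ⁅X, (lieEquiv E G).symm y⁆) 0 := by
    have hA' := ((contDiffAt_adChart (E := E) (G := G)).differentiableAt (by simp)).hasFDerivAt
    have hs : HasStrictDerivOne (fun t : ℝ => expE E G (t • lieEquiv E G X)) _ :=
      hasStrictDerivOne_expE_clm (ContinuousLinearMap.toSpanSingleton ℝ (lieEquiv E G X))
    have h1 := hs.deriv.hasFDerivAt.hasDerivAt
    rw [ContinuousLinearMap.toSpanSingleton_apply, one_smul] at h1
    have hA2 : HasFDerivAt (adChart E G) (fderiv ℝ (adChart E G) (chart E (1 : G)))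
        (chart E (expE E G ((0 : ℝ) • lieEquiv E G X))) := by
      rw [zero_smul, expE_zero]; exact hA'
    have h2a : HasDerivAt (fun t : ℝ => adChart E G (chart E (expE E G (t • lieEquiv E G X))))
        (fderiv ℝ (adChart E G) (chart E (1 : G)) (lieEquiv E G X)) 0 :=
      HasFDerivAt.comp_hasDerivAt (l := adChart E G)
        (f := fun t : ℝ => chart E (expE E G (t • lieEquiv E G X))) (0 : ℝ) hA2 h1
    have h2 : HasDerivAt (fun t : ℝ => adChart E G (chart E (expE E G (t • lieEquiv E G X))) y)
        (fderiv ℝ (adChart E G) (chart E (1 : G)) (lieEquiv E G X) y) 0 :=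
      ((ContinuousLinearMap.apply ℝ E y).hasFDerivAt).comp_hasDerivAt (0 : ℝ) h2a
    have h3 : fderiv ℝ (adChart E G) (chart E (1 : G)) (lieEquiv E G X) y =
        lieEquiv E G ⁅X, (lieEquiv E G).symm y⁆ := fderiv_adChart X ((lieEquiv E G).symm y)
    rw [h3] at h2
    refine h2.congr_of_eventuallyEq ?_
    have hc : Tendsto (fun t : ℝ => expE E G (t • lieEquiv E G X)) (𝓝 0) (𝓝 1) :=
      (continuous_expE_smul (lieEquiv E G X)).tendsto' _ _ (by simp [expE_zero])
    filter_upwards [hc.eventually (chartSource_mem_nhds_one (E := E) (G := G)),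
      (hc.eventually ((continuousAt_chart (one_mem_chartSource (E := E) (G := G))).eventually
        (eventually_AdE_eq (E := E) (G := G))))] with s hs1 hs2
    rw [← hs2, chartSymm_chart hs1]
    rfl
  have h1 : HasDerivAt (fun s : ℝ => s - t) 1 t := (hasDerivAt_id t).sub_const t
  have h2 : HasDerivAt (fun s : ℝ => AdE E (expG ((s - t) • X)) y)
      (lieEquiv E G ⁅X, (lieEquiv E G).symm y⁆) t := by
    have h0' : HasDerivAt (fun s : ℝ => AdE E (expG (s • X)) y)
      (lieEquiv E G ⁅X, (lieEquiv E G).symm y⁆) (t - t) := by rwa [sub_self]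
    have h3 := HasDerivAt.scomp (g₁ := fun s : ℝ => AdE E (expG (s • X)) y)
      (h := fun s : ℝ => s - t) t h0' h1
    rw [one_smul] at h3
    exact h3
  have h3 := (AdE E (expG (t • X))).hasFDerivAt.comp_hasDerivAt t h2
  refine h3.congr_of_eventuallyEq (Eventually.of_forall fun s => ?_)
  simp only [Function.comp_apply]
  rw [← ContinuousLinearMap.comp_apply, ← AdE_mul, ← expG_add_smul]
  simp

lemma hasDerivAt_Ad (l : LieAlg E G →ₗ[ℝ] ℝ) (X Y : LieAlg E G) (t : ℝ) :
    HasDerivAt (fun s : ℝ => l (Ad E (expG (s • X)) Y)) (l (Ad E (expG (t • X)) ⁅X, Y⁆)) t := by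
  let l' : E →L[ℝ] ℝ := LinearMap.toContinuousLinearMap (l ∘ₗ (lieEquiv E G).symm.toLinearMap)
  exact l'.hasFDerivAt.comp_hasDerivAt t (hasDerivAt_AdE X (lieEquiv E G Y) t)

lemma continuous_Ad (l : LieAlg E G →ₗ[ℝ] ℝ) (Y : LieAlg E G) :
    Continuous fun g : G => l (Ad E g Y) := by
  let l' : E →L[ℝ] ℝ := LinearMap.toContinuousLinearMap (l ∘ₗ (lieEquiv E G).symm.toLinearMap)
  exact l'.continuous.comp (continuous_AdE.clm_apply continuous_const)

/-- Linear functionals separate the points of the Lie algebra. -/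
lemma eq_of_forall_dual {X Y : LieAlg E G} (h : ∀ l : LieAlg E G →ₗ[ℝ] ℝ, l X = l Y) : X = Y :=
  sub_eq_zero.mp ((Module.forall_dual_apply_eq_zero_iff ℝ (X - Y)).mp fun l => by
    rw [map_sub, h, sub_self])

lemma Ad_expG_of_lie_eq_zero {X Y : LieAlg E G} (h : ⁅X, Y⁆ = 0) : Ad E (expG X) Y = Y := by
  refine eq_of_forall_dual fun l => ?_
  have h1 : ∀ t : ℝ, HasDerivAt (fun s : ℝ => l (Ad E (expG (s • X)) Y)) 0 t := by
    intro t
    simpa [h] using hasDerivAt_Ad l X Y t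
  have := is_const_of_deriv_eq_zero (fun t => (h1 t).differentiableAt) (fun t => (h1 t).deriv) 1 0
  simpa [Ad_one] using this

lemma lie_eq_zero_of_Ad {X Y : LieAlg E G} (h : ∀ t : ℝ, Ad E (expG (t • X)) Y = Y) :
    ⁅X, Y⁆ = 0 := by
  refine eq_of_forall_dual fun l => ?_
  have h1 := hasDerivAt_Ad l X Y 0
  simp only [h] at h1
  have := h1.unique (hasDerivAt_const 0 (l Y))
  rwa [zero_smul, expG_zero, Ad_one, ← map_zero l] at this

/-! ### Commuting exponentials and closed abelian subgroups -/

lemma commute_expG {X Y : LieAlg E G} (h : ⁅X, Y⁆ = 0) : expG X * expG Y = expG Y * expG X := by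
  have := conj_expG (expG X) Y
  rw [Ad_expG_of_lie_eq_zero h] at this
  exact mul_inv_eq_iff_eq_mul.mp this

lemma expG_add {X Y : LieAlg E G} (h : ⁅X, Y⁆ = 0) : expG (X + Y) = expG X * expG Y := by
  have hx : HasStrictDerivOne (fun t : ℝ => expE E G (t • lieEquiv E G X)) _ :=
    hasStrictDerivOne_expE_clm (ContinuousLinearMap.toSpanSingleton ℝ (lieEquiv E G X))
  have hy : HasStrictDerivOne (fun t : ℝ => expE E G (t • lieEquiv E G Y)) _ :=
    hasStrictDerivOne_expE_clm (ContinuousLinearMap.toSpanSingleton ℝ (lieEquiv E G Y))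
  have hxy := hx.mul hy
  have hd := hxy.deriv.hasFDerivAt.hasDerivAt
  rw [add_apply, ContinuousLinearMap.toSpanSingleton_apply,
    ContinuousLinearMap.toSpanSingleton_apply, one_smul, one_smul, ← map_add] at hd
  have hcomm : ∀ s t : ℝ, expG (s • X) * expG (t • Y) = expG (t • Y) * expG (s • X) := by
    intro s t
    exact commute_expG (by rw [smul_lie, lie_smul, h, smul_zero, smul_zero])
  have h2 := eq_expE_of_hom
    (γ := fun t : ℝ => expE E G (t • lieEquiv E G X) * expE E G (t • lieEquiv E G Y))
    (by simp [expE_zero]) (fun s t => by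
      have e : ∀ Z : LieAlg E G, ∀ u : ℝ, expE E G (u • lieEquiv E G Z) = expG (u • Z) :=
        fun _ _ => rfl
      simp only [e, expG_add_smul]
      rw [mul_mul_mul_comm_of_comm]
      exact hcomm t s)
    hxy.continuousAt hd 1
  simp only [one_smul] at h2
  exact h2.symm
where
  mul_mul_mul_comm_of_comm {a b c d : G} (h : b * c = c * b) :
      a * b * (c * d) = a * c * (b * d) := by
    rw [mul_assoc, ← mul_assoc b, h, mul_assoc, mul_assoc]

variable (E) in
lemma lieOf_eq_span (H : Subgroup G) :
    lieOf E H = Submodule.span ℝ {X : LieAlg E G | ∀ t : ℝ, expG (t • X) ∈ H} := by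
  rw [lieOf]
  congr 1
  ext X
  constructor
  · rintro ⟨γ, hγ, h⟩ t
    rw [← hγ.eq_expG]
    exact h t
  · exact fun h => ⟨_, isOneParam_expG X, h⟩

lemma lie_eq_zero_of_commute {X Y : LieAlg E G}
    (h : ∀ s t : ℝ, expG (s • X) * expG (t • Y) = expG (t • Y) * expG (s • X)) : ⁅X, Y⁆ = 0 := by
  refine lie_eq_zero_of_Ad fun t => expG_smul_injective fun s => ?_
  rw [← map_smul, ← conj_expG, h, mul_inv_cancel_right]

/-- The Lie algebra of an abelian subgroup. -/
lemma mem_lieOf_iff {A : Subgroup G} (hA : ∀ x ∈ A, ∀ y ∈ A, x * y = y * x) {X : LieAlg E G} :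
    X ∈ lieOf E A ↔ ∀ t : ℝ, expG (t • X) ∈ A := by
  rw [lieOf_eq_span]
  refine ⟨fun hX => ?_, fun h => Submodule.subset_span h⟩
  induction hX using Submodule.span_induction with
  | mem X hX => exact hX
  | zero => intro t; rw [smul_zero, expG_zero]; exact A.one_mem
  | add X Y _ _ hX hY =>
    intro t
    have : ⁅X, Y⁆ = 0 := lie_eq_zero_of_commute fun s t => hA _ (hX s) _ (hY t)
    rw [smul_add, expG_add (by rw [smul_lie, lie_smul, this, smul_zero, smul_zero])]
    exact A.mul_mem (hX t) (hY t)
  | smul c X _ hX => intro t; rw [smul_smul]; exact hX _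

lemma expG_mem_of_mem_lieOf {A : Subgroup G} (hA : ∀ x ∈ A, ∀ y ∈ A, x * y = y * x)
    {X : LieAlg E G} (hX : X ∈ lieOf E A) : expG X ∈ A := by
  simpa using (mem_lieOf_iff hA).mp hX 1

lemma lie_eq_zero_of_mem_lieOf {A : Subgroup G} (hA : ∀ x ∈ A, ∀ y ∈ A, x * y = y * x)
    {X Y : LieAlg E G} (hX : X ∈ lieOf E A) (hY : Y ∈ lieOf E A) : ⁅X, Y⁆ = 0 :=
  lie_eq_zero_of_commute fun s t =>
    hA _ ((mem_lieOf_iff hA).mp hX s) _ ((mem_lieOf_iff hA).mp hY t)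

lemma expE_nsmul (n : ℕ) (x : E) : expE E G ((n : ℝ) • x) = expE E G x ^ n := by
  rw [expE, map_smul, expG_nsmul, expE]

lemma expE_zsmul (n : ℤ) (x : E) : expE E G ((n : ℝ) • x) = expE E G x ^ n := by
  obtain ⟨m, rfl | rfl⟩ := n.eq_nat_or_neg
  · rw [Int.cast_natCast, expE_nsmul, zpow_natCast]
  · rw [Int.cast_neg, Int.cast_natCast, neg_smul, zpow_neg, zpow_natCast, ← expE_nsmul, expE, expE,
      map_neg, expG_neg]

/-- The exponential map is continuous. -/
theorem continuous_expE : Continuous (expE E G) := by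
  have : IsTopologicalGroup G := topologicalGroup_of_lieGroup 𝓘(ℝ, E) ∞
  -- continuity near `0`
  obtain ⟨K, s, hs, hK⟩ :=
    (hasStrictFDerivAt_chart_expE (E := E) (G := G)).exists_lipschitzOnWith
  have h0 : ∀ᶠ x in 𝓝 (0 : E), ContinuousAt (expE E G) x := by
    have h1 : ∀ᶠ x in 𝓝 (0 : E), expE E G x ∈ chartSource E G :=
      tendsto_expE_zero.eventually (chartSource_mem_nhds_one (E := E) (G := G))
    filter_upwards [eventually_eventually_nhds.mpr h1,
      eventually_eventually_nhds.mpr (show ∀ᶠ x in 𝓝 (0 : E), x ∈ s from hs)] with x hx hxs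
    have hc : ContinuousAt (fun x => chart E (expE E G x)) x := hK.continuousOn.continuousAt hxs
    have hc2 : ContinuousAt (chartSymm G : E → G) (chart E (expE E G x)) :=
      continuousAt_extChartAt_symm'' ((extChartAt 𝓘(ℝ, E) (1 : G)).map_source hx.self_of_nhds)
    have hc3 : ContinuousAt (fun x => chartSymm G (chart E (expE E G x))) x :=
      ContinuousAt.comp (g := chartSymm G) hc2 hc
    refine hc3.congr ?_
    filter_upwards [hx] with y hy using chartSymm_chart hy
  obtain ⟨r, hr, hball⟩ := Metric.eventually_nhds_iff_ball.mp h0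
  rw [continuous_iff_continuousAt]
  intro x
  obtain ⟨n, hn⟩ := exists_nat_gt (‖x‖ / r)
  have hn0 : (0 : ℝ) < n := (by positivity : (0 : ℝ) ≤ ‖x‖ / r).trans_lt hn
  have e : expE E G = fun y => expE E G ((n : ℝ)⁻¹ • y) ^ n := by
    funext y
    rw [← expE_nsmul, smul_smul, mul_inv_cancel₀ hn0.ne', one_smul]
  rw [e]
  have hx : (n : ℝ)⁻¹ • x ∈ Metric.ball (0 : E) r := by
    rw [mem_ball_zero_iff, norm_smul, norm_inv, Real.norm_of_nonneg hn0.le,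
      inv_mul_lt_iff₀ hn0]
    rwa [div_lt_iff₀ hr] at hn
  exact (ContinuousAt.comp (g := expE E G) (f := fun y => (n : ℝ)⁻¹ • y) (hball _ hx)
    (by fun_prop)).pow n

/-- A subspace of `E` is the range of a continuous projection. -/
lemma exists_projection (S : Submodule ℝ E) : ∃ P : E →L[ℝ] E, (∀ x, P x ∈ S) ∧ ∀ x ∈ S, P x = x := by
  obtain ⟨f, hf⟩ := LinearMap.exists_leftInverse_of_injective S.subtype S.ker_subtype
  refine ⟨LinearMap.toContinuousLinearMap (S.subtype ∘ₗ f), fun x => (f x).2, fun x hx => ?_⟩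
  have := LinearMap.congr_fun hf ⟨x, hx⟩
  exact congrArg Subtype.val this

/-- Near `1` a closed abelian subgroup consists of exponentials of its Lie algebra: otherwise the
directions transversal to the Lie algebra in which the subgroup accumulates at `1` would converge
to an element of the Lie algebra. -/
lemma eventually_mem_expG_of_isClosed {A : Subgroup G} (hA : ∀ x ∈ A, ∀ y ∈ A, x * y = y * x)
    (hc : IsClosed (A : Set G)) :
    ∀ᶠ g in 𝓝 (1 : G), g ∈ A → ∃ X ∈ lieOf E A, expG X = g := by
  have : ProperSpace E := FiniteDimensional.proper_real E
  have : CompleteSpace E := FiniteDimensional.complete ℝ E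
  obtain ⟨P, hPS, hP⟩ := exists_projection ((lieOf E A).map (lieEquiv E G).toLinearMap)
  have hmem : ∀ x : E, P x = x → ∀ t : ℝ, expE E G (t • x) ∈ A := by
    intro x hx t
    obtain ⟨X, hX, hXx⟩ := hPS x
    rw [hx] at hXx
    rw [← hXx]
    exact (mem_lieOf_iff hA).mp hX t
  have hPP : ∀ x, P (P x) = P x := fun x => hP _ (hPS x)
  have hΨ := (hasStrictDerivOne_expE_clm (G := G) P).mul
    (hasStrictDerivOne_expE_clm (G := G) (ContinuousLinearMap.id ℝ E - P))
  rw [add_sub_cancel] at hΨ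
  have hmap := hΨ.nhds_le_map (fun x => ⟨x, rfl⟩)
  by_contra hcon
  rw [not_eventually] at hcon
  have hex : ∀ n : ℕ, ∃ y : E, y ≠ 0 ∧ P y = 0 ∧ expE E G y ∈ A ∧
      ‖y‖ < ‖ContinuousLinearMap.id ℝ E - P‖ / (n + 1) + 1 / (n + 1) := by
    intro n
    have hU : (fun v => expE E G (P v) * expE E G ((ContinuousLinearMap.id ℝ E - P) v)) ''
        Metric.ball (0 : E) (1 / (n + 1)) ∈ 𝓝 (1 : G) :=
      hmap (image_mem_map (Metric.ball_mem_nhds _ (by positivity)))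
    obtain ⟨g, hg, v, hv, rfl⟩ := (hcon.and_eventually hU).exists
    push Not at hg
    refine ⟨(ContinuousLinearMap.id ℝ E - P) v, fun h0 => ?_, ?_, ?_, ?_⟩
    · obtain ⟨X, hX, hXv⟩ := hPS v
      refine hg.2 X hX ?_
      rw [h0, expE_zero, mul_one, ← hXv]
      rfl
    · simp [hPP]
    · have h1 : expE E G (P v) ∈ A := by simpa using hmem (P v) (hPP v) 1
      exact (A.mul_mem_cancel_left h1).mp hg.1
    · rw [mem_ball_zero_iff] at hv
      have h1 := (ContinuousLinearMap.id ℝ E - P).le_opNorm v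
      have h2 : ‖ContinuousLinearMap.id ℝ E - P‖ * ‖v‖ ≤
          ‖ContinuousLinearMap.id ℝ E - P‖ * (1 / (n + 1)) :=
        mul_le_mul_of_nonneg_left hv.le (norm_nonneg _)
      have h3 : (0 : ℝ) < 1 / (n + 1) := by positivity
      rw [mul_one_div] at h2
      linarith
  choose y hy0 hyP hyA hyn using hex
  have hy : Tendsto (fun n => ‖y n‖) atTop (𝓝 0) := by
    have h1 := (tendsto_const_div_atTop_nhds_zero_nat ‖ContinuousLinearMap.id ℝ E - P‖).comp
      (tendsto_add_atTop_nat 1)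
    have h2 := (tendsto_const_div_atTop_nhds_zero_nat (1 : ℝ)).comp (tendsto_add_atTop_nat 1)
    have h3 := h1.add h2
    rw [add_zero] at h3
    refine squeeze_zero (fun n => norm_nonneg _) (fun n => (hyn n).le) ?_
    simpa [Function.comp_def] using h3
  obtain ⟨u, hu, φ, hφ, hlim⟩ := (isCompact_sphere (0 : E) 1).tendsto_subseq
    (x := fun n => ‖y n‖⁻¹ • y n) (fun n => by simp [norm_smul, hy0 n])
  have hPu : P u = 0 := by
    have h1 := (P.continuous.tendsto u).comp hlim
    refine tendsto_nhds_unique h1 ?_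
    refine tendsto_const_nhds.congr fun n => ?_
    simp [hyP]
  have huA : ∀ t : ℝ, expE E G (t • u) ∈ A := by
    intro t
    have hk : Tendsto (fun n => ((⌊t / ‖y (φ n)‖⌋ : ℝ) * ‖y (φ n)‖)) atTop (𝓝 t) := by
      have h1 := hy.comp hφ.tendsto_atTop
      have hlow : Tendsto (fun n => t - ‖y (φ n)‖) atTop (𝓝 t) := by
        simpa using tendsto_const_nhds.sub h1
      refine tendsto_of_tendsto_of_tendsto_of_le_of_le hlow tendsto_const_nhds
        (fun n => ?_) (fun n => ?_)
      · have hp : 0 < ‖y (φ n)‖ := norm_pos_iff.mpr (hy0 _)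
        have := (Int.sub_one_lt_floor (t / ‖y (φ n)‖)).le
        have := mul_le_mul_of_nonneg_right this hp.le
        rw [sub_mul, div_mul_cancel₀ _ hp.ne', one_mul] at this
        exact this
      · have hp : 0 < ‖y (φ n)‖ := norm_pos_iff.mpr (hy0 _)
        have := mul_le_mul_of_nonneg_right (Int.floor_le (t / ‖y (φ n)‖)) hp.le
        rw [div_mul_cancel₀ _ hp.ne'] at this
        exact this
    have h2 := (continuous_expE (E := E) (G := G)).continuousAt.tendsto.comp (hk.smul hlim)
    refine hc.mem_of_tendsto h2 (Eventually.of_forall fun n => ?_)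
    have hp : ‖y (φ n)‖ ≠ 0 := norm_ne_zero_iff.mpr (hy0 _)
    simp only [Function.comp_apply]
    rw [smul_smul, mul_assoc, mul_inv_cancel₀ hp, mul_one, expE_zsmul]
    exact A.zpow_mem (hyA _) _
  have huL : (lieEquiv E G).symm u ∈ lieOf E A := by
    rw [mem_lieOf_iff hA]
    intro t
    simpa [expE] using huA t
  have := hP u ⟨_, huL, by simp⟩
  rw [hPu] at this
  rw [← this] at hu
  simp at hu

/-- The image under the exponential map of the Lie algebra of an abelian subgroup. -/
def expSubgroup {A : Subgroup G} (hA : ∀ x ∈ A, ∀ y ∈ A, x * y = y * x) : Subgroup G where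
  carrier := {g | ∃ X ∈ lieOf E A, expG X = g}
  mul_mem' := by
    rintro a b ⟨X, hX, ha⟩ ⟨Y, hY, hb⟩
    exact ⟨X + Y, Submodule.add_mem _ hX hY, by
      rw [expG_add (lie_eq_zero_of_mem_lieOf hA hX hY), ha, hb]⟩
  one_mem' := ⟨0, Submodule.zero_mem _, expG_zero⟩
  inv_mem' := by
    rintro a ⟨X, hX, ha⟩
    exact ⟨-X, Submodule.neg_mem _ hX, by rw [expG_neg, ha]⟩

lemma expSubgroup_le {A : Subgroup G} (hA : ∀ x ∈ A, ∀ y ∈ A, x * y = y * x) :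
    expSubgroup (E := E) hA ≤ A := by
  rintro _ ⟨X, hX, rfl⟩
  exact expG_mem_of_mem_lieOf hA hX

lemma expSubgroup_comm {A : Subgroup G} (hA : ∀ x ∈ A, ∀ y ∈ A, x * y = y * x) :
    ∀ x ∈ expSubgroup (E := E) hA, ∀ y ∈ expSubgroup (E := E) hA, x * y = y * x :=
  fun x hx y hy => hA x (expSubgroup_le hA hx) y (expSubgroup_le hA hy)

lemma lieOf_expSubgroup {A : Subgroup G} (hA : ∀ x ∈ A, ∀ y ∈ A, x * y = y * x) :
    lieOf E (expSubgroup (E := E) hA) = lieOf E A := by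
  ext X
  rw [mem_lieOf_iff (expSubgroup_comm hA)]
  refine ⟨fun h => (mem_lieOf_iff hA).mpr fun t => expSubgroup_le hA (h t), fun h t => ?_⟩
  exact ⟨t • X, Submodule.smul_mem _ t h, rfl⟩

lemma isClopen_expSubgroup {A : Subgroup G} (hA : ∀ x ∈ A, ∀ y ∈ A, x * y = y * x)
    (hc : IsClosed (A : Set G)) :
    IsClopen ((expSubgroup (E := E) hA).subgroupOf A : Set A) := by
  have : IsTopologicalGroup G := topologicalGroup_of_lieGroup 𝓘(ℝ, E) ∞
  have hmem : ((expSubgroup (E := E) hA).subgroupOf A : Set A) ∈ 𝓝 (1 : A) := by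
    have h1 : Tendsto (fun a : A => (a : G)) (𝓝 1) (𝓝 1) := continuous_subtype_val.tendsto' _ _ rfl
    filter_upwards [h1.eventually (eventually_mem_expG_of_isClosed (E := E) hA hc)] with a ha
    exact ha a.2
  have hop := Subgroup.isOpen_of_mem_nhds _ hmem
  exact ⟨Subgroup.isClosed_of_isOpen _ hop, hop⟩

lemma isClosed_expSubgroup {A : Subgroup G} (hA : ∀ x ∈ A, ∀ y ∈ A, x * y = y * x)
    (hc : IsClosed (A : Set G)) : IsClosed (expSubgroup (E := E) hA : Set G) := by
  have h := hc.isClosedEmbedding_subtypeVal.isClosedMap _ (isClopen_expSubgroup (E := E) hA hc).1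
  have e : Subtype.val '' ((expSubgroup (E := E) hA).subgroupOf A : Set A) =
      (expSubgroup (E := E) hA : Set G) := by
    ext g
    exact ⟨by rintro ⟨a, ha, rfl⟩; exact ha, fun hg => ⟨⟨g, expSubgroup_le hA hg⟩, hg, rfl⟩⟩
  exact e ▸ h

/-- The exponential map of a closed connected abelian subgroup is onto. -/
theorem exists_expG_eq_of_isClosed {A : Subgroup G} (hA : ∀ x ∈ A, ∀ y ∈ A, x * y = y * x)
    (hc : IsClosed (A : Set G)) (hconn : IsConnected (A : Set G)) {g : G} (hg : g ∈ A) :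
    ∃ X ∈ lieOf E A, expG X = g := by
  have : ConnectedSpace A := isConnected_iff_connectedSpace.mp hconn
  have huniv := (isClopen_expSubgroup (E := E) hA hc).eq_univ ⟨1, Subgroup.one_mem _⟩
  have : (⟨g, hg⟩ : A) ∈ ((expSubgroup (E := E) hA).subgroupOf A : Set A) := huniv ▸ mem_univ _
  exact this

/-! ### Differentials of homomorphisms, invariant forms -/

lemma expG_smul_differential {f : G →* G} (hf : ContMDiff 𝓘(ℝ, E) 𝓘(ℝ, E) ∞ f) (t : ℝ)
    (X : LieAlg E G) : f (expG (t • X)) = expG (t • differential E f X) := by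
  rw [map_expG hf, map_smul]

/-- The differential of a homomorphism preserves brackets. -/
lemma differential_lie {f : G →* G} (hf : ContMDiff 𝓘(ℝ, E) 𝓘(ℝ, E) ∞ f) (X Y : LieAlg E G) :
    differential E f ⁅X, Y⁆ = ⁅differential E f X, differential E f Y⁆ := by
  refine eq_of_forall_dual fun l => ?_
  have h1 := hasDerivAt_Ad (l ∘ₗ differential E f) X Y 0
  have h2 := hasDerivAt_Ad l (differential E f X) (differential E f Y) 0
  simp only [zero_smul, expG_zero, Ad_one, LinearMap.comp_apply, differential_Ad hf,
    expG_smul_differential hf] at h1 h2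
  exact h1.unique h2

lemma Ad_lie (g : G) (X Y : LieAlg E G) : Ad E g ⁅X, Y⁆ = ⁅Ad E g X, Ad E g Y⁆ :=
  differential_lie (contMDiff_conj g) X Y

variable {K : Subgroup G} {θ : G →* G} {B : LinearMap.BilinForm ℝ (LieAlg E G)} {T : Subgroup G}

lemma IsCartanInvolution.differential_differential (hθ : IsCartanInvolution E K θ)
    (X : LieAlg E G) : differential E θ (differential E θ X) = X := by
  refine expG_smul_injective fun t => ?_
  rw [← expG_smul_differential hθ.smooth, ← expG_smul_differential hθ.smooth, hθ.involutive]

lemma mem_kPart {X : LieAlg E G} : X ∈ kPart E θ ↔ differential E θ X = X := by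
  rw [kPart, Module.End.mem_eigenspace_iff, one_smul]

lemma mem_pPart {X : LieAlg E G} : X ∈ pPart E θ ↔ differential E θ X = -X := by
  rw [pPart, Module.End.mem_eigenspace_iff, neg_smul, one_smul]

lemma IsInvariantForm.lie_left (hB : IsInvariantForm θ B) (X Y Z : LieAlg E G) :
    B ⁅X, Y⁆ Z = -B Y ⁅X, Z⁆ := by
  have h1 := hasDerivAt_Ad (B.flip Z) X Y 0
  have h2 := hasDerivAt_Ad (B Y) (-X) Z 0
  simp only [zero_smul, expG_zero, Ad_one] at h1 h2
  rw [neg_lie, map_neg] at h2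
  refine h1.unique (h2.congr_of_eventuallyEq (Eventually.of_forall fun s => ?_))
  change B (Ad E (expG (s • X)) Y) Z = B Y (Ad E (expG (s • -X)) Z)
  rw [← hB.ad_invariant (expG (s • -X)), smul_neg, expG_neg, Ad_inv_Ad]

/-- `𝔤₀ = 𝔨₀ ⊕ 𝔭₀` is a Cartan decomposition of the Lie algebra for the invariant form `B`. -/
structure IsCartanDecomposition {𝔤 : Type*} [LieRing 𝔤] [LieAlgebra ℝ 𝔤] (k p : Submodule ℝ 𝔤)
    (B : LinearMap.BilinForm ℝ 𝔤) : Prop where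
  symm : ∀ X Y, B X Y = B Y X
  lie_left : ∀ X Y Z : 𝔤, B ⁅X, Y⁆ Z = -B Y ⁅X, Z⁆
  neg_def : ∀ X ∈ k, X ≠ 0 → B X X < 0
  pos_def : ∀ X ∈ p, X ≠ 0 → 0 < B X X
  orthogonal : ∀ X ∈ k, ∀ Y ∈ p, B X Y = 0
  lie_kk : ∀ X ∈ k, ∀ Y ∈ k, (⁅X, Y⁆ : 𝔤) ∈ k
  lie_kp : ∀ X ∈ k, ∀ Y ∈ p, (⁅X, Y⁆ : 𝔤) ∈ p
  lie_pp : ∀ X ∈ p, ∀ Y ∈ p, (⁅X, Y⁆ : 𝔤) ∈ k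
  exists_add : ∀ X, ∃ Y ∈ k, ∃ Z ∈ p, X = Y + Z

lemma exists_add_of_involutive {V : Type*} [AddCommGroup V] [Module ℝ V] {f : V →ₗ[ℝ] V}
    (hf : ∀ x, f (f x) = x) (x : V) : ∃ y, f y = y ∧ ∃ z, f z = -z ∧ x = y + z := by
  refine ⟨(1 / 2 : ℝ) • (x + f x), ?_, (1 / 2 : ℝ) • (x - f x), ?_, by module⟩
  · rw [map_smul, map_add, hf, add_comm]
  · rw [map_smul, map_sub, hf, ← smul_neg, neg_sub]

lemma eq_zero_of_eq_neg {V : Type*} [AddCommGroup V] [Module ℝ V] {x : V} (h : x = -x) : x = 0 := by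
  have : (2 : ℝ) • x = 0 := by rw [two_smul]; nth_rw 2 [h]; exact add_neg_cancel x
  exact (smul_eq_zero_iff_right two_ne_zero).mp this

lemma isCartanDecomposition (hθ : IsCartanInvolution E K θ) (hB : IsInvariantForm θ B) :
    IsCartanDecomposition (kPart E θ) (pPart E θ) B where
  symm := hB.symm
  lie_left := hB.lie_left
  neg_def := hB.neg_def
  pos_def := hB.pos_def
  orthogonal X hX Y hY := by
    have := hB.theta_invariant X Y
    rw [mem_kPart.mp hX, mem_pPart.mp hY, map_neg] at this
    linarith
  lie_kk X hX Y hY := by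
    rw [mem_kPart] at hX hY ⊢
    rw [differential_lie hθ.smooth, hX, hY]
  lie_kp X hX Y hY := by
    rw [mem_kPart] at hX
    rw [mem_pPart] at hY ⊢
    rw [differential_lie hθ.smooth, hX, hY, lie_neg]
  lie_pp X hX Y hY := by
    rw [mem_pPart] at hX hY
    rw [mem_kPart, differential_lie hθ.smooth, hX, hY, lie_neg, neg_lie, neg_neg]
  exists_add X := by
    obtain ⟨Y, hY, Z, hZ, h⟩ := exists_add_of_involutive hθ.differential_differential X
    exact ⟨Y, mem_kPart.mpr hY, Z, mem_pPart.mpr hZ, h⟩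

/-! ### The maximal compact subgroup and its maximal torus -/

lemma IsCartanInvolution.isCompact (hθ : IsCartanInvolution E K θ) : IsCompact (K : Set G) :=
  hθ.maximal_compact.prop

lemma IsCartanInvolution.expG_mem (hθ : IsCartanInvolution E K θ) {X : LieAlg E G}
    (hX : X ∈ kPart E θ) : expG X ∈ K := by
  rw [hθ.fixed, map_expG hθ.smooth, mem_kPart.mp hX]

lemma IsCartanInvolution.expG_smul_mem_iff (hθ : IsCartanInvolution E K θ) {X : LieAlg E G} :
    (∀ t : ℝ, expG (t • X) ∈ K) ↔ X ∈ kPart E θ := by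
  refine ⟨fun h => ?_, fun h t => hθ.expG_mem (Submodule.smul_mem _ t h)⟩
  rw [mem_kPart]
  refine expG_smul_injective fun t => ?_
  rw [← expG_smul_differential hθ.smooth, (hθ.fixed _).mp (h t)]

lemma IsCartanInvolution.Ad_mem_kPart (hθ : IsCartanInvolution E K θ) {g : G} (hg : g ∈ K)
    {X : LieAlg E G} (hX : X ∈ kPart E θ) : Ad E g X ∈ kPart E θ := by
  rw [mem_kPart] at *
  rw [differential_Ad hθ.smooth, (hθ.fixed g).mp hg, hX]

lemma IsCartanInvolution.Ad_mem_pPart (hθ : IsCartanInvolution E K θ) {g : G} (hg : g ∈ K)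
    {X : LieAlg E G} (hX : X ∈ pPart E θ) : Ad E g X ∈ pPart E θ := by
  rw [mem_pPart] at *
  rw [differential_Ad hθ.smooth, (hθ.fixed g).mp hg, hX, map_neg]

lemma IsMaximalTorus.comm (hT : IsMaximalTorus K T) : ∀ x ∈ T, ∀ y ∈ T, x * y = y * x :=
  hT.prop.2.2.2

lemma IsMaximalTorus.exists_expG_eq (hT : IsMaximalTorus K T) {g : G} (hg : g ∈ T) :
    ∃ X ∈ lieOf E T, expG X = g :=
  exists_expG_eq_of_isClosed hT.comm hT.prop.2.1.isClosed hT.prop.2.2.1 hg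

lemma IsMaximalTorus.lieOf_le (hT : IsMaximalTorus K T) (hθ : IsCartanInvolution E K θ) :
    lieOf E T ≤ kPart E θ := fun _ hX =>
  hθ.expG_smul_mem_iff.mp fun t => hT.prop.1 ((mem_lieOf_iff hT.comm).mp hX t)

/-- A connected abelian subgroup of `K` that commutes with a maximal torus is contained in it. -/
lemma IsMaximalTorus.le_of_commute [IsTopologicalGroup G] (hT : IsMaximalTorus K T)
    (hK : IsCompact (K : Set G))
    {S : Subgroup G} (hS : S ≤ K) (hconn : IsConnected (S : Set G))
    (hcomm : ∀ x ∈ S, ∀ y ∈ S, x * y = y * x) (hTS : ∀ x ∈ T, ∀ y ∈ S, x * y = y * x) : S ≤ T := by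
  let R : Subgroup G :=
    { carrier := (fun q : G × G => q.1 * q.2) '' ((T : Set G) ×ˢ (S : Set G))
      mul_mem' := by
        rintro _ _ ⟨⟨a, b⟩, ⟨ha, hb⟩, rfl⟩ ⟨⟨c, d⟩, ⟨hc, hd⟩, rfl⟩
        refine ⟨(a * c, b * d), ⟨T.mul_mem ha hc, S.mul_mem hb hd⟩, ?_⟩
        have := hTS c hc b hb
        simp only
        rw [mul_assoc, ← mul_assoc c, this]
        simp only [mul_assoc]
      one_mem' := ⟨(1, 1), ⟨T.one_mem, S.one_mem⟩, one_mul _⟩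
      inv_mem' := by
        rintro _ ⟨⟨a, b⟩, ⟨ha, hb⟩, rfl⟩
        refine ⟨(a⁻¹, b⁻¹), ⟨T.inv_mem ha, S.inv_mem hb⟩, ?_⟩
        have := hTS _ (T.inv_mem ha) _ (S.inv_mem hb)
        simp only
        rw [this, mul_inv_rev] }
  have hR : (R : Set G) = (fun q : G × G => q.1 * q.2) '' ((T : Set G) ×ˢ (S : Set G)) := rfl
  have hRcomm : ∀ x ∈ R, ∀ y ∈ R, x * y = y * x := by
    rintro _ ⟨⟨a, b⟩, ⟨ha, hb⟩, rfl⟩ _ ⟨⟨c, d⟩, ⟨hc, hd⟩, rfl⟩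
    simp only
    rw [mul_assoc, ← mul_assoc b, ← hTS c hc b hb, mul_assoc, hcomm b hb d hd, ← mul_assoc,
      hT.comm a ha c hc, mul_assoc, mul_assoc, ← mul_assoc d, ← hTS a ha d hd, mul_assoc]
  have hRK : R ≤ K := by
    rintro _ ⟨⟨a, b⟩, ⟨ha, hb⟩, rfl⟩
    exact K.mul_mem (hT.prop.1 ha) (hS hb)
  have hcl : R.topologicalClosure ≤ K := R.topologicalClosure_minimal hRK hK.isClosed
  have hle := hT.le_of_ge (y := R.topologicalClosure) ⟨hcl, ?_, ?_, ?_⟩ ?_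
  · refine fun s hs => hle (R.le_topologicalClosure ?_)
    exact ⟨(1, s), ⟨T.one_mem, hs⟩, one_mul _⟩
  · exact hK.of_isClosed_subset R.isClosed_topologicalClosure hcl
  · rw [Subgroup.topologicalClosure_coe]
    refine IsConnected.closure ?_
    rw [hR]
    exact (hT.prop.2.2.1.prod hconn).image _ continuous_mul.continuousOn
  · have h1 : ∀ x ∈ R, ∀ y ∈ R.topologicalClosure, x * y = y * x := by
      intro x hx y hy
      have hc : IsClosed {y : G | x * y = y * x} :=
        isClosed_eq (by fun_prop) (by fun_prop)
      exact closure_minimal (s := (R : Set G)) (fun y hy => hRcomm x hx y hy) hc hy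
    intro x hx y hy
    have hc : IsClosed {x : G | x * y = y * x} := isClosed_eq (by fun_prop) (by fun_prop)
    exact closure_minimal (s := (R : Set G)) (fun x hx => h1 x hx y hy) hc hx
  · refine le_trans (fun t ht => ?_) R.le_topologicalClosure
    exact ⟨(t, 1), ⟨ht, S.one_mem⟩, mul_one _⟩

/-- The one-parameter subgroup of `X`. -/
def expLine (X : LieAlg E G) : Subgroup G where
  carrier := range fun t : ℝ => expG (t • X)
  mul_mem' := by
    rintro _ _ ⟨s, rfl⟩ ⟨t, rfl⟩
    exact ⟨s + t, expG_add_smul X s t⟩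
  one_mem' := ⟨0, by simp⟩
  inv_mem' := by
    rintro _ ⟨s, rfl⟩
    exact ⟨-s, by simp only [neg_smul, expG_neg]⟩

lemma isConnected_expLine (X : LieAlg E G) : IsConnected (expLine X : Set G) :=
  isConnected_range (continuous_expG_smul X)

lemma expLine_comm (X : LieAlg E G) : ∀ x ∈ expLine X, ∀ y ∈ expLine X, x * y = y * x := by
  rintro _ ⟨s, rfl⟩ _ ⟨t, rfl⟩
  rw [← expG_add_smul, ← expG_add_smul, add_comm]

/-- The Lie algebra of a maximal torus is its own centraliser in `𝔨₀`. -/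
lemma IsMaximalTorus.mem_lieOf_of_lie_eq_zero (hT : IsMaximalTorus K T)
    (hθ : IsCartanInvolution E K θ) {X : LieAlg E G} (hX : X ∈ kPart E θ)
    (h : ∀ H ∈ lieOf E T, ⁅X, H⁆ = 0) : X ∈ lieOf E T := by
  rw [mem_lieOf_iff hT.comm]
  have : IsTopologicalGroup G := topologicalGroup_of_lieGroup 𝓘(ℝ, E) ∞
  have := hT.le_of_commute hθ.isCompact (S := expLine X) ?_ (isConnected_expLine X)
    (expLine_comm X) ?_
  · exact fun t => this ⟨t, rfl⟩
  · rintro _ ⟨t, rfl⟩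
    exact hθ.expG_smul_mem_iff.mpr hX t
  · rintro x hx _ ⟨t, rfl⟩
    obtain ⟨H, hH, rfl⟩ := hT.exists_expG_eq (E := E) hx
    refine commute_expG ?_
    rw [lie_smul, ← lie_skew, h H hH, neg_zero, smul_zero]

lemma IsMaximalTorus.lie_eq_zero (hT : IsMaximalTorus K T) {X Y : LieAlg E G}
    (hX : X ∈ lieOf E T) (hY : Y ∈ lieOf E T) : ⁅X, Y⁆ = 0 :=
  lie_eq_zero_of_mem_lieOf hT.comm hX hY

/-! ### The centre -/

/-- An element of the complex adjoint group fixes the vectors that are killed by all `ad X`. -/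
lemma apply_eq_of_mem_complexAdjointGroup {φ : Module.End ℂ (LieAlgC E G)}
    (hφ : φ ∈ complexAdjointGroup E G) {v : LieAlgC E G} (hv : ∀ X : LieAlgC E G, ⁅X, v⁆ = 0) : φ v = v := by
  induction hφ using Submonoid.closure_induction with
  | mem φ h =>
    obtain ⟨X, hX⟩ := h
    refine (Module.forall_dual_apply_eq_zero_iff ℂ _).mp ?_ |> sub_eq_zero.mp
    intro l
    rw [map_sub, sub_eq_zero]
    refine (hX v l).unique ?_
    convert hasSum_single (f := fun n : ℕ => ((n.factorial : ℂ)⁻¹) *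
      l ((LieAlgebra.ad ℂ (LieAlgC E G) X ^ n) v)) 0 ?_ using 1
    · simp
    · intro n hn
      obtain ⟨m, rfl⟩ := Nat.exists_eq_succ_of_ne_zero hn
      rw [pow_succ, Module.End.mul_apply, LieAlgebra.ad_apply, hv, map_zero, map_zero, mul_zero]
  | one => rfl
  | mul a b _ _ ha hb => rw [Module.End.mul_apply, hb, ha]

/-- An element of the complex adjoint group preserves the functionals that vanish on brackets. -/
lemma dual_apply_eq_of_mem_complexAdjointGroup {φ : Module.End ℂ (LieAlgC E G)}
    (hφ : φ ∈ complexAdjointGroup E G) {l : Module.Dual ℂ (LieAlgC E G)}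
    (hl : ∀ X Y : LieAlgC E G, l ⁅X, Y⁆ = 0) (v : LieAlgC E G) : l (φ v) = l v := by
  induction hφ using Submonoid.closure_induction generalizing v with
  | mem φ h =>
    obtain ⟨X, hX⟩ := h
    refine (hX v l).unique ?_
    convert hasSum_single (f := fun n : ℕ => ((n.factorial : ℂ)⁻¹) *
      l ((LieAlgebra.ad ℂ (LieAlgC E G) X ^ n) v)) 0 ?_ using 1
    · simp
    · intro n hn
      obtain ⟨m, rfl⟩ := Nat.exists_eq_succ_of_ne_zero hn
      rw [pow_succ', Module.End.mul_apply, LieAlgebra.ad_apply, hl, mul_zero]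
  | one => rfl
  | mul a b _ _ ha hb => rw [Module.End.mul_apply, ha, hb]

lemma one_tmul_injective {V : Type*} [AddCommGroup V] [Module ℝ V] [FiniteDimensional ℝ V]
    {x y : V} (h : (1 : ℂ) ⊗ₜ[ℝ] x = 1 ⊗ₜ y) : x = y := by
  have := (Module.forall_dual_apply_eq_zero_iff ℝ (x - y)).mp ?_
  · exact sub_eq_zero.mp this
  intro l
  have := congrArg (LinearMap.baseChange ℂ l) h
  rw [LinearMap.baseChange_tmul, LinearMap.baseChange_tmul] at this
  have h2 := congrArg (TensorProduct.rid ℝ ℂ) this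
  simp only [TensorProduct.rid_tmul, Complex.real_smul, mul_one, Complex.ofReal_inj] at h2
  rw [map_sub, h2, sub_self]

/-- Central elements of `𝔤₀` are fixed by all of `Ad G`, including the other components of `G`,
since `Ad G` is contained in the complex adjoint group. -/
lemma IsHarishChandraClass.Ad_eq_self (hG : IsHarishChandraClass E G) (g : G) {X : LieAlg E G}
    (hX : ∀ Y : LieAlg E G, ⁅Y, X⁆ = 0) : Ad E g X = X := by
  have := apply_eq_of_mem_complexAdjointGroup (hG.inner g) (v := 1 ⊗ₜ X) ?_
  · rw [LinearMap.baseChange_tmul] at this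
    exact one_tmul_injective this
  · intro v
    induction v using TensorProduct.induction_on with
    | zero => exact zero_lie _
    | tmul a Y => rw [LieAlgebra.ExtendScalars.bracket_tmul, hX, TensorProduct.tmul_zero]
    | add a b ha hb => rw [add_lie, ha, hb, add_zero]

lemma baseChange_lie_eq_zero {L : Type*} [LieRing L] [LieAlgebra ℝ L] {l : Module.Dual ℝ L}
    (hl : ∀ X Y : L, l ⁅X, Y⁆ = 0) (v w : ℂ ⊗[ℝ] L) : Module.Dual.baseChange ℂ l ⁅v, w⁆ = 0 := by
  induction v using TensorProduct.induction_on with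
  | zero => rw [zero_lie, map_zero]
  | tmul a Y =>
    induction w using TensorProduct.induction_on with
    | zero => exact (congrArg _ (lie_zero (a ⊗ₜ[ℝ] Y : ℂ ⊗[ℝ] L))).trans (map_zero _)
    | tmul b Z =>
      rw [LieAlgebra.ExtendScalars.bracket_tmul, Module.Dual.baseChange_apply_tmul, hl, zero_smul]
    | add b c hb hc =>
      refine (congrArg _ (lie_add (a ⊗ₜ[ℝ] Y : ℂ ⊗[ℝ] L) b c)).trans ?_
      rw [map_add, hb, hc, add_zero]
  | add a b ha hb => rw [add_lie, map_add, ha, hb, add_zero]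

lemma IsHarishChandraClass.dual_Ad_eq (hG : IsHarishChandraClass E G) (g : G)
    {l : Module.Dual ℝ (LieAlg E G)} (hl : ∀ X Y : LieAlg E G, l ⁅X, Y⁆ = 0) (X : LieAlg E G) :
    l (Ad E g X) = l X := by
  have := dual_apply_eq_of_mem_complexAdjointGroup (hG.inner g)
    (l := Module.Dual.baseChange ℂ l) ?_ (1 ⊗ₜ X)
  · rw [LinearMap.baseChange_tmul] at this
    simpa using this
  · exact baseChange_lie_eq_zero hl

lemma centerIdentity_le_center : centerIdentity E G ≤ Subgroup.center G := by
  rintro _ ⟨z, -, rfl⟩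
  exact z.2

lemma comm_of_mem_centerIdentity {x : G} (hx : x ∈ centerIdentity E G) (y : G) : x * y = y * x :=
  (Subgroup.mem_center_iff.mp (centerIdentity_le_center hx) y).symm

lemma coe_centerIdentity : (centerIdentity E G : Set G) =
    (Subtype.val : Subgroup.center G → G) '' connectedComponent 1 := rfl

lemma isClosed_center [IsTopologicalGroup G] : IsClosed (Subgroup.center G : Set G) := by
  have e : (Subgroup.center G : Set G) = ⋂ y : G, {x | y * x = x * y} := by
    ext x
    simp [Subgroup.mem_center_iff]
  rw [e]
  exact isClosed_iInter fun y => isClosed_eq (by fun_prop) (by fun_prop)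

lemma isClosed_centerIdentity : IsClosed (centerIdentity E G : Set G) := by
  have : IsTopologicalGroup G := topologicalGroup_of_lieGroup 𝓘(ℝ, E) ∞
  rw [coe_centerIdentity]
  exact isClosed_center.isClosedEmbedding_subtypeVal.isClosedMap _
    isClosed_connectedComponent

lemma isConnected_centerIdentity : IsConnected (centerIdentity E G : Set G) := by
  rw [coe_centerIdentity]
  exact isConnected_connectedComponent.image _ continuous_subtype_val.continuousOn

lemma exists_expG_eq_of_mem_centerIdentity {g : G} (hg : g ∈ centerIdentity E G) :
    ∃ X ∈ lieOf E (centerIdentity E G), expG X = g :=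
  exists_expG_eq_of_isClosed (fun _ hx y _ => comm_of_mem_centerIdentity hx y)
    isClosed_centerIdentity isConnected_centerIdentity hg

/-- The Lie algebra of the centre of a group in Harish-Chandra's class is the centre of `𝔤₀`. -/
lemma IsHarishChandraClass.mem_lieOf_centerIdentity_iff (hG : IsHarishChandraClass E G)
    {X : LieAlg E G} : X ∈ lieOf E (centerIdentity E G) ↔ ∀ Y : LieAlg E G, ⁅Y, X⁆ = 0 := by
  rw [mem_lieOf_iff (fun _ hx y _ => comm_of_mem_centerIdentity hx y)]
  constructor
  · intro h Y
    exact lie_eq_zero_of_commute fun s t => (comm_of_mem_centerIdentity (h t) _).symm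
  · intro h
    have hc : ∀ t : ℝ, expG (t • X) ∈ Subgroup.center G := by
      intro t
      rw [Subgroup.mem_center_iff]
      intro g
      have := conj_expG g (t • X)
      rw [map_smul, hG.Ad_eq_self g h] at this
      exact mul_inv_eq_iff_eq_mul.mp this
    intro t
    have h1 : IsPreconnected (range fun t : ℝ => (⟨expG (t • X), hc t⟩ : Subgroup.center G)) :=
      isPreconnected_range ((continuous_expG_smul X).subtype_mk _)
    have h2 := h1.subset_connectedComponent (x := 1) ⟨0, Subtype.ext (by simp)⟩ ⟨t, rfl⟩
    exact ⟨_, h2, rfl⟩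

lemma IsCartanInvolution.lie_differential_eq_zero (hθ : IsCartanInvolution E K θ)
    {X : LieAlg E G} (hX : ∀ Y : LieAlg E G, ⁅Y, X⁆ = 0) (Y : LieAlg E G) : ⁅Y, differential E θ X⁆ = 0 := by
  rw [← hθ.differential_differential Y, ← differential_lie hθ.smooth, hX, map_zero]

/-- A central element of `𝔭₀` that generates a circle vanishes, by the maximality of `K`. -/
lemma IsCartanInvolution.eq_zero_of_expG_eq_one (hθ : IsCartanInvolution E K θ)
    (hG : IsHarishChandraClass E G)
    {X : LieAlg E G} (hX : ∀ Y : LieAlg E G, ⁅Y, X⁆ = 0) (hp : X ∈ pPart E θ) (h : expG X = 1) : X = 0 := by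
  have : IsTopologicalGroup G := topologicalGroup_of_lieGroup 𝓘(ℝ, E) ∞
  have hc : ∀ (t : ℝ) (g : G), g * expG (t • X) = expG (t • X) * g := by
    intro t g
    have := conj_expG g (t • X)
    rw [map_smul, hG.Ad_eq_self g hX] at this
    exact mul_inv_eq_iff_eq_mul.mp this
  let R : Subgroup G :=
    { carrier := (fun q : G × ℝ => q.1 * expG (q.2 • X)) '' ((K : Set G) ×ˢ univ)
      mul_mem' := by
        rintro _ _ ⟨⟨a, s⟩, ⟨ha, -⟩, rfl⟩ ⟨⟨b, t⟩, ⟨hb, -⟩, rfl⟩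
        refine ⟨(a * b, s + t), ⟨K.mul_mem ha hb, trivial⟩, ?_⟩
        simp only
        rw [expG_add_smul, mul_assoc, mul_assoc, ← mul_assoc b, hc s b, mul_assoc]
      one_mem' := ⟨(1, 0), ⟨K.one_mem, trivial⟩, by simp⟩
      inv_mem' := by
        rintro _ ⟨⟨a, s⟩, ⟨ha, -⟩, rfl⟩
        refine ⟨(a⁻¹, -s), ⟨K.inv_mem ha, trivial⟩, ?_⟩
        simp only
        rw [hc, mul_inv_rev, neg_smul, expG_neg] }
  have hR : (R : Set G) =
      (fun q : G × ℝ => q.1 * expG (q.2 • X)) '' ((K : Set G) ×ˢ Icc (0 : ℝ) 1) := by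
    refine subset_antisymm ?_ (image_mono (prod_mono_right (subset_univ _)))
    rintro _ ⟨⟨a, s⟩, ⟨ha, -⟩, rfl⟩
    refine ⟨(a, Int.fract s), ⟨ha, Int.fract_nonneg s, (Int.fract_lt_one s).le⟩, ?_⟩
    simp only
    have e : expG ((⌊s⌋ : ℝ) • X) = 1 := by
      have := expE_zsmul (G := G) ⌊s⌋ (lieEquiv E G X)
      rw [← map_smul, expE_lieEquiv, expE_lieEquiv, h, one_zpow] at this
      exact this
    conv_rhs => rw [← Int.floor_add_fract s, expG_add_smul, e, one_mul]
  have hcomp : IsCompact (R : Set G) := by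
    rw [hR]
    refine (hθ.isCompact.prod isCompact_Icc).image ?_
    exact continuous_fst.mul ((continuous_expG_smul X).comp continuous_snd)
  have hle : R ≤ K := hθ.maximal_compact.le_of_ge hcomp fun g hg => ⟨(g, 0), ⟨hg, trivial⟩, by simp⟩
  have hk : X ∈ kPart E θ :=
    hθ.expG_smul_mem_iff.mp fun t => hle ⟨(1, t), ⟨K.one_mem, trivial⟩, by simp⟩
  rw [mem_kPart] at hk
  rw [mem_pPart, hk] at hp
  exact eq_zero_of_eq_neg hp

lemma Zc_comm : ∀ x ∈ Zc E K, ∀ y ∈ Zc E K, x * y = y * x :=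
  fun _ hx y _ => comm_of_mem_centerIdentity hx.1 y

/-- The Lie algebra of `Z_c` is the intersection of the centre of `𝔤₀` with `𝔨₀`. -/
lemma IsHarishChandraClass.mem_lieOf_Zc_iff (hG : IsHarishChandraClass E G)
    (hθ : IsCartanInvolution E K θ) {X : LieAlg E G} :
    X ∈ lieOf E (Zc E K) ↔ (∀ Y : LieAlg E G, ⁅Y, X⁆ = 0) ∧ X ∈ kPart E θ := by
  rw [mem_lieOf_iff Zc_comm, ← hG.mem_lieOf_centerIdentity_iff,
    mem_lieOf_iff (fun _ hx y _ => comm_of_mem_centerIdentity hx y), ← hθ.expG_smul_mem_iff,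
    ← forall_and]
  rfl

/-- `Z_c` is covered by the exponential map of its Lie algebra; in particular it is connected. -/
lemma IsHarishChandraClass.exists_expG_eq_of_mem_Zc (hG : IsHarishChandraClass E G)
    (hθ : IsCartanInvolution E K θ) {g : G} (hg : g ∈ Zc E K) :
    ∃ X ∈ lieOf E (Zc E K), expG X = g := by
  obtain ⟨X, hX, rfl⟩ := exists_expG_eq_of_mem_centerIdentity hg.1
  rw [hG.mem_lieOf_centerIdentity_iff] at hX
  have hθX := hθ.lie_differential_eq_zero hX
  refine ⟨X, hG.mem_lieOf_Zc_iff hθ |>.mpr ⟨hX, ?_⟩, rfl⟩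
  have h1 : expG (X - differential E θ X) = 1 := by
    have h2 := (hθ.fixed _).mp hg.2
    rw [map_expG hθ.smooth] at h2
    rw [sub_eq_add_neg, expG_add (by rw [lie_neg, hθX, neg_zero]), expG_neg, h2, mul_inv_cancel]
  have h3 := hθ.eq_zero_of_expG_eq_one hG (X := X - differential E θ X)
    (fun Y => by rw [lie_sub, hX, hθX, sub_zero]) ?_ h1
  · rw [mem_kPart]
    exact (sub_eq_zero.mp h3).symm
  · rw [mem_pPart, map_sub, hθ.differential_differential, neg_sub]

lemma IsHarishChandraClass.Zc_le (hG : IsHarishChandraClass E G)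
    (hθ : IsCartanInvolution E K θ) (hT : IsMaximalTorus K T) : Zc E K ≤ T := by
  have : IsTopologicalGroup G := topologicalGroup_of_lieGroup 𝓘(ℝ, E) ∞
  refine hT.le_of_commute hθ.isCompact (fun _ hx => hx.2) ?_ Zc_comm
    (fun x _ y hy => (comm_of_mem_centerIdentity hy.1 x).symm)
  have e : (Zc E K : Set G) = expE E G '' ((lieOf E (Zc E K)).map (lieEquiv E G).toLinearMap) := by
    ext g
    constructor
    · intro hg
      obtain ⟨X, hX, rfl⟩ := hG.exists_expG_eq_of_mem_Zc hθ hg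
      exact ⟨lieEquiv E G X, ⟨X, hX, rfl⟩, rfl⟩
    · rintro ⟨_, ⟨X, hX, rfl⟩, rfl⟩
      exact expG_mem_of_mem_lieOf Zc_comm hX
  rw [e]
  refine IsConnected.image ?_ _ continuous_expE.continuousOn
  exact (Submodule.convex _).isConnected ⟨0, Submodule.zero_mem _⟩

/-! ### Characters of compact abelian subgroups -/

/-- The kernel of the exponential map is discrete. -/
lemma eventually_eq_zero_of_expE_eq_one : ∀ᶠ x in 𝓝 (0 : E), expE E G x = 1 → x = 0 := by
  have h := (hasStrictDerivOne_expE (E := E) (G := G)).exists_antilipschitz (c := 1) one_pos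
    (fun v => by simp)
  have h2 : Tendsto (fun x : E => (x, (0 : E))) (𝓝 0) (𝓝 (0, 0)) := by
    exact (Continuous.prodMk_left (0 : E)).tendsto' _ _ rfl
  filter_upwards [h2.eventually h] with x hx h1
  rw [h1, expE_zero, sub_self, norm_zero, sub_zero] at hx
  have := norm_nonneg x
  exact norm_eq_zero.mp (by linarith)

variable {A : Subgroup G}

/-- The Lie algebra of a subgroup as a subspace of the model space. -/
def lieOfE (A : Subgroup G) : Submodule ℝ E := (lieOf E A).map (lieEquiv E G).toLinearMap

lemma mem_lieOfE {x : E} : x ∈ lieOfE A ↔ (lieEquiv E G).symm x ∈ lieOf E A := by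
  rw [lieOfE, Submodule.mem_map_equiv]

variable (A) in
/-- The two versions of the Lie algebra of a subgroup are the same. -/
def lieOfEquiv : lieOf E A ≃ₗ[ℝ] lieOfE (E := E) A := (lieEquiv E G).submoduleMap (lieOf E A)

/-- The exponential map of an abelian subgroup, as a homomorphism. -/
def expHom (hA : ∀ x ∈ A, ∀ y ∈ A, x * y = y * x) : Multiplicative (lieOfE (E := E) A) →* A where
  toFun x := ⟨expE E G (x.toAdd : E), expG_mem_of_mem_lieOf hA (mem_lieOfE.mp x.toAdd.2)⟩
  map_one' := Subtype.ext expE_zero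
  map_mul' x y := by
    refine Subtype.ext ?_
    change expG ((lieEquiv E G).symm ((x.toAdd : E) + (y.toAdd : E))) = _
    rw [map_add]
    exact expG_add (lie_eq_zero_of_mem_lieOf hA (mem_lieOfE.mp x.toAdd.2) (mem_lieOfE.mp y.toAdd.2))

/-- A continuous homomorphism on the Lie algebra of a compact abelian subgroup that kills the kernel
of the exponential map descends to the subgroup. -/
lemma exists_hom_comp_expHom (hA : ∀ x ∈ A, ∀ y ∈ A, x * y = y * x) (hc : IsCompact (A : Set G))
    (hexp : ∀ g ∈ A, ∃ X ∈ lieOf E A, expG X = g) {H : Type*} [Group H] [TopologicalSpace H]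
    (g : Multiplicative (lieOfE (E := E) A) →* H) (hg : Continuous g)
    (hker : ∀ x, expHom hA x = 1 → g x = 1) :
    ∃ χ : A →ₜ* H, ∀ x, χ (expHom hA x) = g x := by
  have : IsTopologicalGroup G := topologicalGroup_of_lieGroup 𝓘(ℝ, E) ∞
  have : CompactSpace A := isCompact_iff_compactSpace.mp hc
  have : ProperSpace E := FiniteDimensional.proper_real E
  have hsurj : Function.Surjective (expHom (E := E) hA) := by
    rintro ⟨a, ha⟩
    obtain ⟨X, hX, rfl⟩ := hexp a ha
    exact ⟨Multiplicative.ofAdd ⟨lieEquiv E G X, ⟨X, hX, rfl⟩⟩, rfl⟩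
  have hcont : Continuous (expHom (E := E) hA) :=
    (continuous_expE.comp (continuous_subtype_val.comp continuous_toAdd)).subtype_mk _
  have : SigmaCompactSpace (Multiplicative (lieOfE (E := E) A)) :=
    inferInstanceAs (SigmaCompactSpace (lieOfE (E := E) A))
  have hopen := (expHom (E := E) hA).isOpenMap_of_sigmaCompact hsurj hcont
  let χ : A →* H := (expHom (E := E) hA).liftOfSurjective hsurj ⟨g, hker⟩
  have hχ : ∀ x, χ (expHom hA x) = g x := fun x =>
    MonoidHom.liftOfRightInverse_comp_apply _ _ _ _ x
  refine ⟨⟨χ, ?_⟩, hχ⟩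
  rw [OneHom.toFun_eq_coe, (hopen.isQuotientMap hcont hsurj).continuous_iff]
  exact hg.congr fun x => (hχ x).symm

/-- A functional on the Lie algebra of a compact abelian group covered by its exponential map is the
differential of a character as soon as it is integral on the kernel of the exponential map. -/
lemma exists_isDifferential (hA : ∀ x ∈ A, ∀ y ∈ A, x * y = y * x) (hc : IsCompact (A : Set G))
    (hexp : ∀ g ∈ A, ∃ X ∈ lieOf E A, expG X = g) (μ : Module.Dual ℝ (lieOf E A))
    (hμ : ∀ X : lieOf E A, expG (X : LieAlg E G) = 1 → ∃ n : ℤ, μ X = n * (2 * Real.pi)) :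
    ∃ χ : A →ₜ* Circle, IsDifferential A χ μ := by
  let f : lieOfE (E := E) A →ₗ[ℝ] ℝ := μ ∘ₗ (lieOfEquiv (E := E) A).symm.toLinearMap
  have hf : Continuous f := f.continuous_of_finiteDimensional
  have hcont : Continuous fun x : Multiplicative (lieOfE (E := E) A) => Circle.exp (f x.toAdd) :=
    Circle.exp.continuous.comp (hf.comp continuous_toAdd)
  obtain ⟨χ, hχ⟩ := exists_hom_comp_expHom hA hc hexp
    (H := Circle) (AddMonoidHom.toMultiplicativeLeft (Circle.expHom.comp f.toAddMonoidHom))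
    hcont fun x hx => by
      obtain ⟨n, hn⟩ := hμ ((lieOfEquiv (E := E) A).symm x.toAdd) (congrArg Subtype.val hx)
      exact Circle.exp_eq_one.mpr ⟨n, hn⟩
  · refine ⟨χ, fun X γ hγ hγA t => ?_⟩
    have e : (⟨γ t, hγA t⟩ : A) = expHom hA (Multiplicative.ofAdd
        (lieOfEquiv A (t • X))) := Subtype.ext (hγ.eq_expG t)
    rw [e, hχ]
    change Circle.exp (μ ((lieOfEquiv A).symm (lieOfEquiv A (t • X)))) = _
    rw [LinearEquiv.symm_apply_apply, map_smul, smul_eq_mul]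

/-- A linear functional that vanishes on the kernel of the exponential map of a compact group
vanishes, because its image is a bounded subgroup of `ℝ`. -/
lemma eq_zero_of_forall_expG_eq_one (hA : ∀ x ∈ A, ∀ y ∈ A, x * y = y * x)
    (hc : IsCompact (A : Set G)) (hexp : ∀ g ∈ A, ∃ X ∈ lieOf E A, expG X = g)
    (f : lieOfE (E := E) A →ₗ[ℝ] ℝ)
    (hf : ∀ x : lieOfE (E := E) A, expE E G x = 1 → f x = 0) : f = 0 := by
  have : CompactSpace A := isCompact_iff_compactSpace.mp hc
  have hcont : Continuous f := f.continuous_of_finiteDimensional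
  obtain ⟨χ, hχ⟩ := exists_hom_comp_expHom hA hc hexp
    (H := Multiplicative ℝ) (AddMonoidHom.toMultiplicative f.toAddMonoidHom)
    (hcont.comp continuous_toAdd) fun x hx => hf _ (congrArg Subtype.val hx)
  · obtain ⟨C, hC⟩ := (isCompact_range (continuous_toAdd.comp χ.continuous_toFun :
      Continuous fun a : A => (χ.toMonoidHom a).toAdd)).isBounded.exists_norm_le
    ext x
    have hb : ∀ n : ℕ, n * |f x| ≤ C := by
      intro n
      have := hC _ ⟨expHom hA (Multiplicative.ofAdd ((n : ℝ) • x)), rfl⟩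
      change ‖(χ.toMonoidHom (expHom hA (Multiplicative.ofAdd ((n : ℝ) • x)))).toAdd‖ ≤ C at this
      rw [show χ.toMonoidHom _ = _ from hχ _] at this
      change ‖f ((n : ℝ) • x)‖ ≤ C at this
      rwa [map_smul, norm_smul, RCLike.norm_natCast] at this
    by_contra h0
    have hpos : 0 < |f x| := abs_pos.mpr h0
    obtain ⟨n, hn⟩ := exists_nat_gt (C / |f x|)
    rw [div_lt_iff₀ hpos] at hn
    exact absurd (hb n) (not_le.mpr hn)

/-- The kernel of the exponential map of an abelian subgroup. -/
def expKer (hA : ∀ x ∈ A, ∀ y ∈ A, x * y = y * x) : Submodule ℤ (lieOfE (E := E) A) :=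
  AddSubgroup.toIntSubmodule
    { carrier := {x | expE E G (x : E) = 1}
      zero_mem' := expE_zero
      add_mem' := by
        intro x y hx hy
        have := (expHom (E := E) hA).map_mul (Multiplicative.ofAdd x) (Multiplicative.ofAdd y)
        have := congrArg Subtype.val this
        refine this.trans ?_
        change expE E G (x : E) * expE E G (y : E) = 1
        rw [show expE E G (x : E) = 1 from hx, show expE E G (y : E) = 1 from hy, one_mul]
      neg_mem' := by
        intro x hx
        change expG ((lieEquiv E G).symm (-(x : E))) = 1
        rw [map_neg, expG_neg, inv_eq_one]
        exact hx }

lemma mem_expKer (hA : ∀ x ∈ A, ∀ y ∈ A, x * y = y * x) {x : lieOfE (E := E) A} :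
    x ∈ expKer hA ↔ expE E G (x : E) = 1 := Iff.rfl

lemma discreteTopology_expKer (hA : ∀ x ∈ A, ∀ y ∈ A, x * y = y * x) :
    DiscreteTopology (expKer (E := E) hA) := by
  refine discreteTopology_of_isOpen_singleton_zero ?_
  rw [isOpen_singleton_iff_nhds_eq_pure]
  refine le_antisymm ?_ (pure_le_nhds _)
  rw [le_pure_iff]
  have h : Tendsto (fun x : expKer (E := E) hA => ((x : lieOfE (E := E) A) : E)) (𝓝 0) (𝓝 0) :=
    (continuous_subtype_val.comp continuous_subtype_val).tendsto' _ _ rfl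
  filter_upwards [h.eventually (eventually_eq_zero_of_expE_eq_one (E := E) (G := G))] with x hx
  exact Subtype.ext (Subtype.ext (hx x.2))

/-- The kernel of the exponential map of a compact abelian group spans its Lie algebra. -/
lemma span_expKer (hA : ∀ x ∈ A, ∀ y ∈ A, x * y = y * x) (hc : IsCompact (A : Set G))
    (hexp : ∀ g ∈ A, ∃ X ∈ lieOf E A, expG X = g) :
    Submodule.span ℝ (expKer (E := E) hA : Set (lieOfE (E := E) A)) = ⊤ := by
  by_contra hne
  obtain ⟨x, hx⟩ := SetLike.exists_not_mem_of_ne_top _ hne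
  obtain ⟨f, hfx, hf⟩ := Submodule.exists_le_ker_of_notMem hx
  refine hfx ?_
  rw [eq_zero_of_forall_expG_eq_one hA hc hexp f fun y hy => ?_, LinearMap.zero_apply]
  exact hf (Submodule.subset_span hy)

/-- A functional that is integral on the intersection of a lattice with a rational subspace extends
from this subspace to a functional that is integral on the lattice. -/
lemma exists_integral_extension {V : Type*} [NormedAddCommGroup V] [NormedSpace ℝ V]
    [FiniteDimensional ℝ V] (L : Submodule ℤ V) [DiscreteTopology L]
    (hL : Submodule.span ℝ (L : Set V) = ⊤) (U : Submodule ℝ V)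
    (hU : U ≤ Submodule.span ℝ ((L : Set V) ∩ U)) (l : V →ₗ[ℝ] ℝ) {c : ℝ}
    (hl : ∀ x ∈ L, x ∈ U → ∃ n : ℤ, l x = n * c) :
    ∃ μ : V →ₗ[ℝ] ℝ, (∀ x ∈ L, ∃ n : ℤ, μ x = n * c) ∧ ∀ x ∈ U, μ x = l x := by
  have : ProperSpace V := FiniteDimensional.proper_real V
  have : IsZLattice ℝ L := ⟨hL⟩
  let N : Submodule ℤ L := (U.restrictScalars ℤ).comap L.subtype
  have hN : ∀ x : L, x ∈ N ↔ (x : V) ∈ U := fun x => Iff.rfl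
  have : Module.Finite ℤ L := ZLattice.module_finite ℝ L
  have : Module.IsTorsionFree ℤ (L ⧸ N) := by
    rw [Module.isTorsionFree_iff_smul_eq_zero]
    intro n q hq
    obtain ⟨x, rfl⟩ := N.mkQ_surjective q
    by_contra! hcon
    refine hcon.2 ?_
    rw [← map_smul, Submodule.mkQ_apply, Submodule.Quotient.mk_eq_zero, hN] at hq
    rw [Submodule.mkQ_apply, Submodule.Quotient.mk_eq_zero, hN]
    have h1 : (n : ℝ) • (x : V) ∈ U := by rw [Int.cast_smul_eq_zsmul]; exact hq
    exact (U.smul_mem_iff (Int.cast_ne_zero.mpr hcon.1)).mp h1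
  have : Module.Free ℤ (L ⧸ N) := Module.free_of_finite_type_torsion_free'
  obtain ⟨s, hs⟩ := Module.projective_lifting_property N.mkQ LinearMap.id N.mkQ_surjective
  have hr : ∀ x : L, x - s (N.mkQ x) ∈ N := by
    intro x
    have : x - s (N.mkQ x) ∈ LinearMap.ker N.mkQ := by
      rw [LinearMap.mem_ker, map_sub, sub_eq_zero]
      exact (LinearMap.congr_fun hs (N.mkQ x)).symm
    rwa [N.ker_mkQ] at this
  let m : L →ₗ[ℤ] ℝ :=
    (l.restrictScalars ℤ) ∘ₗ L.subtype ∘ₗ (LinearMap.id - s ∘ₗ N.mkQ)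
  have hm : ∀ x : L, m x = l (x - s (N.mkQ x) : L) := fun x => rfl
  let b := Module.Free.chooseBasis ℤ L
  let bR := b.ofZLatticeBasis ℝ L
  let μ : V →ₗ[ℝ] ℝ := bR.constr ℝ fun i => m (b i)
  have hμ : ∀ x : L, μ x = m x := by
    intro x
    have : (μ.restrictScalars ℤ) ∘ₗ L.subtype = m := by
      refine b.ext fun i => ?_
      change μ (b i) = m (b i)
      rw [← b.ofZLatticeBasis_apply ℝ L i, Module.Basis.constr_basis]
    exact LinearMap.congr_fun this x
  refine ⟨μ, fun x hx => ?_, fun x hx => ?_⟩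
  · rw [hμ ⟨x, hx⟩, hm]
    exact hl _ (Subtype.coe_prop _) (hr _)
  · have : U ≤ LinearMap.eqLocus μ l := by
      refine hU.trans (Submodule.span_le.mpr ?_)
      rintro y ⟨hy, hyU⟩
      change μ y = l y
      have h0 : N.mkQ ⟨y, hy⟩ = 0 := by
        rw [← LinearMap.mem_ker, N.ker_mkQ]
        exact hyU
      rw [hμ ⟨y, hy⟩, hm, h0, map_zero, sub_zero]
    exact this hx

/-- A functional on `𝔱₀` that is integral on the Lie algebra of a closed subgroup of the torus `T`
agrees there with the differential of a character of `T`. -/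
lemma exists_mem_characterLattice {T : Subgroup G} (hT : ∀ x ∈ T, ∀ y ∈ T, x * y = y * x)
    (hc : IsCompact (T : Set G)) (hexp : ∀ g ∈ T, ∃ X ∈ lieOf E T, expG X = g)
    (hAT : A ≤ T) (hA : IsClosed (A : Set G)) (l : Module.Dual ℝ (lieOf E T))
    (hl : ∀ X : lieOf E T, (X : LieAlg E G) ∈ lieOf E A → expG (X : LieAlg E G) = 1 →
      ∃ n : ℤ, l X = n * (2 * Real.pi)) :
    ∃ μ ∈ characterLattice E T, ∀ X : lieOf E T, (X : LieAlg E G) ∈ lieOf E A → μ X = l X := by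
  have hAcomm : ∀ x ∈ A, ∀ y ∈ A, x * y = y * x := fun x hx y hy => hT x (hAT hx) y (hAT hy)
  have hA0 : (expSubgroup (E := E) hAcomm : Set G) ⊆ T := (expSubgroup_le hAcomm).trans hAT
  have hspan := span_expKer (E := E) (expSubgroup_comm hAcomm)
    (hc.of_isClosed_subset (isClosed_expSubgroup hAcomm hA) hA0)
    (fun g hg => by rw [lieOf_expSubgroup]; exact hg)
  have hle : lieOfE (E := E) (expSubgroup (E := E) hAcomm) ≤ lieOfE T := by
    intro x hx
    rw [mem_lieOfE, lieOf_expSubgroup, mem_lieOf_iff hAcomm] at hx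
    rw [mem_lieOfE, mem_lieOf_iff hT]
    exact fun t => hAT (hx t)
  have hU : ∀ x : lieOfE (E := E) T, x ∈ (lieOfE (E := E) (expSubgroup (E := E) hAcomm)).comap
      (lieOfE (E := E) T).subtype ↔ (lieEquiv E G).symm x ∈ lieOf E A := by
    intro x
    rw [Submodule.mem_comap, Submodule.subtype_apply, mem_lieOfE, lieOf_expSubgroup]
  have := discreteTopology_expKer (E := E) hT
  have hspan' : (lieOfE (E := E) (expSubgroup (E := E) hAcomm)).comap (lieOfE (E := E) T).subtype ≤
      Submodule.span ℝ ((expKer (E := E) hT : Set (lieOfE (E := E) T)) ∩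
      (lieOfE (E := E) (expSubgroup (E := E) hAcomm)).comap (lieOfE (E := E) T).subtype) := by
    intro x hx
    have h1 := hspan.ge (Submodule.mem_top (x := ⟨x, hx⟩))
    have h2 := Submodule.mem_map_of_mem (f := Submodule.inclusion hle) h1
    rw [Submodule.map_span] at h2
    refine Submodule.span_mono ?_ h2
    rintro _ ⟨y, hy, rfl⟩
    exact ⟨hy, y.2⟩
  have hint : ∀ x ∈ expKer (E := E) hT,
      x ∈ (lieOfE (E := E) (expSubgroup (E := E) hAcomm)).comap (lieOfE (E := E) T).subtype →
      ∃ n : ℤ, (l ∘ₗ (lieOfEquiv (E := E) T).symm.toLinearMap) x = n * (2 * Real.pi) := by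
    intro x hx hxU
    have h1 := hl ((lieOfEquiv (E := E) T).symm x) ((hU x).mp hxU) ((mem_expKer hT).mp hx)
    exact h1
  obtain ⟨m, hm, hml⟩ := exists_integral_extension (expKer (E := E) hT) (span_expKer hT hc hexp)
    _ hspan' (l ∘ₗ (lieOfEquiv (E := E) T).symm.toLinearMap) (c := 2 * Real.pi) hint
  obtain ⟨χ, hχ⟩ := exists_isDifferential hT hc hexp
    (m ∘ₗ (lieOfEquiv (E := E) T).toLinearMap) fun X hX => hm (lieOfEquiv T X) hX
  refine ⟨_, ⟨χ, hχ⟩, fun X hX => ?_⟩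
  have := hml (lieOfEquiv T X) ((hU _).mpr hX)
  refine this.trans (congrArg l ?_)
  exact (lieOfEquiv T).symm_apply_apply X

/-! ### Products of exponentials in a compact ideal -/

/-- `c` is an ideal of the Lie algebra (as a subspace of the model space) on which the invariant form
`b` is positive definite; it acts trivially on its orthogonal complement. -/
structure IsCompactIdeal (G : Type*) [TopologicalSpace G] [ChartedSpace E G] [Group G]
    [LieGroup 𝓘(ℝ, E) ∞ G] [T2Space G] (c : Submodule ℝ E) (b : LinearMap.BilinForm ℝ E) : Prop where
  symm : ∀ x y, b x y = b y x
  invariant : ∀ (g : G) (x y), b (AdE E g x) (AdE E g y) = b x y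
  pos : ∀ x ∈ c, x ≠ 0 → 0 < b x x
  mem : ∀ x ∈ c, ∀ y ∈ c, AdE E (expE E G x) y ∈ c
  fix : ∀ x ∈ c, ∀ y, (∀ z ∈ c, b z y = 0) → AdE E (expE E G x) y = y

/-- The orthogonal projection on a subspace on which a possibly indefinite form is positive
definite. -/
lemma exists_orthogonal_add {V : Type*} [AddCommGroup V] [Module ℝ V] [FiniteDimensional ℝ V]
    {b : LinearMap.BilinForm ℝ V} (hb : ∀ x y, b x y = b y x) {c : Submodule ℝ V}
    (hpos : ∀ x ∈ c, x ≠ 0 → 0 < b x x) :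
    ∃ P : V →ₗ[ℝ] V, (∀ x, P x ∈ c) ∧ (∀ x ∈ c, P x = x) ∧ ∀ z ∈ c, ∀ x, b z (x - P x) = 0 := by
  have hrefl : b.IsRefl := fun x y h => by rw [hb]; exact h
  have hnd : (b.restrict c).Nondegenerate := by
    have hs : ∀ x : c, (∀ y : c, b x y = 0) → x = 0 := by
      intro x hx
      by_contra hne
      exact (hpos x x.2 (fun h => hne (Subtype.ext h))).ne' (hx x)
    exact ⟨hs, fun y hy => hs y fun x => by rw [hb]; exact hy x⟩
  have hc := LinearMap.BilinForm.isCompl_orthogonal_of_restrict_nondegenerate hrefl hnd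
  refine ⟨c.projection _ hc, fun x => Submodule.projection_apply_mem hc x,
    fun x hx => Submodule.projection_apply_of_mem_left hc hx, fun z hz x => ?_⟩
  have : x - c.projection _ hc x ∈ b.orthogonal c := by
    rw [← Submodule.projection_apply_eq_zero_iff hc, map_sub,
      Submodule.projection_apply_of_mem_left hc (Submodule.projection_apply_mem hc x), sub_self]
  exact this z hz

lemma exists_forall_le_form {b : LinearMap.BilinForm ℝ E} {c : Submodule ℝ E}
    (hpos : ∀ x ∈ c, x ≠ 0 → 0 < b x x) : ∃ m > 0, ∀ x ∈ c, m * ‖x‖ ^ 2 ≤ b x x := by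
  have : ProperSpace E := FiniteDimensional.proper_real E
  have hcont : Continuous fun x => b x x :=
    b.toContinuousBilinearMap.continuous.clm_apply continuous_id
  by_cases hne : (Metric.sphere (0 : E) 1 ∩ c).Nonempty
  · have hcomp : IsCompact (Metric.sphere (0 : E) 1 ∩ c) :=
      (isCompact_sphere 0 1).inter_right c.closed_of_finiteDimensional
    obtain ⟨x, ⟨hx1, hxc⟩, hx⟩ := hcomp.exists_isMinOn hne hcont.continuousOn
    rw [mem_sphere_zero_iff_norm] at hx1
    refine ⟨b x x, hpos x hxc (fun h => by simp [h] at hx1), fun y hy => ?_⟩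
    rcases eq_or_ne y 0 with rfl | hy0
    · simp
    have hn : ‖y‖ ≠ 0 := norm_ne_zero_iff.mpr hy0
    have h1 := hx (a := ‖y‖⁻¹ • y) ⟨by simp [norm_smul, hn], c.smul_mem _ hy⟩
    simp only [mem_ofPred_eq, map_smul, LinearMap.smul_apply, smul_eq_mul] at h1
    have h2 := mul_le_mul_of_nonneg_right h1 (sq_nonneg ‖y‖)
    calc _ ≤ _ := h2
      _ = _ := by field_simp
  · refine ⟨1, one_pos, fun x hx => ?_⟩
    rcases eq_or_ne x 0 with rfl | hx0
    · simp
    exact (hne ⟨‖x‖⁻¹ • x, by simp [norm_smul, hx0], c.smul_mem _ hx⟩).elim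

/-- The exponential map is injective near `0`. -/
lemma exists_expE_injOn : ∃ r > 0, ∀ x y : E, ‖x‖ < r → ‖y‖ < r →
    expE E G x = expE E G y → x = y := by
  have h := (hasStrictDerivOne_expE (E := E) (G := G)).exists_antilipschitz (c := 1) one_pos
    (fun v => by simp)
  obtain ⟨r, hr, h⟩ := Metric.eventually_nhds_iff_ball.mp h
  refine ⟨r, hr, fun x y hx hy hxy => ?_⟩
  have := h (x, y) (by rw [← ball_prod_same]; exact ⟨by simpa using hx, by simpa using hy⟩)
  simp only [hxy, sub_self, norm_zero] at this
  have h0 := norm_nonneg (x - y)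
  exact sub_eq_zero.mp (norm_eq_zero.mp (by linarith))

/-- For small `a`, commuting with `exp a` is the same as commuting with `a`, since the exponential
map is injective near `0`. -/
lemma IsCompactIdeal.eventually_AdE_eq {c : Submodule ℝ E} {b : LinearMap.BilinForm ℝ E}
    (hc : IsCompactIdeal G c b) : ∀ᶠ a in 𝓝 (0 : E), a ∈ c → ∀ w ∈ c,
      AdE E (expE E G a) w = w → ∀ t : ℝ, AdE E (expE E G (t • w)) a = a := by
  obtain ⟨r, hr, hinj⟩ := exists_expE_injOn (E := E) (G := G)
  obtain ⟨m, hm, hmb⟩ := exists_forall_le_form hc.pos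
  have hcont : Continuous fun x => b x x :=
    b.toContinuousBilinearMap.continuous.clm_apply continuous_id
  have h1 : ∀ᶠ a in 𝓝 (0 : E), b a a < m * r ^ 2 :=
    hcont.continuousAt.eventually_lt_const (by simp; positivity)
  filter_upwards [h1, Metric.ball_mem_nhds (0 : E) hr] with a ha har hac w hw haw t
  rw [mem_ball_zero_iff] at har
  have hwc := hc.mem (t • w) (c.smul_mem t hw) a hac
  refine hinj _ _ ?_ har ?_
  · have h2 := hmb _ hwc
    rw [hc.invariant] at h2
    have h3 : ‖AdE E (expE E G (t • w)) a‖ ^ 2 < r ^ 2 := lt_of_mul_lt_mul_left (h2.trans_lt ha) hm.le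
    exact lt_of_pow_lt_pow_left₀ 2 hr.le h3
  · rw [← conj_expE]
    have h4 := conj_expE (expE E G a) (t • w)
    rw [map_smul, haw] at h4
    rw [mul_inv_eq_iff_eq_mul] at h4 ⊢
    exact h4.symm

lemma AdE_expE_self (a : E) : AdE E (expE E G a) a = a := by
  have := Ad_expG_of_lie_eq_zero (lie_self ((lieEquiv E G).symm a))
  exact congrArg (lieEquiv E G) this

lemma expE_neg (a : E) : expE E G (-a) = (expE E G a)⁻¹ := by
  rw [expE, map_neg, expG_neg, expE]

lemma AdE_inv_AdE (g : G) (x : E) : AdE E g⁻¹ (AdE E g x) = x := by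
  rw [← ContinuousLinearMap.comp_apply, ← AdE_mul, inv_mul_cancel, AdE_one]; rfl

lemma AdE_AdE_inv (g : G) (x : E) : AdE E g (AdE E g⁻¹ x) = x := by
  rw [← ContinuousLinearMap.comp_apply, ← AdE_mul, mul_inv_cancel, AdE_one]; rfl

/-- For the isometry `Ad (exp (-a))` of `c`, the space `c` is the sum of the fixed vectors and of the
image of `Ad (exp (-a)) - 1`. -/
lemma IsCompactIdeal.exists_fixed_add {c : Submodule ℝ E} {b : LinearMap.BilinForm ℝ E}
    (hc : IsCompactIdeal G c b) {a : E} (ha : a ∈ c) {q : E} (hq : q ∈ c) :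
    ∃ w ∈ c, ∃ z ∈ c, AdE E (expE E G a) w = w ∧ q = w + (AdE E (expE E G (-a)) z - z) := by
  have hmem := hc.mem (-a) (c.neg_mem ha)
  let R : Submodule ℝ E := c.map ((AdE E (expE E G (-a)) : E →L[ℝ] E).toLinearMap - LinearMap.id)
  have hR : R ≤ c := by
    rintro _ ⟨z, hz, rfl⟩
    exact c.sub_mem (hmem z hz) hz
  obtain ⟨P, hP, -, hP2⟩ := exists_orthogonal_add hc.symm (fun x hx => hc.pos x (hR hx))
  obtain ⟨z, hz, hz2⟩ := hP q
  have hz3 : P q = AdE E (expE E G (-a)) z - z := hz2.symm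
  have hw : q - P q ∈ c := c.sub_mem hq (hR (hP q))
  refine ⟨q - P q, hw, z, hz, ?_, by rw [← hz3]; abel⟩
  set w := q - P q with hwdef
  have hfw := hc.mem a ha w hw
  by_contra hne
  have hd := c.sub_mem hfw hw
  refine (hc.pos _ hd (sub_ne_zero.mpr hne)).ne' ?_
  have key : ∀ y ∈ c, b (AdE E (expE E G a) w - w) y = 0 := by
    intro y hy
    have h1 := hP2 _ ⟨y, hy, rfl⟩ q
    change b (AdE E (expE E G (-a)) y - y) w = 0 at h1
    rw [LinearMap.map_sub₂, expE_neg, ← hc.invariant (expE E G a), AdE_AdE_inv] at h1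
    rw [LinearMap.map_sub₂, hc.symm _ y, hc.symm w y]
    exact h1
  exact key _ hd

lemma lie_eq_zero_of_AdE {w a : E} (h : ∀ t : ℝ, AdE E (expE E G (t • w)) a = a) :
    ⁅(lieEquiv E G).symm w, (lieEquiv E G).symm a⁆ = 0 := by
  refine lie_eq_zero_of_Ad fun t => ?_
  have := congrArg (lieEquiv E G).symm (h t)
  rwa [AdE_apply, LinearEquiv.symm_apply_apply, expE, map_smul] at this

/-- Two curves that agree to first order at `1` still do after left translation. -/
lemma hasDerivAt_chart_mul {g : G} (hg : g ∈ chartSource E G) : ∃ D : E →L[ℝ] E,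
    ∀ (α : ℝ → G) (L : ℝ →L[ℝ] E), HasStrictDerivOne α L →
      HasDerivAt (fun h => chart E (g * α h)) (D (L 1)) 0 := by
  have h1 : ContMDiffAt 𝓘(ℝ, E) 𝓘(ℝ, E) ∞ (fun x : E => chart E (g * chartSymm G x))
      (chart E (1 : G)) := by
    have hg' : g * chartSymm G (chart E (1 : G)) ∈ chartSource E G := by
      rwa [chartSymm_chart_one, mul_one]
    have := contMDiffAt_chart hg'
    refine ContMDiffAt.comp (g := chart E) (f := fun x : E => g * chartSymm G x) _ this ?_
    exact contMDiffAt_const.mul contMDiffAt_chartSymm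
  have h2 := (h1.contDiffAt.differentiableAt (by simp)).hasFDerivAt
  refine ⟨fderiv ℝ (fun x : E => chart E (g * chartSymm G x)) (chart E (1 : G)),
    fun α L hα => ?_⟩
  have h2' : HasFDerivAt (fun x : E => chart E (g * chartSymm G x))
      (fderiv ℝ (fun x : E => chart E (g * chartSymm G x)) (chart E (1 : G))) (chart E (α 0)) := by
    rw [hα.map_zero]; exact h2
  have h3 := HasFDerivAt.comp_hasDerivAt (l := fun x : E => chart E (g * chartSymm G x))
    (f := fun h => chart E (α h)) (0 : ℝ) h2' hα.deriv.hasFDerivAt.hasDerivAt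
  refine h3.congr_of_eventuallyEq ?_
  filter_upwards [eventually_chartSymm_comp hα] with h hh
  simp only [Function.comp_apply, hh]

lemma hasDerivAt_form (b : LinearMap.BilinForm ℝ E) (hb : ∀ x y, b x y = b y x) {v : ℝ → E} {d : E}
    {s : ℝ} (hv : HasDerivAt v d s) : HasDerivAt (fun s => b (v s) (v s)) (2 * b (v s) d) s := by
  have h1 := (b.toContinuousBilinearMap.hasFDerivAt.comp_hasDerivAt s hv).clm_apply hv
  refine h1.congr_deriv ?_
  change b d (v s) + b (v s) d = _
  rw [hb d, two_mul]

/-- The curve `exp (v s) = exp x exp (s q)` for small `x` in `c` and arbitrary `q` in `c`: it stays in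
`c`, and its energy has the derivative that it would have in a vector space. For the proof, the curve
is decomposed along `c` and its orthogonal complement. Writing `q = w + (Ad (exp (-a)) z - z)` with
`w` commuting with the component `a` in `c`, the curve agrees to first order with
`Ad (exp (h z)) (a + h w)`, which lies in `c` and has the energy of `a + h w`. -/
lemma IsCompactIdeal.exists_curve {c : Submodule ℝ E} {b : LinearMap.BilinForm ℝ E}
    (hc : IsCompactIdeal G c b) : ∀ᶠ x in 𝓝 (0 : E), x ∈ c → ∀ q ∈ c, ∃ v : ℝ → E, v 0 = x ∧
      (∀ᶠ s in 𝓝 (0 : ℝ), v s ∈ c ∧ expE E G (v s) = expE E G x * expE E G (s • q)) ∧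
      HasDerivAt (fun s => b (v s) (v s)) (2 * b x q) 0 := by
  have : IsTopologicalGroup G := topologicalGroup_of_lieGroup 𝓘(ℝ, E) ∞
  have : CompleteSpace E := FiniteDimensional.complete ℝ E
  obtain ⟨P₀, hPc, hPid, hPo⟩ := exists_orthogonal_add hc.symm hc.pos
  let P : E →L[ℝ] E := LinearMap.toContinuousLinearMap P₀
  replace hPc : ∀ x, P x ∈ c := hPc
  replace hPid : ∀ x ∈ c, P x = x := hPid
  replace hPo : ∀ z ∈ c, ∀ x, b z (x - P x) = 0 := hPo
  have hfix : ∀ y ∈ c, ∀ x, AdE E (expE E G y) (x - P x) = x - P x :=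
    fun y hy x => hc.fix y hy _ fun z hz => hPo z hz x
  let Ψ : E → G := fun v => expE E G (P v) * expE E G (v - P v)
  have hΨ : HasStrictDerivOne Ψ (ContinuousLinearMap.id ℝ E) :=
    ((hasStrictDerivOne_expE_clm (G := G) P).mul
      (hasStrictDerivOne_expE_clm (G := G) (ContinuousLinearMap.id ℝ E - P))).congr
      (fun _ => rfl) (add_sub_cancel _ _)
  have hanti := hΨ.exists_antilipschitz (c := 1) one_pos (fun v => by simp)
  have hsrc : ∀ᶠ v in 𝓝 (0 : E), Ψ v ∈ chartSource E G :=
    hΨ.continuousAt.eventually (by rw [hΨ.map_zero]; exact chartSource_mem_nhds_one)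
  have hP0 : Tendsto P (𝓝 0) (𝓝 0) := P.continuous.tendsto' _ _ P.map_zero
  obtain ⟨r, hr, hball⟩ := Metric.eventually_nhds_iff_ball.mp
    ((hP0.eventually hc.eventually_AdE_eq).and hsrc)
  obtain ⟨r', hr', hball'⟩ := Metric.eventually_nhds_iff_ball.mp hanti
  rw [← ball_prod_same] at hball'
  set U : Set E := Metric.ball 0 (min r r') with hUdef
  have hUo : IsOpen U := Metric.isOpen_ball
  have hU0 : U ∈ 𝓝 (0 : E) := Metric.ball_mem_nhds _ (lt_min hr hr')
  have hU1 : ∀ v ∈ U, _ := fun v hv => hball v (Metric.ball_subset_ball (min_le_left _ _) hv)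
  have hU2 : ∀ v ∈ U, ∀ w ∈ U, ‖v - w‖ ≤ 2 * ‖chart E (Ψ v) - chart E (Ψ w)‖ := by
    intro v hv w hw
    have := hball' (v, w) ⟨Metric.ball_subset_ball (min_le_right _ _) hv,
      Metric.ball_subset_ball (min_le_right _ _) hw⟩
    simp only at this
    linarith
  have hO : Ψ '' U ∈ 𝓝 (1 : G) := hΨ.nhds_le_map (fun x => ⟨x, rfl⟩) (image_mem_map hU0)
  have hOx : ∀ᶠ x in 𝓝 (0 : E), expE E G x ∈ interior (Ψ '' U) :=
    tendsto_expE_zero.eventually (interior_mem_nhds.mpr hO)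
  filter_upwards [hU0, hOx] with x hxU hxO hxc q hq
  have hcurve : Continuous fun s : ℝ => expE E G x * expE E G (s • q) :=
    continuous_const.mul (continuous_expE_smul q)
  have hev : ∀ᶠ s in 𝓝 (0 : ℝ), expE E G x * expE E G (s • q) ∈ interior (Ψ '' U) := by
    refine hcurve.continuousAt.eventually (isOpen_interior.mem_nhds ?_)
    simp only [zero_smul, expE_zero, mul_one]
    exact hxO
  obtain ⟨σ, hσ, hev⟩ := Metric.eventually_nhds_iff_ball.mp hev
  have hex : ∀ s ∈ Metric.ball (0 : ℝ) σ, ∃ v ∈ U, Ψ v = expE E G x * expE E G (s • q) :=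
    fun s hs => interior_subset (s := Ψ '' U) (hev s hs)
  choose! v hvU hvΨ using hex
  have h0σ : (0 : ℝ) ∈ Metric.ball (0 : ℝ) σ := Metric.mem_ball_self hσ
  have hv0 : v 0 = x := by
    have h1 := hU2 _ (hvU 0 h0σ) x hxU
    have e : Ψ x = Ψ (v 0) := by
      rw [hvΨ 0 h0σ, zero_smul, expE_zero, mul_one]
      simp only [Ψ]
      rw [hPid x hxc, sub_self, expE_zero, mul_one]
    rw [e, sub_self, norm_zero, mul_zero] at h1
    exact sub_eq_zero.mp (norm_eq_zero.mp (le_antisymm h1 (norm_nonneg _)))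
  have key : ∀ s ∈ Metric.ball (0 : ℝ) σ, ∃ d ∈ c, HasDerivAt v d s ∧
      b (P (v s)) d = b (P (v s)) q := by
    intro s hs
    set a := P (v s) with ha
    set e := v s - P (v s) with he
    have hac : a ∈ c := hPc _
    have hae : a + e = v s := add_sub_cancel _ _
    have hPe : P e = 0 := by rw [he, map_sub, hPid _ hac, sub_self]
    obtain ⟨w, hw, z, hz, haw, hq2⟩ := hc.exists_fixed_add hac hq
    have hcomm := (hU1 _ (hvU s hs)).1 hac w hw haw
    have hlie := lie_eq_zero_of_AdE hcomm
    -- the model curve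
    let m : ℝ → E := fun h => AdE E (expE E G (h • z)) (a + h • w) + e
    have hmem : ∀ h, AdE E (expE E G (h • z)) (a + h • w) ∈ c := fun h =>
      hc.mem _ (c.smul_mem _ hz) _ (c.add_mem hac (c.smul_mem _ hw))
    have hm0 : m 0 = v s := by
      simp only [m, zero_smul, expE_zero, AdE_one, add_zero, ContinuousLinearMap.id_apply, hae]
    have hAd : ∀ y : E, HasDerivAt (fun h : ℝ => AdE E (expE E G (h • z)) y)
        (lieEquiv E G ⁅(lieEquiv E G).symm z, (lieEquiv E G).symm y⁆) 0 := by
      intro y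
      have := hasDerivAt_AdE ((lieEquiv E G).symm z) y 0
      rw [zero_smul, expG_zero, AdE_one] at this
      exact this
    obtain ⟨d, hd⟩ : ∃ d, HasDerivAt m d 0 := by
      have h1 := ((hAd a).add ((hasDerivAt_id (0 : ℝ)).smul (hAd w))).add_const e
      refine ⟨_, h1.congr_of_eventuallyEq (Eventually.of_forall fun h => ?_)⟩
      simp only [m, map_add, map_smul]
      rfl
    have hPm : ∀ h, P (m h) = m h - e := by
      intro h
      simp only [m]
      rw [map_add, hPe, hPid _ (hmem h), add_zero, add_sub_cancel_right]
    have hdc : d ∈ c := by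
      have h1 : HasDerivAt (fun h => P (m h)) (P d) 0 := P.hasFDerivAt.comp_hasDerivAt (0 : ℝ) hd
      have h2 : HasDerivAt (fun h => P (m h)) d 0 :=
        (hd.sub_const e).congr_of_eventuallyEq (Eventually.of_forall hPm)
      rw [← h1.unique h2]
      exact hPc d
    -- both curves in the group
    have hΨv : ∀ h, s + h ∈ Metric.ball (0 : ℝ) σ → Ψ (v (s + h)) = Ψ (v s) * expE E G (h • q) := by
      intro h hh
      rw [hvΨ _ hh, hvΨ s hs, mul_assoc]
      exact congrArg _ (expG_add_smul ((lieEquiv E G).symm q) s h)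
    have hΨm : ∀ h : ℝ, Ψ (m h) = Ψ (v s) * (expE E G (h • AdE E (expE E G (-a)) z) *
        expE E G (h • w) * expE E G (h • (-z))) := by
      intro h
      have e1 : Ψ (m h) = expE E G (AdE E (expE E G (h • z)) (a + h • w)) * expE E G e := by
        simp only [Ψ]
        rw [hPm]
        simp only [m, add_sub_cancel_right, add_sub_cancel_left]
      have e2 : expE E G (a + h • w) = expE E G a * expE E G (h • w) := by
        have : ⁅(lieEquiv E G).symm a, (lieEquiv E G).symm (h • w)⁆ = 0 := by
          rw [map_smul, lie_smul, ← lie_skew, hlie, neg_zero, smul_zero]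
        have h3 := expG_add this
        rw [← map_add] at h3
        exact h3
      have e3 : ∀ y ∈ c, expE E G y * expE E G e = expE E G e * expE E G y := by
        intro y hy
        have h3 := conj_expE (expE E G y) e
        rw [hfix y hy] at h3
        exact mul_inv_eq_iff_eq_mul.mp h3
      rw [e1, ← conj_expE, e2, ← expE_neg, ← map_smul, ← conj_expE, expE_neg a, inv_inv]
      have e4 : Ψ (v s) = expE E G a * expE E G e := rfl
      rw [e4, smul_neg]
      have e5 := e3 (h • z) (c.smul_mem _ hz)
      have e6 := e3 (h • w) (c.smul_mem _ hw)
      have e7 := e3 a hac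
      have e8 := e3 (-(h • z)) (c.neg_mem (c.smul_mem _ hz))
      rw [e7]
      simp only [mul_assoc]
      rw [e8, ← mul_assoc (expE E G (h • w)) (expE E G e), e6, mul_assoc,
        ← mul_assoc (expE E G a) (expE E G e), e7, mul_assoc,
        ← mul_assoc (expE E G (h • z)) (expE E G e), e5, expE_neg]
      group
    obtain ⟨D, hD⟩ := hasDerivAt_chart_mul (hU1 _ (hvU s hs)).2
    have hα := hD _ _ (hasStrictDerivOne_expE_clm (G := G)
      (ContinuousLinearMap.toSpanSingleton ℝ q))
    have hβ := hD _ _ (((hasStrictDerivOne_expE_clm (G := G)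
      (ContinuousLinearMap.toSpanSingleton ℝ (AdE E (expE E G (-a)) z))).mul
      (hasStrictDerivOne_expE_clm (G := G) (ContinuousLinearMap.toSpanSingleton ℝ w))).mul
      (hasStrictDerivOne_expE_clm (G := G) (ContinuousLinearMap.toSpanSingleton ℝ (-z))))
    have hαβ := hα.sub hβ
    simp only [add_apply, ContinuousLinearMap.toSpanSingleton_apply, one_smul] at hαβ
    rw [← map_sub, show q - (AdE E (expE E G (-a)) z + w + -z) = 0 by nth_rw 1 [hq2]; abel,
      map_zero] at hαβ
    have hball2 : ∀ᶠ h in 𝓝 (0 : ℝ), s + h ∈ Metric.ball (0 : ℝ) σ := by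
      refine (continuous_const.add continuous_id).continuousAt.eventually
        (Metric.isOpen_ball.mem_nhds ?_)
      simpa using hs
    have hmU : ∀ᶠ h in 𝓝 (0 : ℝ), m h ∈ U :=
      hd.continuousAt.eventually (hUo.mem_nhds (by rw [hm0]; exact hvU s hs))
    have hlittle : (fun h : ℝ => v (s + h) - m h) =o[𝓝 0] fun h => h := by
      have h1 := hαβ.isLittleO
      simp only [sub_zero, smul_zero] at h1
      refine (Asymptotics.IsBigO.of_bound 2 ?_).trans_isLittleO h1
      filter_upwards [hball2, hmU] with h hh hhm
      have h2 := hU2 _ (hvU _ hh) _ hhm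
      rw [hΨv h hh, hΨm h] at h2
      simpa [expE_zero] using h2
    have hvd : HasDerivAt v d s := by
      rw [hasDerivAt_iff_isLittleO_nhds_zero]
      have h1 := hd.isLittleO
      simp only [sub_zero] at h1
      refine (hlittle.add h1).congr_left fun h => ?_
      rw [hm0]
      abel
    refine ⟨d, hdc, hvd, ?_⟩
    have h1 : HasDerivAt (fun h => b (P (m h)) (P (m h))) (2 * b (P (m 0)) d) 0 := by
      have h2 := hasDerivAt_form b hc.symm (hd.sub_const e)
      have h3 : (fun h => b (P (m h)) (P (m h))) = fun h => b (m h - e) (m h - e) := by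
        funext h; rw [hPm]
      rw [h3, hPm]
      exact h2
    have h2 : HasDerivAt (fun h : ℝ => b (a + h • w) (a + h • w)) (2 * b (a + (0 : ℝ) • w) w) 0 := by
      refine hasDerivAt_form b hc.symm ?_
      have := ((hasDerivAt_id (0 : ℝ)).smul_const w).const_add a
      rwa [one_smul] at this
    have h3 : (fun h => b (P (m h)) (P (m h))) = fun h : ℝ => b (a + h • w) (a + h • w) := by
      funext h
      rw [hPm]
      simp only [m, add_sub_cancel_right]
      rw [hc.invariant]
    rw [h3] at h1
    have h4 := h1.unique h2
    rw [hm0, zero_smul, add_zero] at h4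
    have h5 : b a (AdE E (expE E G (-a)) z) = b a z := by
      have h7 : AdE E (expE E G (-a)) a = a := by
        have := AdE_inv_AdE (expE E G a) a
        rwa [AdE_expE_self, ← expE_neg] at this
      have := hc.invariant (expE E G (-a)) a z
      rwa [h7] at this
    have h6 : b a q = b a w := by
      nth_rw 1 [hq2]
      rw [map_add, map_sub, h5, sub_self, add_zero]
    rw [h6]
    linarith
  have hvc : ∀ s ∈ Metric.ball (0 : ℝ) σ, v s ∈ c := by
    have h1 : ∀ s ∈ Metric.ball (0 : ℝ) σ,
        HasDerivWithinAt (fun s => v s - P (v s)) 0 (Metric.ball (0 : ℝ) σ) s := by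
      intro s hs
      obtain ⟨d, hd, hvd, -⟩ := key s hs
      have h2 := hvd.sub (P.hasFDerivAt.comp_hasDerivAt s hvd)
      rw [hPid d hd, sub_self] at h2
      exact h2.hasDerivWithinAt
    intro s hs
    have h2 := (convex_ball (0 : ℝ) σ).norm_image_sub_le_of_norm_hasDerivWithin_le (C := 0)
      h1 (fun _ _ => by simp) h0σ hs
    rw [zero_mul, hv0, hPid x hxc, sub_self, sub_zero] at h2
    have h3 : v s = P (v s) := sub_eq_zero.mp (norm_eq_zero.mp (le_antisymm h2 (norm_nonneg _)))
    rw [h3]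
    exact hPc _
  refine ⟨v, hv0, ?_, ?_⟩
  · filter_upwards [Metric.ball_mem_nhds (0 : ℝ) hσ] with s hs
    refine ⟨hvc s hs, ?_⟩
    rw [← hvΨ s hs]
    simp only [Ψ]
    rw [hPid _ (hvc s hs), sub_self, expE_zero, mul_one]
  · obtain ⟨d, -, hvd, hdq⟩ := key 0 h0σ
    have h1 := hasDerivAt_form b hc.symm hvd
    rw [hv0, hPid x hxc] at hdq
    rwa [hv0, hdq] at h1

/-! ### Discrete geodesics -/

variable (G) in
/-- The product `exp (x 0) ⋯ exp (x (n - 1))`. -/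
def prodExp (x : ℕ → E) : ℕ → G
  | 0 => 1
  | n + 1 => prodExp x n * expE E G (x n)

lemma prodExp_congr {x y : ℕ → E} {n : ℕ} (h : ∀ i < n, x i = y i) :
    prodExp G x n = prodExp G y n := by
  induction n with
  | zero => rfl
  | succ n ih => rw [prodExp, prodExp, ih fun i hi => h i (by omega), h n (by omega)]

lemma continuous_prodExp (n : ℕ) : Continuous fun x : ℕ → E => prodExp G x n := by
  have : IsTopologicalGroup G := topologicalGroup_of_lieGroup 𝓘(ℝ, E) ∞
  induction n with
  | zero => exact continuous_const
  | succ n ih => exact ih.mul (continuous_expE.comp (continuous_apply n))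

/-- Changing two consecutive factors without changing their product. -/
lemma prodExp_update {x y : ℕ → E} {i n : ℕ} (hin : i + 2 ≤ n)
    (h : ∀ j, j ≠ i → j ≠ i + 1 → x j = y j)
    (hi : expE E G (x i) * expE E G (x (i + 1)) = expE E G (y i) * expE E G (y (i + 1))) :
    prodExp G x n = prodExp G y n := by
  induction n, hin using Nat.le_induction with
  | base =>
    rw [prodExp, prodExp, prodExp, prodExp, mul_assoc, mul_assoc, hi,
      prodExp_congr fun j hj => h j (by omega) (by omega)]
  | succ n hn ih => rw [prodExp, prodExp, ih, h n (by omega) (by omega)]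

lemma prodExp_const (x : E) (n : ℕ) : prodExp G (fun _ => x) n = expE E G x ^ n := by
  induction n with
  | zero => rw [pow_zero]; rfl
  | succ n ih => rw [prodExp, ih, pow_succ]

variable {c : Submodule ℝ E} {b : LinearMap.BilinForm ℝ E}

/-- Words with arbitrarily small energy that represent an element of the analytic subgroup: every
factor is subdivided into many equal ones. -/
lemma exists_prodExp_eq {z : G} (hz : z ∈ Subgroup.closure (expE E G '' c)) {ε : ℝ} (hε : 0 < ε) :
    ∃ (n : ℕ) (x : ℕ → E), (∀ i, x i ∈ c) ∧ (∀ i, n ≤ i → x i = 0) ∧ prodExp G x n = z ∧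
      ∑ i ∈ Finset.range n, b (x i) (x i) < ε := by
  have step : ∀ (z : G) (y : E), y ∈ c → (∀ ε > 0, ∃ (n : ℕ) (x : ℕ → E), (∀ i, x i ∈ c) ∧
      (∀ i, n ≤ i → x i = 0) ∧ prodExp G x n = z ∧ ∑ i ∈ Finset.range n, b (x i) (x i) < ε) →
      ∀ ε > 0, ∃ (n : ℕ) (x : ℕ → E), (∀ i, x i ∈ c) ∧ (∀ i, n ≤ i → x i = 0) ∧
        prodExp G x n = z * expE E G y ∧ ∑ i ∈ Finset.range n, b (x i) (x i) < ε := by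
    intro z y hy h ε hε
    obtain ⟨n, x, hxc, hx0, hxz, hxε⟩ := h (ε / 2) (half_pos hε)
    obtain ⟨k, hk⟩ := exists_nat_gt (2 * |b y y| / ε)
    have hk0 : (0 : ℝ) < k := lt_of_le_of_lt (by positivity) hk
    let x' : ℕ → E := fun i => if i < n then x i else if i < n + k then (k : ℝ)⁻¹ • y else 0
    have h1 : ∀ j ≤ k, prodExp G x' (n + j) = z * expE E G ((k : ℝ)⁻¹ • y) ^ j := by
      intro j
      induction j with
      | zero =>
        intro _
        rw [add_zero, pow_zero, mul_one, ← hxz]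
        exact prodExp_congr fun i hi => if_pos hi
      | succ j ih =>
        intro hj
        have e : x' (n + j) = (k : ℝ)⁻¹ • y := by
          simp only [x']
          rw [if_neg (by omega), if_pos (by omega)]
        rw [← add_assoc, prodExp, ih (by omega), e, pow_succ, mul_assoc]
    refine ⟨n + k, x', fun i => ?_, fun i hi => ?_, ?_, ?_⟩
    · simp only [x']
      split_ifs
      exacts [hxc i, c.smul_mem _ hy, c.zero_mem]
    · simp only [x']
      rw [if_neg (by omega), if_neg (by omega)]
    · rw [h1 k le_rfl, ← expE_nsmul, smul_smul, mul_inv_cancel₀ hk0.ne', one_smul]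
    · rw [Finset.sum_range_add]
      have e1 : ∑ i ∈ Finset.range n, b (x' i) (x' i) = ∑ i ∈ Finset.range n, b (x i) (x i) := by
        refine Finset.sum_congr rfl fun i hi => ?_
        simp only [x']
        rw [if_pos (Finset.mem_range.mp hi)]
      have e2 : ∑ i ∈ Finset.range k, b (x' (n + i)) (x' (n + i)) = (k : ℝ)⁻¹ * b y y := by
        have e3 : ∀ i ∈ Finset.range k, b (x' (n + i)) (x' (n + i)) =
            (k : ℝ)⁻¹ * ((k : ℝ)⁻¹ * b y y) := by
          intro i hi
          have hik := Finset.mem_range.mp hi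
          simp only [x']
          rw [if_neg (by omega), if_pos (by omega), map_smul, LinearMap.map_smul₂,
            smul_eq_mul, smul_eq_mul]
        rw [Finset.sum_congr rfl e3, Finset.sum_const, Finset.card_range, nsmul_eq_mul,
          mul_inv_cancel_left₀ hk0.ne']
      rw [e1, e2]
      have h2 : (k : ℝ)⁻¹ * b y y < ε / 2 := by
        rw [inv_mul_lt_iff₀ hk0]
        rw [div_lt_iff₀ hε] at hk
        have := le_abs_self (b y y)
        linarith
      linarith
  have main : ∀ ε > 0, ∃ (n : ℕ) (x : ℕ → E), (∀ i, x i ∈ c) ∧ (∀ i, n ≤ i → x i = 0) ∧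
      prodExp G x n = z ∧ ∑ i ∈ Finset.range n, b (x i) (x i) < ε := by
    induction hz using Subgroup.closure_induction_right with
    | one => exact fun ε hε => ⟨0, 0, fun _ => c.zero_mem, fun _ _ => rfl, rfl, by simpa using hε⟩
    | mul_right z _ y hy ih =>
      obtain ⟨y, hy, rfl⟩ := hy
      exact step _ _ hy ih
    | mul_inv_cancel z _ y hy ih =>
      obtain ⟨y, hy, rfl⟩ := hy
      rw [← expE_neg]
      exact step _ _ (c.neg_mem hy) ih
  exact main ε hε

lemma sum_range_eq_add_of_forall {f g : ℕ → ℝ} {i n : ℕ} (hin : i + 2 ≤ n)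
    (h : ∀ j, j ≠ i → j ≠ i + 1 → f j = g j) :
    ∑ j ∈ Finset.range n, f j - ∑ j ∈ Finset.range n, g j =
      (f i - g i) + (f (i + 1) - g (i + 1)) := by
  rw [← Finset.sum_sub_distrib, ← Finset.sum_subset (s₁ := {i, i + 1}), Finset.sum_pair (by omega)]
  · intro j hj
    rw [Finset.mem_insert, Finset.mem_singleton] at hj
    exact Finset.mem_range.mpr (by omega)
  · intro j _ hj
    rw [Finset.mem_insert, Finset.mem_singleton, not_or] at hj
    rw [h j hj.1 hj.2, sub_self]

/-- The elements of the analytic subgroup with Lie algebra `c` are exponentials. Among the words of a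
fixed large length that represent the element, the one of minimal energy has equal factors. -/
theorem IsCompactIdeal.exists_expE_eq (hc : IsCompactIdeal G c b) {z : G}
    (hz : z ∈ Subgroup.closure (expE E G '' c)) : ∃ x ∈ c, expE E G x = z := by
  have : ProperSpace E := FiniteDimensional.proper_real E
  obtain ⟨m, hm, hmb⟩ := exists_forall_le_form hc.pos
  obtain ⟨ρ, hρ, hcurve⟩ := Metric.eventually_nhds_iff_ball.mp hc.exists_curve
  obtain ⟨n, x₀, hx₀c, hx₀0, hx₀z, hx₀ε⟩ :=
    exists_prodExp_eq (b := b) hz (ε := m * (ρ / 2) ^ 2) (by positivity)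
  have hnonneg : ∀ x ∈ c, 0 ≤ b x x := fun x hx =>
    (mul_nonneg hm.le (sq_nonneg ‖x‖)).trans (hmb x hx)
  let F : (ℕ → E) → ℝ := fun x => ∑ i ∈ Finset.range n, b (x i) (x i)
  let M : Set (ℕ → E) := {x | (∀ i, x i ∈ c) ∧ (∀ i, n ≤ i → x i = 0) ∧ prodExp G x n = z}
  -- words of small energy have small factors
  have hsmall : ∀ x ∈ M, F x ≤ F x₀ → ∀ i, ‖x i‖ ≤ ρ / 2 := by
    intro x hx hF i
    rcases lt_or_ge i n with hi | hi
    · have h1 : b (x i) (x i) ≤ F x :=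
        Finset.single_le_sum (f := fun i => b (x i) (x i)) (fun j _ => hnonneg _ (hx.1 j))
          (Finset.mem_range.mpr hi)
      have h2 := hmb _ (hx.1 i)
      have h3 : m * ‖x i‖ ^ 2 < m * (ρ / 2) ^ 2 := by
        have : F x₀ < m * (ρ / 2) ^ 2 := hx₀ε
        linarith
      exact (lt_of_pow_lt_pow_left₀ 2 (by positivity) (lt_of_mul_lt_mul_left h3 hm.le)).le
    · rw [hx.2.1 i hi, norm_zero]
      positivity
  let M' : Set (ℕ → E) := M ∩ univ.pi fun _ => Metric.closedBall 0 (ρ / 2)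
  have hMcl : IsClosed M := by
    have h1 : IsClosed {x : ℕ → E | ∀ i, x i ∈ c} := by
      simp only [ofPred_forall]
      exact isClosed_iInter fun i =>
        c.closed_of_finiteDimensional.preimage (continuous_apply (A := fun _ => E) i)
    have h2 : IsClosed {x : ℕ → E | ∀ i, n ≤ i → x i = 0} := by
      simp only [ofPred_forall]
      exact isClosed_iInter fun i => isClosed_iInter fun _ =>
        isClosed_eq (continuous_apply i) continuous_const
    exact h1.inter (h2.inter (isClosed_eq (continuous_prodExp n) continuous_const))
  have hM'c : IsCompact M' :=
    (isCompact_univ_pi fun _ => isCompact_closedBall (0 : E) (ρ / 2)).inter_left hMcl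
  have hx₀M : x₀ ∈ M := ⟨hx₀c, hx₀0, hx₀z⟩
  have hx₀M' : x₀ ∈ M' := ⟨hx₀M, fun i _ => by simpa using hsmall x₀ hx₀M le_rfl i⟩
  have hbcont : Continuous fun x => b x x :=
    b.toContinuousBilinearMap.continuous.clm_apply continuous_id
  have hFcont : Continuous F :=
    continuous_finsetSum _ fun i _ => hbcont.comp (continuous_apply i)
  obtain ⟨x, hxM', hxmin'⟩ := hM'c.exists_isMinOn ⟨x₀, hx₀M'⟩ hFcont.continuousOn
  have hxM : x ∈ M := hxM'.1
  have hFx : F x ≤ F x₀ := hxmin' hx₀M'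
  have hxmin : ∀ y ∈ M, F x ≤ F y := by
    intro y hy
    rcases le_or_gt (F y) (F x₀) with h | h
    · exact hxmin' (⟨hy, fun i _ => by simpa using hsmall y hy h i⟩ : y ∈ M')
    · exact hFx.trans h.le
  have hball : ∀ i, x i ∈ Metric.ball (0 : E) ρ := by
    intro i
    have := hsmall x hxM hFx i
    rw [mem_ball_zero_iff]
    linarith
  -- consecutive factors are equal
  have heq : ∀ i, i + 2 ≤ n → x i = x (i + 1) := by
    intro i hin
    set q := x i - x (i + 1) with hq
    have hqc : q ∈ c := c.sub_mem (hxM.1 _) (hxM.1 _)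
    obtain ⟨v, hv0, hv, hvd⟩ := hcurve _ (hball i) (hxM.1 i) q hqc
    obtain ⟨w, hw0, hw, hwd⟩ := hcurve (-x (i + 1)) (by simpa using hball (i + 1))
      (c.neg_mem (hxM.1 _)) q hqc
    have hmin : IsLocalMin (fun s => b (v s) (v s) + b (w s) (w s)) 0 := by
      filter_upwards [hv, hw] with s hvs hws
      let y : ℕ → E := fun j => if j = i then v s else if j = i + 1 then -w s else x j
      have hyi : y i = v s := if_pos rfl
      have hyi1 : y (i + 1) = -w s := by
        simp [y]
      have hyj : ∀ j, j ≠ i → j ≠ i + 1 → y j = x j := by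
        intro j h1 h2
        simp only [y]
        rw [if_neg h1, if_neg h2]
      have hyM : y ∈ M := by
        refine ⟨fun j => ?_, fun j hj => ?_, ?_⟩
        · simp only [y]
          split_ifs
          exacts [hvs.1, c.neg_mem hws.1, hxM.1 j]
        · rw [hyj j (by omega) (by omega), hxM.2.1 j hj]
        · rw [← hxM.2.2]
          refine prodExp_update hin hyj ?_
          rw [hyi, hyi1, expE_neg, hvs.2, hws.2, expE_neg]
          group
      have h1 := hxmin y hyM
      have h2 := sum_range_eq_add_of_forall (f := fun j => b (y j) (y j))
        (g := fun j => b (x j) (x j)) hin (fun j h1 h2 => by simp only [hyj j h1 h2])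
      simp only [hyi, hyi1, map_neg, LinearMap.neg_apply, neg_neg] at h2
      simp only [F] at h1
      simp only [hv0, hw0, map_neg, LinearMap.neg_apply, neg_neg]
      linarith
    have h0 := hmin.hasDerivAt_eq_zero (hvd.add hwd)
    have h3 : b q q = 0 := by
      have e : b q q = b (x i) q - b (x (i + 1)) q := by
        nth_rw 1 [hq]
        rw [LinearMap.map_sub₂]
      simp only [map_neg, LinearMap.neg_apply] at h0
      linarith
    by_contra hne
    exact (hc.pos q hqc (sub_ne_zero.mpr hne)).ne' h3
  have hconst : ∀ i < n, x i = x 0 := by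
    intro i
    induction i with
    | zero => exact fun _ => rfl
    | succ i ih =>
      intro hi
      rw [← heq i (by omega), ih (by omega)]
  refine ⟨(n : ℝ) • x 0, c.smul_mem _ (hxM.1 0), ?_⟩
  rw [expE_nsmul, ← prodExp_const, ← hxM.2.2]
  exact (prodExp_congr hconst).symm

/-! ### Compact ideals of a reductive Lie algebra -/

section Trace

variable {V : Type*} [AddCommGroup V] [Module ℝ V] [FiniteDimensional ℝ V]

/-- The trace of an endomorphism in terms of a positive definite form. -/
lemma exists_trace_eq {b : LinearMap.BilinForm ℝ V} (hb : ∀ x y, b x y = b y x)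
    (hpos : ∀ x, x ≠ 0 → 0 < b x x) : ∃ (n : ℕ) (v : Module.Basis (Fin n) ℝ V),
      ∀ A : V →ₗ[ℝ] V, LinearMap.trace ℝ V A = ∑ i, (b (v i) (v i))⁻¹ * b (v i) (A (v i)) := by
  obtain ⟨v, hv⟩ := LinearMap.BilinForm.exists_orthogonal_basis (B := b) ⟨hb⟩
  refine ⟨_, v, fun A => ?_⟩
  have hrepr : ∀ x i, b (v i) x = v.repr x i * b (v i) (v i) := by
    intro x i
    conv_lhs => rw [← v.sum_repr x]
    rw [map_sum, Finset.sum_eq_single i]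
    · rw [map_smul, smul_eq_mul]
    · intro j _ hj
      rw [map_smul, LinearMap.isOrthoᵢ_def.mp hv i j hj.symm, smul_zero]
    · intro h; exact absurd (Finset.mem_univ i) h
  rw [LinearMap.trace_eq_matrix_trace ℝ v, Matrix.trace]
  refine Finset.sum_congr rfl fun i _ => ?_
  rw [Matrix.diag_apply, LinearMap.toMatrix_apply, hrepr (A (v i)), mul_comm, mul_assoc,
    mul_inv_cancel₀ (hpos _ (v.ne_zero i)).ne', mul_one]

lemma eq_zero_of_sum_eq_zero {b : LinearMap.BilinForm ℝ V} (hpos : ∀ x, x ≠ 0 → 0 < b x x)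
    {n : ℕ} (v : Module.Basis (Fin n) ℝ V) {A : V →ₗ[ℝ] V}
    (h : ∑ i, (b (v i) (v i))⁻¹ * b (A (v i)) (A (v i)) ≤ 0) : A = 0 := by
  have hnn : ∀ x, 0 ≤ b x x := by
    intro x
    rcases eq_or_ne x 0 with rfl | hx
    · simp
    · exact (hpos x hx).le
  refine v.ext fun i => ?_
  have h0 : ∀ i ∈ Finset.univ, 0 ≤ (b (v i) (v i))⁻¹ * b (A (v i)) (A (v i)) := fun i _ =>
    mul_nonneg (inv_nonneg.mpr (hnn _)) (hnn _)
  have h1 := (Finset.sum_eq_zero_iff_of_nonneg h0).mp (le_antisymm h (Finset.sum_nonneg h0)) i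
    (Finset.mem_univ i)
  by_contra hne
  exact (mul_pos (inv_pos.mpr (hpos _ (v.ne_zero i))) (hpos _ hne)).ne' h1

/-- The square of a nonzero endomorphism that is skew for a positive definite form has negative
trace. -/
lemma trace_sq_neg_of_skew {b : LinearMap.BilinForm ℝ V} (hb : ∀ x y, b x y = b y x)
    (hpos : ∀ x, x ≠ 0 → 0 < b x x) {A : V →ₗ[ℝ] V} (hA : ∀ x y, b (A x) y = -b x (A y))
    (h0 : A ≠ 0) : LinearMap.trace ℝ V (A ∘ₗ A) < 0 := by
  obtain ⟨n, v, hv⟩ := exists_trace_eq hb hpos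
  by_contra! h
  refine h0 (eq_zero_of_sum_eq_zero hpos v ?_)
  rw [hv] at h
  have e : ∀ i, (b (v i) (v i))⁻¹ * b (A (v i)) (A (v i)) =
      -((b (v i) (v i))⁻¹ * b (v i) ((A ∘ₗ A) (v i))) := by
    intro i
    rw [hA, LinearMap.comp_apply]
    ring
  rw [Finset.sum_congr rfl fun i _ => e i, Finset.sum_neg_distrib]
  linarith

lemma trace_sq_nonneg_of_symm {b : LinearMap.BilinForm ℝ V} (hb : ∀ x y, b x y = b y x)
    (hpos : ∀ x, x ≠ 0 → 0 < b x x) {A : V →ₗ[ℝ] V} (hA : ∀ x y, b (A x) y = b x (A y)) :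
    0 ≤ LinearMap.trace ℝ V (A ∘ₗ A) := by
  obtain ⟨n, v, hv⟩ := exists_trace_eq hb hpos
  rw [hv]
  refine Finset.sum_nonneg fun i _ => ?_
  rw [LinearMap.comp_apply, ← hA]
  refine mul_nonneg (inv_nonneg.mpr (hpos _ (v.ne_zero i)).le) ?_
  rcases eq_or_ne (A (v i)) 0 with h | h
  · rw [h, map_zero]
  · exact (hpos _ h).le

end Trace

section Algebra

variable {𝔤 : Type*} [LieRing 𝔤] [LieAlgebra ℝ 𝔤]

lemma dual_eq_zero_of_mem_commutator {l : Module.Dual ℝ 𝔤} (hl : ∀ X Y : 𝔤, l ⁅X, Y⁆ = 0) {X : 𝔤}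
    (hX : X ∈ ⁅(⊤ : LieIdeal ℝ 𝔤), (⊤ : LieIdeal ℝ 𝔤)⁆) : l X = 0 := by
  have h : (⁅(⊤ : LieIdeal ℝ 𝔤), (⊤ : LieIdeal ℝ 𝔤)⁆ : LieIdeal ℝ 𝔤).toSubmodule ≤ LinearMap.ker l := by
    rw [LieSubmodule.lieIdeal_oper_eq_linear_span', Submodule.span_le]
    rintro _ ⟨Y, -, Z, -, rfl⟩
    exact hl Y Z
  exact h hX

lemma lie_mem_commutator (X Y : 𝔤) : ⁅X, Y⁆ ∈ ⁅(⊤ : LieIdeal ℝ 𝔤), (⊤ : LieIdeal ℝ 𝔤)⁆ :=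
  LieSubmodule.lie_mem_lie (LieSubmodule.mem_top X) (LieSubmodule.mem_top Y)

namespace IsCartanDecomposition

variable {k p : Submodule ℝ 𝔤} {B : LinearMap.BilinForm ℝ 𝔤} (D : IsCartanDecomposition k p B)

include D

lemma lie_pk {X Y : 𝔤} (hX : X ∈ p) (hY : Y ∈ k) : ⁅X, Y⁆ ∈ p := by
  rw [← lie_skew]
  exact p.neg_mem (D.lie_kp Y hY X hX)

lemma lie_left' (X Y Z : 𝔤) : B ⁅X, Y⁆ Z = B X ⁅Y, Z⁆ := by
  rw [← lie_skew, map_neg, LinearMap.neg_apply, D.lie_left, neg_neg]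

lemma form_pk {X Y : 𝔤} (hX : X ∈ p) (hY : Y ∈ k) : B X Y = 0 := by
  rw [D.symm]
  exact D.orthogonal Y hY X hX

lemma eq_zero_of_mem_k {X : 𝔤} (hX : X ∈ k) (h : ∀ Y ∈ k, B X Y = 0) : X = 0 := by
  by_contra hne
  exact (D.neg_def X hX hne).ne (h X hX)

lemma eq_zero_of_mem_p {X : 𝔤} (hX : X ∈ p) (h : ∀ Y ∈ p, B X Y = 0) : X = 0 := by
  by_contra hne
  exact (D.pos_def X hX hne).ne' (h X hX)

lemma mem_k_of_orthogonal {X : 𝔤} (h : ∀ Y ∈ p, B X Y = 0) : X ∈ k := by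
  obtain ⟨Y, hY, Z, hZ, rfl⟩ := D.exists_add X
  have : Z = 0 := D.eq_zero_of_mem_p hZ fun V hV => by
    have := h V hV
    rwa [map_add, LinearMap.add_apply, D.orthogonal Y hY V hV, zero_add] at this
  rwa [this, add_zero]

lemma nondegenerate {X : 𝔤} (h : ∀ Y, B X Y = 0) : X = 0 :=
  D.eq_zero_of_mem_k (D.mem_k_of_orthogonal fun Y _ => h Y) fun Y _ => h Y

/-- The ideal of the elements of `𝔨` that commute with `𝔭`. -/
def centralIdeal : LieIdeal ℝ 𝔤 where
  carrier := {X | X ∈ k ∧ ∀ Y ∈ p, ⁅X, Y⁆ = 0}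
  add_mem' := by
    rintro X Y ⟨hX, hX'⟩ ⟨hY, hY'⟩
    exact ⟨k.add_mem hX hY, fun Z hZ => by rw [add_lie, hX' Z hZ, hY' Z hZ, add_zero]⟩
  zero_mem' := ⟨k.zero_mem, fun Z _ => zero_lie Z⟩
  smul_mem' := by
    rintro a X ⟨hX, hX'⟩
    exact ⟨k.smul_mem a hX, fun Z hZ => by rw [smul_lie, hX' Z hZ, smul_zero]⟩
  lie_mem := by
    rintro X Y ⟨hY, hY'⟩
    obtain ⟨V, hV, W, hW, rfl⟩ := D.exists_add X
    have hYW : ⁅W, Y⁆ = 0 := by rw [← lie_skew, hY' W hW, neg_zero]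
    rw [add_lie, hYW, add_zero]
    refine ⟨D.lie_kk V hV Y hY, fun Z hZ => ?_⟩
    rw [lie_lie, hY' Z hZ, hY' _ (D.lie_kp V hV Z hZ), lie_zero, sub_zero]

variable [FiniteDimensional ℝ 𝔤]

/-- An element of `𝔨` is the sum of a central element and an element of `[𝔤, 𝔤]`, both in `𝔨`. -/
lemma exists_center_add {X : 𝔤} (hX : X ∈ k) : ∃ Z ∈ k, (∀ Y : 𝔤, ⁅Y, Z⁆ = 0) ∧
    ∃ W ∈ k, W ∈ ⁅(⊤ : LieIdeal ℝ 𝔤), (⊤ : LieIdeal ℝ 𝔤)⁆ ∧ X = Z + W := by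
  obtain ⟨P, hP, -, hPo⟩ := exists_orthogonal_add (b := -B) (fun x y => by simp [D.symm x y])
    (c := k ⊓ (⁅(⊤ : LieIdeal ℝ 𝔤), (⊤ : LieIdeal ℝ 𝔤)⁆ : LieIdeal ℝ 𝔤).toSubmodule)
    (fun x hx hx0 => by simpa using D.neg_def x hx.1 hx0)
  have hZ : X - P X ∈ k := k.sub_mem hX (hP X).1
  have hk : ∀ V ∈ k, V ∈ ⁅(⊤ : LieIdeal ℝ 𝔤), (⊤ : LieIdeal ℝ 𝔤)⁆ → B (X - P X) V = 0 := by
    intro V hV hV'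
    have := hPo V ⟨hV, hV'⟩ X
    rw [LinearMap.neg_apply, LinearMap.neg_apply, neg_eq_zero, D.symm] at this
    exact this
  have h1 : ∀ Y ∈ k, ⁅X - P X, Y⁆ = 0 := fun Y hY =>
    D.eq_zero_of_mem_k (D.lie_kk _ hZ Y hY) fun V hV => by
      rw [D.lie_left']
      exact hk _ (D.lie_kk Y hY V hV) (lie_mem_commutator Y V)
  have h2 : ∀ Y ∈ p, ⁅X - P X, Y⁆ = 0 := fun Y hY =>
    D.eq_zero_of_mem_p (D.lie_kp _ hZ Y hY) fun V hV => by
      rw [D.lie_left']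
      exact hk _ (D.lie_pp Y hY V hV) (lie_mem_commutator Y V)
  refine ⟨X - P X, hZ, fun Y => ?_, P X, (hP X).1, (hP X).2, (sub_add_cancel X (P X)).symm⟩
  obtain ⟨V, hV, W, hW, rfl⟩ := D.exists_add Y
  rw [← lie_skew, lie_add, h1 V hV, h2 W hW, add_zero, neg_zero]

/-- A central element is orthogonal to the commutators. -/
lemma form_eq_zero_of_center {Z : 𝔤} (hZ : ∀ Y : 𝔤, ⁅Y, Z⁆ = 0) {X : 𝔤}
    (hX : X ∈ ⁅(⊤ : LieIdeal ℝ 𝔤), (⊤ : LieIdeal ℝ 𝔤)⁆) : B Z X = 0 :=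
  dual_eq_zero_of_mem_commutator (l := B Z) (fun V W => by
    rw [← D.lie_left', ← lie_skew, hZ, neg_zero, map_zero, LinearMap.zero_apply]) hX

/-- The positive definite form that equals `-B` on `𝔨` and `B` on `𝔭`; the elements of `𝔭` act by
symmetric endomorphisms and those of `𝔨` by skew ones. -/
lemma exists_positive_form : ∃ b : LinearMap.BilinForm ℝ 𝔤, (∀ x y, b x y = b y x) ∧
    (∀ x, x ≠ 0 → 0 < b x x) ∧ (∀ Y ∈ p, ∀ x y, b ⁅Y, x⁆ y = b x ⁅Y, y⁆) ∧
    ∀ Y ∈ k, ∀ x y, b ⁅Y, x⁆ y = -b x ⁅Y, y⁆ := by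
  obtain ⟨P, hP, hPid, hPo⟩ := exists_orthogonal_add (b := -B) (fun x y => by simp [D.symm x y])
    (c := k) (fun x hx hx0 => by simpa using D.neg_def x hx hx0)
  have hPp : ∀ x ∈ p, P x = 0 := fun x hx => D.eq_zero_of_mem_k (hP x) fun Y hY => by
    have := hPo Y hY x
    rw [map_sub, LinearMap.neg_apply, LinearMap.neg_apply, LinearMap.neg_apply,
      D.orthogonal Y hY x hx] at this
    rw [D.symm]
    linarith
  let b : LinearMap.BilinForm ℝ 𝔤 := B - (2 : ℝ) • (B ∘ₗ P)
  have hb : ∀ x ∈ k, ∀ y ∈ p, ∀ x' ∈ k, ∀ y' ∈ p,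
      b (x + y) (x' + y') = -B x x' + B y y' := by
    intro x hx y hy x' hx' y' hy'
    simp only [b, LinearMap.sub_apply, LinearMap.smul_apply, LinearMap.comp_apply, map_add,
      LinearMap.add_apply, hPid x hx, hPp y hy, map_zero, LinearMap.zero_apply,
      D.orthogonal x hx y' hy', D.form_pk hy hx', smul_eq_mul]
    ring
  refine ⟨b, fun x y => ?_, fun x hx => ?_, fun Y hY x y => ?_, fun Y hY x y => ?_⟩
  · obtain ⟨x, hx, x', hx', rfl⟩ := D.exists_add x
    obtain ⟨y, hy, y', hy', rfl⟩ := D.exists_add y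
    rw [hb x hx x' hx' y hy y' hy', hb y hy y' hy' x hx x' hx', D.symm x y, D.symm x' y']
  · obtain ⟨x, hx1, x', hx', rfl⟩ := D.exists_add x
    rw [hb x hx1 x' hx' x hx1 x' hx']
    rcases eq_or_ne x 0 with rfl | h
    · rw [zero_add] at hx
      simpa using D.pos_def x' hx' hx
    · have h1 := D.neg_def x hx1 h
      rcases eq_or_ne x' 0 with rfl | h'
      · simpa using h1
      · have h2 := D.pos_def x' hx' h'
        linarith
  · obtain ⟨x, hx, x', hx', rfl⟩ := D.exists_add x
    obtain ⟨y, hy, y', hy', rfl⟩ := D.exists_add y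
    rw [lie_add, lie_add, add_comm ⁅Y, x⁆, add_comm ⁅Y, y⁆,
      hb _ (D.lie_pp Y hY x' hx') _ (D.lie_pk hY hx) y hy y' hy',
      hb x hx x' hx' _ (D.lie_pp Y hY y' hy') _ (D.lie_pk hY hy), D.lie_left, D.lie_left]
    ring
  · obtain ⟨x, hx, x', hx', rfl⟩ := D.exists_add x
    obtain ⟨y, hy, y', hy', rfl⟩ := D.exists_add y
    rw [lie_add, lie_add, hb _ (D.lie_kk Y hY x hx) _ (D.lie_kp Y hY x' hx') y hy y' hy',
      hb x hx x' hx' _ (D.lie_kk Y hY y hy) _ (D.lie_kp Y hY y' hy'), D.lie_left, D.lie_left]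
    ring

/-- An ideal with negative definite Killing form commutes with `𝔭`: on it, the elements of `𝔭` act
by endomorphisms that are both symmetric and skew. -/
lemma lie_eq_zero_of_killing {J : LieIdeal ℝ 𝔤} (hJ : ∀ X : J, X ≠ 0 → killingForm ℝ J X X < 0)
    {X Y : 𝔤} (hX : X ∈ J) (hY : Y ∈ p) : ⁅Y, X⁆ = 0 := by
  obtain ⟨b, hb, hbpos, hbY, -⟩ := D.exists_positive_form
  let A : J →ₗ[ℝ] J := ((LieAlgebra.ad ℝ 𝔤 Y : 𝔤 →ₗ[ℝ] 𝔤)).restrict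
    (p := J.toSubmodule) (q := J.toSubmodule) fun x hx => lie_mem_right ℝ 𝔤 J Y x hx
  have hA : ∀ x : J, (A x : 𝔤) = ⁅Y, (x : 𝔤)⁆ := fun x => rfl
  have hA0 : A = 0 := by
    by_contra hne
    refine (trace_sq_neg_of_skew (b := -killingForm ℝ J)
      (fun x y => by simp [LieModule.traceForm_comm ℝ J J x y]) (fun x hx => by simpa using hJ x hx)
      (A := A) (fun x y => ?_) hne).not_ge
      (trace_sq_nonneg_of_symm (b := b.restrict J.toSubmodule) (fun x y => hb _ _)
        (fun x hx => hbpos _ fun h => hx (Subtype.ext h)) fun x y => hbY Y hY _ _)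
    have e : ∀ x y : J, killingForm ℝ J x y = killingForm ℝ 𝔤 x y := fun x y => by
      rw [LieIdeal.killingForm_eq]; rfl
    rw [LinearMap.neg_apply, LinearMap.neg_apply, LinearMap.neg_apply, LinearMap.neg_apply, e, e, hA,
      hA, LieModule.traceForm_apply_lie_apply']
  exact congrArg Subtype.val (LinearMap.congr_fun hA0 ⟨X, hX⟩)

/-- The compact simple factors lie in `𝔨` and commute with `𝔭`. -/
lemma sSup_le_centralIdeal : sSup {J : LieIdeal ℝ 𝔤 |
    J ≤ ⁅(⊤ : LieIdeal ℝ 𝔤), (⊤ : LieIdeal ℝ 𝔤)⁆ ∧ LieAlgebra.IsSimple ℝ J ∧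
      ∀ X : J, X ≠ 0 → killingForm ℝ J X X < 0} ≤ D.centralIdeal := by
  refine sSup_le ?_
  rintro J ⟨-, hs, hJ⟩ X hX
  have h0 : ∀ X ∈ J, ∀ Y ∈ p, ⁅X, Y⁆ = 0 := fun X hX Y hY => by
    rw [← lie_skew, D.lie_eq_zero_of_killing hJ hX hY, neg_zero]
  refine ⟨D.mem_k_of_orthogonal fun Y hY => ?_, h0 X hX⟩
  have htop : ⁅(⊤ : LieIdeal ℝ J), (⊤ : LieIdeal ℝ J)⁆ = ⊤ := by
    refine (hs.eq_bot_or_eq_top _).resolve_left fun hbot => hs.non_abelian ?_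
    refine ⟨fun x y => ?_⟩
    have : ⁅x, y⁆ ∈ ⁅(⊤ : LieIdeal ℝ J), (⊤ : LieIdeal ℝ J)⁆ := lie_mem_commutator x y
    rwa [hbot, LieSubmodule.mem_bot] at this
  refine dual_eq_zero_of_mem_commutator (𝔤 := J) (l := B.flip Y ∘ₗ J.toSubmodule.subtype)
    (fun V W => ?_) (X := ⟨X, hX⟩) (htop.ge (LieSubmodule.mem_top _))
  change B ⁅(V : 𝔤), (W : 𝔤)⁆ Y = 0
  rw [D.lie_left, h0 _ V.2 Y hY, map_zero, neg_zero]

/-- In a reductive Lie algebra, the elements of `[𝔤, 𝔤]` that lie in `𝔨` and commute with `𝔭` form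
the sum of the compact simple factors. -/
lemma centralIdeal_inf_le_sSup [ComplementedLattice (LieIdeal ℝ 𝔤)] :
    D.centralIdeal ⊓ ⁅(⊤ : LieIdeal ℝ 𝔤), (⊤ : LieIdeal ℝ 𝔤)⁆ ≤ sSup {J : LieIdeal ℝ 𝔤 |
      J ≤ ⁅(⊤ : LieIdeal ℝ 𝔤), (⊤ : LieIdeal ℝ 𝔤)⁆ ∧ LieAlgebra.IsSimple ℝ J ∧
      ∀ X : J, X ≠ 0 → killingForm ℝ J X X < 0} := by
  obtain ⟨S, hS, hatom⟩ := IsAtomistic.isLUB_atoms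
    (D.centralIdeal ⊓ ⁅(⊤ : LieIdeal ℝ 𝔤), (⊤ : LieIdeal ℝ 𝔤)⁆)
  rw [← hS.sSup_eq]
  refine sSup_le_sSup fun J hJS => ?_
  have hJle := hS.1 hJS
  have hJa := hatom J hJS
  obtain ⟨J', hJ'⟩ := exists_isCompl J
  have hJJ' : ∀ x ∈ J', ∀ y ∈ J, ⁅x, y⁆ = 0 := by
    intro x hx y hy
    have : ⁅x, y⁆ ∈ J ⊓ J' := ⟨lie_mem_right ℝ 𝔤 J x y hy, lie_mem_left ℝ 𝔤 J' x y hx⟩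
    rwa [hJ'.inf_eq_bot, LieSubmodule.mem_bot] at this
  have hdec : ∀ x : 𝔤, ∃ y ∈ J, ∃ z ∈ J', y + z = x := by
    intro x
    have : x ∈ J ⊔ J' := hJ'.sup_eq_top ▸ LieSubmodule.mem_top x
    exact (LieSubmodule.mem_sup _ _ _).mp this
  have hcenter : ∀ x ∈ J, (∀ y ∈ J, ⁅y, x⁆ = 0) → x = 0 := by
    intro x hx h
    have hx' : ∀ y : 𝔤, ⁅y, x⁆ = 0 := by
      intro y
      obtain ⟨y, hy, z, hz, rfl⟩ := hdec y
      rw [add_lie, h y hy, hJJ' z hz x hx, add_zero]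
    by_contra hne
    exact (D.neg_def x (hJle hx).1.1 hne).ne (D.form_eq_zero_of_center hx' (hJle hx).2)
  refine ⟨hJle.trans inf_le_right, ⟨fun I => ?_, fun hab => hJa.1 ?_⟩, fun X hX => ?_⟩
  · -- ideals of `J` are ideals of `𝔤`
    have hIlie : ∀ (x' y' : 𝔤), y' ∈ I.toSubmodule.map J.toSubmodule.subtype →
        ⁅x', y'⁆ ∈ I.toSubmodule.map J.toSubmodule.subtype := by
      rintro x' _ ⟨y, hy, rfl⟩
      obtain ⟨x, hx, z, hz, hxz⟩ := hdec x'
      refine ⟨⁅(⟨x, hx⟩ : J), y⁆, lie_mem_right ℝ J I _ y hy, ?_⟩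
      change ⁅x, (y : 𝔤)⁆ = ⁅x', (y : 𝔤)⁆
      rw [← hxz, add_lie, hJJ' z hz _ y.2, add_zero]
    let I' : LieIdeal ℝ 𝔤 :=
      { toSubmodule := I.toSubmodule.map J.toSubmodule.subtype
        lie_mem := fun {x' y'} h => hIlie x' y' h }
    have hI' : I' ≤ J := by
      rintro _ ⟨y, -, rfl⟩
      exact y.2
    rcases hJa.le_iff.mp hI' with h | h
    · left
      rw [eq_bot_iff]
      intro y hy
      have : (y : 𝔤) ∈ I' := ⟨y, hy, rfl⟩
      rw [h, LieSubmodule.mem_bot] at this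
      exact (LieSubmodule.mem_bot y).mpr (Subtype.ext this)
    · right
      rw [eq_top_iff]
      intro y _
      have : (y : 𝔤) ∈ I' := h.ge y.2
      obtain ⟨w, hw, hwy⟩ := this
      rwa [Subtype.ext hwy] at hw
  · rw [eq_bot_iff]
    intro x hx
    rw [LieSubmodule.mem_bot]
    exact hcenter x hx fun y hy =>
      congrArg Subtype.val (hab.trivial (⟨y, hy⟩ : J) ⟨x, hx⟩)
  · rw [killingForm_apply_apply]
    refine trace_sq_neg_of_skew (b := -(B.restrict J.toSubmodule))
      (fun x y => by simp [D.symm (x : 𝔤) y]) (fun x hx => ?_) (fun x y => ?_) fun h0 => hX ?_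
    · have := D.neg_def x (hJle x.2).1.1 fun h => hx (Subtype.ext h)
      simpa using this
    · change -B ⁅(X : 𝔤), (x : 𝔤)⁆ y = -(-B x ⁅(X : 𝔤), (y : 𝔤)⁆)
      rw [D.lie_left]
    · refine Subtype.ext (hcenter X X.2 fun y hy => ?_)
      rw [← lie_skew]
      exact neg_eq_zero.mpr (congrArg Subtype.val (LinearMap.congr_fun h0 ⟨y, hy⟩))

end IsCartanDecomposition

end Algebra

/-! ### Weight spaces in the complexification -/

section Complexification

variable {V : Type*} [AddCommGroup V] [Module ℝ V]

/-- The real part of an element of the complexification of `V`. -/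
def rePart : (ℂ ⊗[ℝ] V) →ₗ[ℝ] V :=
  (TensorProduct.lid ℝ V).toLinearMap ∘ₗ LinearMap.rTensor V Complex.reLm

/-- The imaginary part of an element of the complexification of `V`. -/
def imPart : (ℂ ⊗[ℝ] V) →ₗ[ℝ] V :=
  (TensorProduct.lid ℝ V).toLinearMap ∘ₗ LinearMap.rTensor V Complex.imLm

@[simp] lemma rePart_tmul (z : ℂ) (x : V) : rePart (z ⊗ₜ[ℝ] x) = z.re • x := by
  simp [rePart]

@[simp] lemma imPart_tmul (z : ℂ) (x : V) : imPart (z ⊗ₜ[ℝ] x) = z.im • x := by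
  simp [imPart]

lemma rePart_smul (z : ℂ) (v : ℂ ⊗[ℝ] V) :
    rePart (z • v) = z.re • rePart v - z.im • imPart v := by
  induction v with
  | zero => simp
  | tmul w x => simp [TensorProduct.smul_tmul', sub_smul, mul_smul]
  | add v w hv hw => simp only [smul_add, map_add, hv, hw]; abel

lemma imPart_smul (z : ℂ) (v : ℂ ⊗[ℝ] V) :
    imPart (z • v) = z.re • imPart v + z.im • rePart v := by
  induction v with
  | zero => simp
  | tmul w x => simp [TensorProduct.smul_tmul', add_smul, mul_smul]
  | add v w hv hw => simp only [smul_add, map_add, hv, hw]; abel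

lemma tmul_rePart_add_tmul_imPart (v : ℂ ⊗[ℝ] V) :
    (1 : ℂ) ⊗ₜ[ℝ] rePart v + Complex.I ⊗ₜ[ℝ] imPart v = v := by
  induction v with
  | zero => simp
  | tmul w x =>
    rw [rePart_tmul, imPart_tmul, ← TensorProduct.smul_tmul, ← TensorProduct.smul_tmul,
      ← TensorProduct.add_tmul]
    congr 1
    simp only [Complex.real_smul, mul_one]
    exact Complex.re_add_im w
  | add v w hv hw =>
    rw [map_add, map_add, TensorProduct.tmul_add, TensorProduct.tmul_add]
    nth_rewrite 3 [← hv]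
    nth_rewrite 3 [← hw]
    abel

lemma complexification_ext {v w : ℂ ⊗[ℝ] V} (h1 : rePart v = rePart w)
    (h2 : imPart v = imPart w) : v = w := by
  rw [← tmul_rePart_add_tmul_imPart v, h1, h2, tmul_rePart_add_tmul_imPart]

lemma mem_baseChange_iff {U : Submodule ℝ V} {v : ℂ ⊗[ℝ] V} :
    v ∈ U.baseChange ℂ ↔ rePart v ∈ U ∧ imPart v ∈ U := by
  refine ⟨fun h => ?_, fun h => ?_⟩
  · rw [Submodule.baseChange_eq_span] at h
    induction h using Submodule.span_induction with
    | mem v hv =>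
      obtain ⟨x, hx, rfl⟩ := hv
      simpa using hx
    | zero => simp
    | add v w _ _ hv hw => exact ⟨by simpa using U.add_mem hv.1 hw.1, by simpa using U.add_mem hv.2 hw.2⟩
    | smul z v _ hv =>
      rw [rePart_smul, imPart_smul]
      exact ⟨U.sub_mem (U.smul_mem _ hv.1) (U.smul_mem _ hv.2),
        U.add_mem (U.smul_mem _ hv.2) (U.smul_mem _ hv.1)⟩
  · rw [← tmul_rePart_add_tmul_imPart v]
    exact Submodule.add_mem _ (Submodule.tmul_mem_baseChange_of_mem _ h.1)
      (Submodule.tmul_mem_baseChange_of_mem _ h.2)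

end Complexification

section WeightSpace

variable {𝔤 : Type*} [LieRing 𝔤] [LieAlgebra ℝ 𝔤]

/-- The complexification of `ad H`. -/
def adC (H : 𝔤) : Module.End ℂ (ℂ ⊗[ℝ] 𝔤) := ((LieAlgebra.ad ℝ 𝔤 H : 𝔤 →ₗ[ℝ] 𝔤)).baseChange ℂ

lemma rePart_adC (H : 𝔤) (v : ℂ ⊗[ℝ] 𝔤) : rePart (adC H v) = ⁅H, rePart v⁆ := by
  induction v with
  | zero => simp
  | tmul w x => simp [adC]
  | add v w hv hw => simp only [map_add, hv, hw, lie_add]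

lemma imPart_adC (H : 𝔤) (v : ℂ ⊗[ℝ] 𝔤) : imPart (adC H v) = ⁅H, imPart v⁆ := by
  induction v with
  | zero => simp
  | tmul w x => simp [adC]
  | add v w hv hw => simp only [map_add, hv, hw, lie_add]

lemma ad_one_tmul_apply (H : 𝔤) (v : ℂ ⊗[ℝ] 𝔤) :
    LieAlgebra.ad ℂ (ℂ ⊗[ℝ] 𝔤) ((1 : ℂ) ⊗ₜ[ℝ] H) v = adC H v := by
  induction v with
  | zero => simp only [map_zero]
  | tmul w x => simp [LieAlgebra.ExtendScalars.bracket_tmul, adC]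
  | add v w hv hw => simp only [map_add, hv, hw]

lemma commute_adC {H H' : 𝔤} (h : ⁅H, H'⁆ = 0) : Commute (adC H) (adC H') := by
  have h' : ∀ x : 𝔤, ⁅H, ⁅H', x⁆⁆ = ⁅H', ⁅H, x⁆⁆ := fun x => by
    rw [leibniz_lie, h, zero_lie, zero_add]
  refine LinearMap.ext fun v => complexification_ext ?_ ?_
  · change rePart (adC H (adC H' v)) = rePart (adC H' (adC H v))
    rw [rePart_adC, rePart_adC, rePart_adC, rePart_adC, h']
  · change imPart (adC H (adC H' v)) = imPart (adC H' (adC H v))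
    rw [imPart_adC, imPart_adC, imPart_adC, imPart_adC, h']

/-- The weight space of weight `i α` of the subspace `t` in the complexification of `U`. -/
def wtSpace (t U : Submodule ℝ 𝔤) (α : Module.Dual ℝ t) : Submodule ℂ (ℂ ⊗[ℝ] 𝔤) :=
  U.baseChange ℂ ⊓ ⨅ H : t, Module.End.eigenspace (adC (H : 𝔤)) (Complex.I * (α H : ℂ))

variable {t U : Submodule ℝ 𝔤} {α : Module.Dual ℝ t}

lemma mem_wtSpace {v : ℂ ⊗[ℝ] 𝔤} : v ∈ wtSpace t U α ↔ (rePart v ∈ U ∧ imPart v ∈ U) ∧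
    ∀ H : t, ⁅(H : 𝔤), rePart v⁆ = -(α H • imPart v) ∧ ⁅(H : 𝔤), imPart v⁆ = α H • rePart v := by
  rw [wtSpace, Submodule.mem_inf, mem_baseChange_iff, Submodule.mem_iInf]
  refine and_congr_right fun _ => forall_congr' fun H => ?_
  rw [Module.End.mem_eigenspace_iff]
  refine ⟨fun h => ⟨?_, ?_⟩, fun h => complexification_ext ?_ ?_⟩
  · rw [← rePart_adC, h, rePart_smul]
    simp
  · rw [← imPart_adC, h, imPart_smul]
    simp
  · rw [rePart_adC, rePart_smul, h.1]
    simp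
  · rw [imPart_adC, imPart_smul, h.2]
    simp

lemma wtSpace_mono {U' : Submodule ℝ 𝔤} (h : U ≤ U') : wtSpace t U α ≤ wtSpace t U' α := by
  intro v hv
  rw [mem_wtSpace] at hv ⊢
  exact ⟨⟨h hv.1.1, h hv.1.2⟩, hv.2⟩

/-- The nonzero weights of `t` in the complexification of `U`. -/
def wts (t U : Submodule ℝ 𝔤) : Set (Module.Dual ℝ t) := {α | α ≠ 0 ∧ wtSpace t U α ≠ ⊥}

lemma wts_mono {U' : Submodule ℝ 𝔤} (h : U ≤ U') : wts t U ⊆ wts t U' :=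
  fun _ hα => ⟨hα.1, fun hbot => hα.2 (eq_bot_iff.mpr ((wtSpace_mono h).trans hbot.le))⟩

/-- A nonzero weight is afforded by a real plane on which `t` acts by rotations. -/
lemma exists_of_mem_wts (h : α ∈ wts t U) : ∃ x ∈ U, ∃ y ∈ U, x ≠ 0 ∧ y ≠ 0 ∧
    ∀ H : t, ⁅(H : 𝔤), x⁆ = -(α H • y) ∧ ⁅(H : 𝔤), y⁆ = α H • x := by
  obtain ⟨v, hv, hv0⟩ := Submodule.exists_mem_ne_zero_of_ne_bot h.2
  obtain ⟨H, hH⟩ : ∃ H, α H ≠ 0 := by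
    by_contra! hc
    exact h.1 (LinearMap.ext hc)
  rw [mem_wtSpace] at hv
  have hx : rePart v = 0 ↔ imPart v = 0 := by
    refine ⟨fun h0 => ?_, fun h0 => ?_⟩
    · have := (hv.2 H).1
      rw [h0, lie_zero, eq_comm, neg_eq_zero, smul_eq_zero] at this
      exact this.resolve_left hH
    · have := (hv.2 H).2
      rw [h0, lie_zero, eq_comm, smul_eq_zero] at this
      exact this.resolve_left hH
  have hne : rePart v ≠ 0 := fun h0 =>
    hv0 (complexification_ext (by rw [h0, map_zero]) (by rw [hx.mp h0, map_zero]))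
  exact ⟨_, hv.1.1, _, hv.1.2, hne, fun h0 => hne (hx.mpr h0), hv.2⟩

lemma mem_wts_of_ne_zero {x y : 𝔤} (hα : α ≠ 0) (hx : x ∈ U) (hy : y ∈ U) (hx0 : x ≠ 0)
    (h : ∀ H : t, ⁅(H : 𝔤), x⁆ = -(α H • y) ∧ ⁅(H : 𝔤), y⁆ = α H • x) : α ∈ wts t U := by
  refine ⟨hα, fun hbot => hx0 ?_⟩
  have hv : (1 : ℂ) ⊗ₜ[ℝ] x + Complex.I ⊗ₜ[ℝ] y ∈ wtSpace t U α := by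
    rw [mem_wtSpace]
    simpa [hx, hy] using h
  rw [hbot, Submodule.mem_bot] at hv
  simpa using congrArg rePart hv

lemma neg_mem_wts (h : α ∈ wts t U) : -α ∈ wts t U := by
  obtain ⟨x, hx, y, hy, hx0, hy0, hH⟩ := exists_of_mem_wts h
  refine mem_wts_of_ne_zero (neg_ne_zero.mpr h.1) hx (U.neg_mem hy) hx0 fun H => ?_
  rw [lie_neg, (hH H).1, (hH H).2]
  simp

lemma adC_mapsTo (ht : ∀ X ∈ t, ∀ Y ∈ t, ⁅X, Y⁆ = 0) (H H' : t) (z : ℂ) :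
    MapsTo (adC (H : 𝔤)) ((adC (H' : 𝔤)).maxGenEigenspace z) ((adC (H' : 𝔤)).maxGenEigenspace z) :=
  Module.End.mapsTo_maxGenEigenspace_of_comm (commute_adC (ht _ H'.2 _ H.2)) z

lemma wtSpace_le_iInf : wtSpace t U α ≤
    ⨅ H : t, (adC (H : 𝔤)).maxGenEigenspace (Complex.I * (α H : ℂ)) :=
  inf_le_right.trans (iInf_mono fun H =>
    ((adC (H : 𝔤)).genEigenspace (Complex.I * (α H : ℂ))).monotone le_top)

/-- Weight spaces of distinct weights are independent. -/
lemma iSupIndep_wtSpace (ht : ∀ X ∈ t, ∀ Y ∈ t, ⁅X, Y⁆ = 0) : iSupIndep (wtSpace t U) := by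
  have h : iSupIndep fun χ : t → ℂ => ⨅ H : t, (adC (H : 𝔤)).maxGenEigenspace (χ H) :=
    Module.End.independent_iInf_maxGenEigenspace_of_forall_mapsTo
      (fun H : t => adC (H : 𝔤)) (adC_mapsTo ht)
  have hinj : Function.Injective fun (α : Module.Dual ℝ t) (H : t) => Complex.I * (α H : ℂ) := by
    intro α β hαβ
    ext H
    have := congrFun hαβ H
    simpa using this
  exact iSupIndep.mono (h.comp hinj) fun α => wtSpace_le_iInf

lemma finite_wts [FiniteDimensional ℝ 𝔤] (ht : ∀ X ∈ t, ∀ Y ∈ t, ⁅X, Y⁆ = 0) :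
    (wts t U).Finite :=
  (WellFoundedGT.finite_ne_bot_of_iSupIndep (iSupIndep_wtSpace ht)).subset fun _ h => h.2

end WeightSpace

/-! ### The weight space decomposition -/

section WeightDecomposition

variable {𝔤 : Type*} [LieRing 𝔤] [LieAlgebra ℝ 𝔤]

/-- `t` is an abelian subspace of `k` that is its own centraliser in `k`. -/
structure IsMaximalAbelian (k t : Submodule ℝ 𝔤) : Prop where
  le : t ≤ k
  comm : ∀ X ∈ t, ∀ Y ∈ t, ⁅X, Y⁆ = 0
  mem : ∀ X ∈ k, (∀ H ∈ t, ⁅H, X⁆ = 0) → X ∈ t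

/-- A complexified skew endomorphism has imaginary eigenvalues and is diagonalisable: its
generalised eigenvectors are eigenvectors. -/
lemma lie_eq_smul_of_pow_eq_zero {b : LinearMap.BilinForm ℝ 𝔤}
    (hpos : ∀ x, x ≠ 0 → 0 < b x x) {H : 𝔤} (hH : ∀ x y : 𝔤, b ⁅H, x⁆ y = -b x ⁅H, y⁆)
    {z : ℂ} {n : ℕ} {v : ℂ ⊗[ℝ] 𝔤} (hv : v ≠ 0)
    (h : ((adC H - z • (1 : Module.End ℂ (ℂ ⊗[ℝ] 𝔤))) ^ n) v
      = 0) :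
    z.re = 0 ∧ adC H v = z • v := by
  let q : (ℂ ⊗[ℝ] 𝔤) → (ℂ ⊗[ℝ] 𝔤) → ℝ := fun v w => b (rePart v) (rePart w) + b (imPart v) (imPart w)
  have hq0 : ∀ v, q v v = 0 → v = 0 := by
    intro v hv
    have hnn : ∀ x, 0 ≤ b x x := fun x => by
      rcases eq_or_ne x 0 with rfl | hx
      · simp
      · exact (hpos x hx).le
    have h1 : ∀ x, b x x = 0 → x = 0 := fun x hx => by
      by_contra hne
      exact (hpos x hne).ne' hx
    have h2 := hnn (rePart v)
    have h3 := hnn (imPart v)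
    have h4 : b (rePart v) (rePart v) + b (imPart v) (imPart v) = 0 := hv
    exact complexification_ext (by rw [h1 (rePart v) (by linarith), map_zero])
      (by rw [h1 (imPart v) (by linarith), map_zero])
  -- `S = F - i Im z`, where `F = ad H`, is skew
  have hS : ∀ v w, q (adC H v - (Complex.I * z.im) • v) w =
      -q v (adC H w - (Complex.I * z.im) • w) := by
    intro v w
    simp only [q, map_sub, rePart_smul, imPart_smul, rePart_adC, imPart_adC, LinearMap.sub_apply, hH,
      map_smul, LinearMap.smul_apply, Complex.mul_re, Complex.mul_im, Complex.I_re, Complex.I_im,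
      Complex.ofReal_re, Complex.ofReal_im, smul_eq_mul, map_add, LinearMap.add_apply]
    ring
  have heig : ∀ w, w ≠ 0 → adC H w = z • w → z.re = 0 := by
    intro w hw hz
    have h1 : adC H w - (Complex.I * z.im) • w = (z.re : ℂ) • w := by
      rw [hz, ← sub_smul]
      congr 1
      nth_rewrite 1 [← Complex.re_add_im z]
      ring
    have h2 := hS w w
    rw [h1] at h2
    simp only [q, rePart_smul, imPart_smul, map_smul,
      LinearMap.smul_apply, Complex.ofReal_re, Complex.ofReal_im, smul_eq_mul, zero_smul, sub_zero,
      add_zero] at h2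
    have h3 : z.re * q w w = 0 := by
      simp only [q]
      linarith
    exact (mul_eq_zero.mp h3).resolve_right fun h => hw (hq0 w h)
  have hstep : ∀ w, adC H (adC H w - z • w) = z • (adC H w - z • w) → adC H w - z • w = 0 := by
    intro w hw
    by_contra hne
    have hz : Complex.I * z.im = z := by
      nth_rewrite 2 [← Complex.re_add_im z]
      rw [heig _ hne hw]
      simp [mul_comm]
    have h1 := hS w (adC H w - z • w)
    rw [hz, hw, sub_self] at h1
    refine hne (hq0 _ (h1.trans ?_))
    simp [q]
  have hpow : ∀ (n : ℕ) (w), ((adC H - z • (1 : Module.End ℂ (ℂ ⊗[ℝ] 𝔤))) ^ n) w = 0 →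
      adC H w - z • w = 0 := by
    intro n
    induction n with
    | zero =>
      intro w hw
      have : w = 0 := hw
      rw [this, map_zero, smul_zero, sub_zero]
    | succ n ih =>
      intro w hw
      rw [pow_succ, Module.End.mul_apply] at hw
      exact hstep w (sub_eq_zero.mp (ih _ hw))
  have h0 := sub_eq_zero.mp (hpow n v h)
  exact ⟨heig v hv h0, h0⟩

variable {t U : Submodule ℝ 𝔤} {α : Module.Dual ℝ t}

lemma adC_eq_smul {v : ℂ ⊗[ℝ] 𝔤} (hv : v ∈ wtSpace t U α) (H : t) :
    adC (H : 𝔤) v = (Complex.I * α H) • v :=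
  Module.End.mem_eigenspace_iff.mp ((Submodule.mem_iInf _).mp hv.2 H)

/-- If an abelian subspace acts by endomorphisms that are skew for a positive definite form, then
its weight spaces span the complexification. -/
lemma iSup_wtSpace_eq_top [FiniteDimensional ℝ 𝔤] {b : LinearMap.BilinForm ℝ 𝔤}
    (hpos : ∀ x, x ≠ 0 → 0 < b x x)
    (hH : ∀ H ∈ t, ∀ x y : 𝔤, b ⁅H, x⁆ y = -b x ⁅H, y⁆) (ht : ∀ X ∈ t, ∀ Y ∈ t, ⁅X, Y⁆ = 0) :
    ⨆ α, wtSpace t (⊤ : Submodule ℝ 𝔤) α = ⊤ := by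
  have h := Module.End.iSup_iInf_maxGenEigenspace_eq_top_of_forall_mapsTo
    (fun H : t => adC (H : 𝔤)) (adC_mapsTo ht)
    fun H => Module.End.iSup_maxGenEigenspace_eq_top _
  rw [eq_top_iff, ← h]
  refine iSup_le fun χ => ?_
  by_cases hχ : (⨅ H : t, (adC (H : 𝔤)).maxGenEigenspace (χ H)) = ⊥
  · rw [hχ]
    exact bot_le
  have key : ∀ w ∈ ⨅ H : t, (adC (H : 𝔤)).maxGenEigenspace (χ H), w ≠ 0 → ∀ H : t,
      (χ H).re = 0 ∧ adC (H : 𝔤) w = χ H • w := by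
    intro w hw hw0 H
    obtain ⟨n, hn⟩ := Module.End.mem_maxGenEigenspace _ _ _ |>.mp ((Submodule.mem_iInf _).mp hw H)
    exact lie_eq_smul_of_pow_eq_zero hpos (hH H H.2) hw0 hn
  obtain ⟨v, hv, hv0⟩ := Submodule.exists_mem_ne_zero_of_ne_bot hχ
  have hinj : ∀ z z' : ℂ, z • v = z' • v → z = z' := fun z z' h => smul_left_injective ℂ hv0 h
  have hadd : ∀ (H H' : 𝔤), adC (H + H') v = adC H v + adC H' v := fun H H' =>
    complexification_ext (by simp only [map_add, rePart_adC, add_lie])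
      (by simp only [map_add, imPart_adC, add_lie])
  have hsmul : ∀ (a : ℝ) (H : 𝔤), adC (a • H) v = (a : ℂ) • adC H v := fun a H =>
    complexification_ext (by rw [rePart_smul, rePart_adC, rePart_adC, imPart_adC]; simp)
      (by rw [imPart_smul, rePart_adC, imPart_adC, imPart_adC]; simp)
  let α : Module.Dual ℝ t :=
    { toFun := fun H => (χ H).im
      map_add' := fun H H' => by
        rw [← Complex.add_im]
        refine congrArg _ (hinj _ _ ?_)
        rw [← (key v hv hv0 _).2, add_smul, ← (key v hv hv0 H).2, ← (key v hv hv0 H').2]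
        exact hadd _ _
      map_smul' := fun a H => by
        have : χ (a • H) = (a : ℂ) * χ H := by
          refine hinj _ _ ?_
          rw [← (key v hv hv0 _).2, mul_smul, ← (key v hv hv0 H).2]
          exact hsmul _ _
        rw [this]
        simp }
  refine le_trans (fun w hw => ?_) (le_iSup (wtSpace t (⊤ : Submodule ℝ 𝔤)) α)
  refine ⟨mem_baseChange_iff.mpr ⟨trivial, trivial⟩, (Submodule.mem_iInf _).mpr fun H => ?_⟩
  rw [Module.End.mem_eigenspace_iff]
  rcases eq_or_ne w 0 with rfl | hw0
  · simp
  rw [(key w hw hw0 H).2]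
  congr 1
  nth_rewrite 1 [← Complex.re_add_im (χ H)]
  rw [(key w hw hw0 H).1, Complex.ofReal_zero, zero_add, mul_comm]
  rfl

/-- Finitely many nonzero functionals have a common point at which none of them vanishes. -/
lemma exists_forall_ne_zero {V : Type*} [AddCommGroup V] [Module ℝ V] {S : Set (Module.Dual ℝ V)}
    (hS : S.Finite) (h0 : ∀ α ∈ S, α ≠ 0) : ∃ H : V, ∀ α ∈ S, α H ≠ 0 := by
  induction S, hS using Set.Finite.induction_on with
  | empty => exact ⟨0, by simp⟩
  | @insert α S _ hS ih =>
    obtain ⟨H, hH⟩ := ih fun β hβ => h0 β (mem_insert_of_mem _ hβ)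
    obtain ⟨H', hH'⟩ : ∃ H', α H' ≠ 0 := by
      by_contra! hc
      exact h0 α (mem_insert _ _) (LinearMap.ext hc)
    -- each functional vanishes at `H' + c H` for at most one scalar `c`, or at `H + c H'`
    have hfin : (insert α S).Finite := hS.insert α
    have hbad : {c : ℝ | ∃ β ∈ insert α S, β (H' + c • H) = 0 ∧ β H ≠ 0}.Finite := by
      have : {c : ℝ | ∃ β ∈ insert α S, β (H' + c • H) = 0 ∧ β H ≠ 0} ⊆
          (fun β : Module.Dual ℝ V => -β H' / β H) '' insert α S := by
        rintro c ⟨β, hβ, h1, h2⟩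
        refine ⟨β, hβ, ?_⟩
        rw [map_add, map_smul, smul_eq_mul] at h1
        field_simp
        linarith
      exact (hfin.image _).subset this
    obtain ⟨c, hc⟩ := hbad.infinite_compl.nonempty
    refine ⟨H' + c • H, fun β hβ h => ?_⟩
    by_cases hβH : β H = 0
    · rcases hβ with rfl | hβ
      · rw [map_add, map_smul, hβH, smul_zero, add_zero] at h
        exact hH' h
      · exact hH β hβ hβH
    · exact hc ⟨β, hβ, h, hβH⟩

namespace IsCartanDecomposition

variable {k p : Submodule ℝ 𝔤} {B : LinearMap.BilinForm ℝ 𝔤} (D : IsCartanDecomposition k p B)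
  (M : IsMaximalAbelian k t)

include D

/-- The decomposition of `𝔤` into `𝔨` and `𝔭` is direct. -/
lemma add_inj {x x' y y' : 𝔤} (hx : x ∈ k) (hx' : x' ∈ k) (hy : y ∈ p) (hy' : y' ∈ p)
    (h : x + y = x' + y') : x = x' ∧ y = y' := by
  have h1 : x - x' = y' - y := by
    rw [sub_eq_sub_iff_add_eq_add, h, add_comm]
  have h2 : x - x' = 0 := D.eq_zero_of_mem_k (k.sub_mem hx hx') fun Y hY => by
    rw [h1]
    exact D.form_pk (p.sub_mem hy' hy) hY
  exact ⟨sub_eq_zero.mp h2, (sub_eq_zero.mp (h1.symm.trans h2)).symm⟩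

include M

lemma wtSpace_top_eq : wtSpace t (⊤ : Submodule ℝ 𝔤) α = wtSpace t k α ⊔ wtSpace t p α := by
  refine le_antisymm (fun v hv => ?_) (sup_le (wtSpace_mono le_top) (wtSpace_mono le_top))
  rw [mem_wtSpace] at hv
  obtain ⟨x, hx, x', hx', hxx⟩ := D.exists_add (rePart v)
  obtain ⟨y, hy, y', hy', hyy⟩ := D.exists_add (imPart v)
  have hH : ∀ H : t, (⁅(H : 𝔤), x⁆ = -(α H • y) ∧ ⁅(H : 𝔤), y⁆ = α H • x) ∧
      (⁅(H : 𝔤), x'⁆ = -(α H • y') ∧ ⁅(H : 𝔤), y'⁆ = α H • x') := by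
    intro H
    have hHk := M.le H.2
    have h1 := (hv.2 H).1
    have h2 := (hv.2 H).2
    rw [hxx, hyy, lie_add, smul_add, neg_add] at h1
    rw [hxx, hyy, lie_add, smul_add] at h2
    have h3 := D.add_inj (D.lie_kk _ hHk _ hx) (k.neg_mem (k.smul_mem _ hy)) (D.lie_kp _ hHk _ hx')
      (p.neg_mem (p.smul_mem _ hy')) h1
    have h4 := D.add_inj (D.lie_kk _ hHk _ hy) (k.smul_mem _ hx) (D.lie_kp _ hHk _ hy')
      (p.smul_mem _ hx') h2
    exact ⟨⟨h3.1, h4.1⟩, h3.2, h4.2⟩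
  have hv' : v = ((1 : ℂ) ⊗ₜ[ℝ] x + Complex.I ⊗ₜ[ℝ] y) + ((1 : ℂ) ⊗ₜ[ℝ] x' + Complex.I ⊗ₜ[ℝ] y') :=
    complexification_ext (by simp [hxx]) (by simp [hyy])
  rw [hv']
  refine Submodule.add_mem_sup ?_ ?_ <;> rw [mem_wtSpace]
  · simpa [hx, hy] using fun H h => (hH ⟨H, h⟩).1
  · simpa [hx', hy'] using fun H h => (hH ⟨H, h⟩).2

lemma wts_top_eq : wts t (⊤ : Submodule ℝ 𝔤) = wts t k ∪ wts t p := by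
  ext α
  simp only [wts, mem_union, Set.mem_ofPred_eq, D.wtSpace_top_eq M, ne_eq, sup_eq_bot_iff]
  tauto

variable [FiniteDimensional ℝ 𝔤]

lemma finrank_wtSpace_top : Module.finrank ℂ (wtSpace t (⊤ : Submodule ℝ 𝔤) α) =
    Module.finrank ℂ (wtSpace t k α) + Module.finrank ℂ (wtSpace t p α) := by
  rw [D.wtSpace_top_eq M, ← Submodule.finrank_sup_add_finrank_inf_eq]
  have : wtSpace t k α ⊓ wtSpace t p α = ⊥ := by
    refine eq_bot_iff.mpr fun v hv => ?_
    have h1 := (mem_wtSpace.mp hv.1).1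
    have h2 := (mem_wtSpace.mp hv.2).1
    have h0 : ∀ x ∈ k, x ∈ p → x = 0 := fun x hx hx' => D.eq_zero_of_mem_k hx fun Y hY =>
      D.form_pk hx' hY
    exact complexification_ext (by rw [h0 _ h1.1 h2.1, map_zero]) (by rw [h0 _ h1.2 h2.2, map_zero])
  rw [this, finrank_bot, add_zero]

lemma iSup_wtSpace : ⨆ α, wtSpace t (⊤ : Submodule ℝ 𝔤) α = ⊤ := by
  obtain ⟨b, -, hbpos, -, hbk⟩ := D.exists_positive_form
  exact iSup_wtSpace_eq_top hbpos (fun H hH => hbk H (M.le hH)) M.comm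

/-- An element of `𝔱` at which the weights in `𝔭` vanish commutes with `𝔭`. -/
lemma lie_eq_zero_of_forall_wts {H : t} (hH : ∀ β ∈ wts t p, β H = 0) {X : 𝔤} (hX : X ∈ p) :
    ⁅(H : 𝔤), X⁆ = 0 := by
  have h : (⊤ : Submodule ℂ (ℂ ⊗[ℝ] 𝔤)) ≤ k.baseChange ℂ ⊔ LinearMap.ker (adC (H : 𝔤)) := by
    rw [← D.iSup_wtSpace M]
    refine iSup_le fun α => ?_
    rw [D.wtSpace_top_eq M]
    refine sup_le (inf_le_left.trans le_sup_left) (le_trans (fun v hv => ?_) le_sup_right)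
    rw [LinearMap.mem_ker, adC_eq_smul hv]
    rcases eq_or_ne v 0 with rfl | hv0
    · simp
    have : α H = 0 := by
      rcases eq_or_ne α 0 with rfl | hα
      · rfl
      · exact hH α ⟨hα, (Submodule.ne_bot_iff _).mpr ⟨v, hv, hv0⟩⟩
    simp [this]
  obtain ⟨v, hv, w, hw, hvw⟩ := Submodule.mem_sup.mp (h (Submodule.mem_top (x := (1 : ℂ) ⊗ₜ[ℝ] X)))
  have h1 : ⁅(H : 𝔤), rePart v⁆ = ⁅(H : 𝔤), X⁆ := by
    have h2 : X = rePart v + rePart w := by rw [← map_add, hvw]; simp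
    rw [h2, lie_add, ← rePart_adC _ w, LinearMap.mem_ker.mp hw, map_zero, add_zero]
  have h3 : ⁅(H : 𝔤), rePart v⁆ ∈ k := D.lie_kk _ (M.le H.2) _ (mem_baseChange_iff.mp hv).1
  rw [h1] at h3
  exact D.eq_zero_of_mem_k h3 fun Y hY => D.form_pk (D.lie_kp _ (M.le H.2) X hX) hY

/-- The centraliser of an element of `𝔱` at which no weight vanishes is the centraliser of `𝔱`. -/
lemma lie_eq_zero_of_regular {H : t} (hH : ∀ β ∈ wts t (⊤ : Submodule ℝ 𝔤), β H ≠ 0) {X : 𝔤}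
    (hX : ⁅(H : 𝔤), X⁆ = 0) (H' : t) : ⁅(H' : 𝔤), X⁆ = 0 := by
  have h : (⊤ : Submodule ℂ (ℂ ⊗[ℝ] 𝔤)) ≤
      (LinearMap.range (adC (H : 𝔤))).comap (adC (H' : 𝔤)) := by
    rw [← D.iSup_wtSpace M]
    refine iSup_le fun α v hv => ?_
    rw [Submodule.mem_comap, adC_eq_smul hv]
    rcases eq_or_ne v 0 with rfl | hv0
    · simp
    rcases eq_or_ne α 0 with rfl | hα
    · simp
    have h0 : (α H : ℂ) ≠ 0 := by
      exact_mod_cast hH α ⟨hα, (Submodule.ne_bot_iff _).mpr ⟨v, hv, hv0⟩⟩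
    refine ⟨((α H' : ℂ) / α H) • v, ?_⟩
    rw [map_smul, adC_eq_smul hv, smul_smul]
    congr 1
    field_simp
  refine D.nondegenerate fun Y => ?_
  obtain ⟨v, hv⟩ := h (Submodule.mem_top (x := (1 : ℂ) ⊗ₜ[ℝ] Y))
  have h1 : ⁅(H : 𝔤), rePart v⁆ = ⁅(H' : 𝔤), Y⁆ := by
    rw [← rePart_adC, hv, rePart_adC]
    simp
  rw [D.lie_left, ← h1, ← D.lie_left, hX, map_zero, LinearMap.zero_apply]

omit M [FiniteDimensional ℝ 𝔤]

/-- The plane of a weight is orthogonal-conformal: the rotations preserve the form. -/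
lemma form_eq_of_rotation {x y H : 𝔤} {a : ℝ} (ha : a ≠ 0) (h1 : ⁅H, x⁆ = -(a • y))
    (h2 : ⁅H, y⁆ = a • x) : B x y = 0 ∧ B y y = B x x := by
  have e1 := D.lie_left H x x
  have e2 := D.lie_left H x y
  rw [h1] at e1 e2
  rw [h2] at e2
  simp only [map_neg, LinearMap.neg_apply, map_smul, LinearMap.smul_apply, smul_eq_mul, neg_neg] at e1 e2
  refine ⟨?_, mul_left_cancel₀ ha (by linarith)⟩
  have : a * (2 * B x y) = 0 := by
    rw [D.symm y x] at e1
    linarith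
  simpa [ha] using this

include M

/-- The bracket of the two vectors of a root plane in `𝔨` lies in `𝔱`, and represents the root. -/
lemma lie_mem_of_rotation {x y : 𝔤} (hx : x ∈ k) (hy : y ∈ k)
    (h : ∀ H : t, ⁅(H : 𝔤), x⁆ = -(α H • y) ∧ ⁅(H : 𝔤), y⁆ = α H • x) :
    ⁅x, y⁆ ∈ t ∧ ∀ H : t, B ⁅x, y⁆ H = -(α H * B x x) := by
  refine ⟨M.mem _ (D.lie_kk x hx y hy) fun H hH => ?_, fun H => ?_⟩
  · have h1 := h ⟨H, hH⟩
    rw [leibniz_lie, h1.1, h1.2, neg_lie, smul_lie, lie_smul, lie_self, lie_self, smul_zero,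
      neg_zero, add_zero]
  · rw [D.lie_left', ← lie_skew, (h H).2, map_neg, map_smul, smul_eq_mul]

/-- A weight either vanishes on the part of `𝔱` that commutes with `𝔭`, or it is a root in `𝔨` that
vanishes on the orthogonal complement of this part. -/
lemma wts_top_cases {γ : Module.Dual ℝ t} (hγ : γ ∈ wts t (⊤ : Submodule ℝ 𝔤)) :
    (∀ H : t, (H : 𝔤) ∈ D.centralIdeal → γ H = 0) ∨ γ ∈ wts t k ∧
      ∀ H : t, (∀ H' ∈ t, H' ∈ D.centralIdeal → B H' H = 0) → γ H = 0 := by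
  rw [or_iff_not_imp_left]
  intro hne
  push Not at hne
  obtain ⟨H, hH, hγH⟩ := hne
  rw [D.wts_top_eq M] at hγ
  have hk : γ ∈ wts t k := by
    refine hγ.resolve_right fun hp => hγH ?_
    obtain ⟨x, hx, y, hy, hx0, hy0, hxy⟩ := exists_of_mem_wts hp
    have := (hxy H).1
    rw [hH.2 x hx, eq_comm, neg_eq_zero, smul_eq_zero] at this
    exact this.resolve_right hy0
  refine ⟨hk, fun H' hH' => ?_⟩
  obtain ⟨x, hx, y, hy, hx0, hy0, hxy⟩ := exists_of_mem_wts hk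
  have hxu : x ∈ D.centralIdeal := by
    have h1 : γ H • x ∈ D.centralIdeal := by
      rw [← (hxy H).2, ← lie_skew]
      exact neg_mem (lie_mem_right ℝ 𝔤 D.centralIdeal y H hH)
    have h2 := D.centralIdeal.smul_mem (γ H)⁻¹ h1
    rwa [smul_smul, inv_mul_cancel₀ hγH, one_smul] at h2
  obtain ⟨h1, h2⟩ := D.lie_mem_of_rotation M hx hy hxy
  have h3 := hH' _ h1 (by
    rw [← lie_skew]
    exact neg_mem (lie_mem_right ℝ 𝔤 D.centralIdeal y x hxu))
  rw [h2, neg_eq_zero, mul_eq_zero] at h3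
  exact h3.resolve_right (D.neg_def x hx hx0).ne

end IsCartanDecomposition

end WeightDecomposition

/-! ### Strict dominance of the sum of the positive roots -/

section StrictDominance

variable {𝔤 : Type*} [LieRing 𝔤] [LieAlgebra ℝ 𝔤] {t k p : Submodule ℝ 𝔤}

lemma adC_lie (x y : 𝔤) : adC ⁅x, y⁆ = adC x * adC y - adC y * adC x := by
  refine LinearMap.ext fun v => complexification_ext ?_ ?_
  · simp only [LinearMap.sub_apply, Module.End.mul_apply, map_sub, rePart_adC, lie_lie]
  · simp only [LinearMap.sub_apply, Module.End.mul_apply, map_sub, imPart_adC, lie_lie]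

lemma adC_smul (a : ℝ) (x : 𝔤) : adC (a • x) = (a : ℂ) • adC x := by
  refine LinearMap.ext fun v => complexification_ext ?_ ?_
  · rw [LinearMap.smul_apply, rePart_smul, rePart_adC, rePart_adC]
    simp
  · rw [LinearMap.smul_apply, imPart_smul, imPart_adC, imPart_adC]
    simp

/-- The root vector `x + s i y`, `s = ± 1`, of weight `s α` maps the weight space of `β` to that of
`β + s α`. -/
lemma rootVector_mem_wtSpace (hkk : ∀ X ∈ k, ∀ Y ∈ k, ⁅X, Y⁆ ∈ k) {α β : Module.Dual ℝ t} {x y : 𝔤}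
    (hx : x ∈ k) (hy : y ∈ k)
    (h : ∀ H : t, ⁅(H : 𝔤), x⁆ = -(α H • y) ∧ ⁅(H : 𝔤), y⁆ = α H • x) {s : ℝ} (hs : s * s = 1)
    {v : ℂ ⊗[ℝ] 𝔤} (hv : v ∈ wtSpace t k β) :
    adC x v + (s * Complex.I) • adC y v ∈ wtSpace t k (β + s • α) := by
  have hsC : (s : ℂ) * s = 1 := by exact_mod_cast hs
  have hk : ∀ z ∈ k, ∀ w ∈ k.baseChange ℂ, adC z w ∈ k.baseChange ℂ := by
    intro z hz w hw
    rw [mem_baseChange_iff] at hw ⊢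
    rw [rePart_adC, imPart_adC]
    exact ⟨hkk z hz _ hw.1, hkk z hz _ hw.2⟩
  refine ⟨add_mem (hk x hx v hv.1) (Submodule.smul_mem _ _ (hk y hy v hv.1)),
    (Submodule.mem_iInf _).mpr fun H => ?_⟩
  rw [Module.End.mem_eigenspace_iff]
  have hcomm : ∀ z : 𝔤, adC (H : 𝔤) (adC z v) =
      adC ⁅(H : 𝔤), z⁆ v + (Complex.I * β H) • adC z v := by
    intro z
    rw [adC_lie, LinearMap.sub_apply, Module.End.mul_apply, Module.End.mul_apply,
      adC_eq_smul hv, map_smul, sub_add_cancel]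
  rw [map_add, map_smul, hcomm, hcomm, (h H).1, (h H).2, ← neg_smul, adC_smul, adC_smul,
    LinearMap.smul_apply, LinearMap.smul_apply]
  simp only [smul_add, smul_smul, LinearMap.add_apply, LinearMap.smul_apply, Complex.ofReal_add,
    Complex.ofReal_neg, smul_eq_mul, Complex.ofReal_mul]
  match_scalars
  · linear_combination -(α H : ℂ) * Complex.I * Complex.I * hsC - (α H : ℂ) * Complex.I_mul_I
  · ring

namespace IsCartanDecomposition

variable {B : LinearMap.BilinForm ℝ 𝔤} (D : IsCartanDecomposition k p B)
  (M : IsMaximalAbelian k t)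

include D M

lemma eq_of_form_eq {W W' : 𝔤} (hW : W ∈ t) (hW' : W' ∈ t) (h : ∀ H ∈ t, B W H = B W' H) :
    W = W' := by
  have h0 := h _ (t.sub_mem hW hW')
  by_contra hne
  refine (D.neg_def (W - W') (M.le (t.sub_mem hW hW')) (sub_ne_zero.mpr hne)).ne ?_
  rw [LinearMap.map_sub₂, h0, sub_self]

variable [FiniteDimensional ℝ 𝔤]

/-- The commutator of the root vectors for `α` and `-α` acts with trace zero on the sum of the
weight spaces of the weights `β` with `β(H') < 0`, if `α(H') = 0`. -/
lemma sum_finrank_mul_eq_zero {α : Module.Dual ℝ t} (hα : α ∈ wts t k) {W : t}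
    (hW : ∀ H : t, -B W H = α H) {H' : t} (hH' : α H' = 0) :
    ∑ β ∈ (finite_wts M.comm (U := k)).toFinset with β H' < 0,
      (Module.finrank ℂ (wtSpace t k β) : ℝ) * β W = 0 := by
  obtain ⟨x, hx, y, hy, hx0, hy0, hxy⟩ := exists_of_mem_wts hα
  set c := B x x with hc
  have hc0 : c ≠ 0 := (D.neg_def x hx hx0).ne
  obtain ⟨h1, h2⟩ := D.lie_mem_of_rotation M hx hy hxy
  have hlie : ⁅x, y⁆ = c • (W : 𝔤) :=
    D.eq_of_form_eq M h1 (t.smul_mem c W.2) fun H hH => by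
      have := hW ⟨H, hH⟩
      rw [h2 ⟨H, hH⟩, ← this, map_smul, LinearMap.smul_apply, smul_eq_mul]
      ring
  set s := (finite_wts M.comm (U := k)).toFinset.filter fun β => β H' < 0 with hs
  set N := ⨆ β ∈ s, wtSpace t k β with hN
  have hEN : ∀ ε : ℝ, ε * ε = 1 → ∀ v ∈ N, (adC x + (ε * Complex.I) • adC y) v ∈ N := by
    intro ε hε
    refine fun v hv => (iSup₂_le fun β hβ w hw => ?_ :
      N ≤ N.comap (adC x + (ε * Complex.I) • adC y)) hv
    have hw' := rootVector_mem_wtSpace D.lie_kk hx hy hxy hε hw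
    rw [Submodule.mem_comap, LinearMap.add_apply, LinearMap.smul_apply]
    set w' := adC x w + (ε * Complex.I) • adC y w
    rcases eq_or_ne w' 0 with h0 | h0
    · rw [h0]
      exact N.zero_mem
    refine le_iSup₂ (f := fun β (_ : β ∈ s) => wtSpace t k β) (β + ε • α) ?_ hw'
    have hβ' : (β + ε • α) H' < 0 := by
      rw [LinearMap.add_apply, LinearMap.smul_apply, hH', smul_zero, add_zero]
      exact (Finset.mem_filter.mp hβ).2
    rw [hs, Finset.mem_filter, Set.Finite.mem_toFinset]
    refine ⟨⟨fun h => ?_, (Submodule.ne_bot_iff _).mpr ⟨w', hw', h0⟩⟩, hβ'⟩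
    rw [h, LinearMap.zero_apply] at hβ'
    exact lt_irrefl _ hβ'
  let E₁ : Module.End ℂ N := (adC x + (((1 : ℝ) : ℂ) * Complex.I) • adC y).restrict (hEN 1 (by norm_num))
  let E₂ : Module.End ℂ N :=
    (adC x + (((-1 : ℝ) : ℂ) * Complex.I) • adC y).restrict (hEN (-1) (by norm_num))
  have hmaps : ∀ β : Module.Dual ℝ t,
      MapsTo (adC (W : 𝔤)) (wtSpace t k β) (wtSpace t k β) := by
    intro β v hv
    rw [SetLike.mem_coe, adC_eq_smul hv]
    exact Submodule.smul_mem _ _ hv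
  have hWN : MapsTo (adC (W : 𝔤)) N N :=
    fun v hv => (iSup₂_le fun β hβ w hw =>
      le_iSup₂ (f := fun β (_ : β ∈ s) => wtSpace t k β) β hβ (hmaps β hw) :
      N ≤ N.comap (adC (W : 𝔤))) hv
  have hcommutator : E₁ * E₂ - E₂ * E₁ =
      (-2 * Complex.I * c : ℂ) • ((adC (W : 𝔤)).restrict hWN : Module.End ℂ N) := by
    refine LinearMap.ext fun v => Subtype.ext ?_
    have e : (adC x * adC y - adC y * adC x) (v : ℂ ⊗[ℝ] 𝔤) = (c : ℂ) • adC (W : 𝔤) v := by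
      rw [← adC_lie, hlie, adC_smul, LinearMap.smul_apply]
    rw [LinearMap.sub_apply, Module.End.mul_apply, Module.End.mul_apply] at e
    change (adC x + (((1 : ℝ) : ℂ) * Complex.I) • adC y)
        ((adC x + (((-1 : ℝ) : ℂ) * Complex.I) • adC y) (v : ℂ ⊗[ℝ] 𝔤)) -
      (adC x + (((-1 : ℝ) : ℂ) * Complex.I) • adC y)
        ((adC x + (((1 : ℝ) : ℂ) * Complex.I) • adC y) (v : ℂ ⊗[ℝ] 𝔤)) =
      (-2 * Complex.I * c : ℂ) • adC (W : 𝔤) v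
    rw [mul_smul (-2 * Complex.I : ℂ), ← e]
    simp only [LinearMap.add_apply, LinearMap.smul_apply, map_add, map_smul]
    push_cast
    module
  have htr : LinearMap.trace ℂ N ((adC (W : 𝔤)).restrict hWN) = 0 := by
    have h3 : LinearMap.trace ℂ N (E₁ * E₂ - E₂ * E₁) = 0 := by
      have h5 := LinearMap.map_sub (LinearMap.trace ℂ N) (E₁ * E₂) (E₂ * E₁)
      rw [LinearMap.trace_mul_comm ℂ E₁ E₂] at h5
      exact h5.trans (sub_self _)
    rw [hcommutator, map_smul, smul_eq_zero] at h3
    refine h3.resolve_left ?_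
    simp [hc0]
  have hsum := LinearMap.trace_eq_sum_trace_restrict_of_eq_biSup s
    ((iSupIndep_wtSpace M.comm (U := k)).comp Subtype.val_injective) hmaps N hN hWN
  have hterm : ∀ β : Module.Dual ℝ t, LinearMap.trace ℂ (wtSpace t k β)
      ((adC (W : 𝔤)).restrict (hmaps β)) =
      Complex.I * (((Module.finrank ℂ (wtSpace t k β) : ℝ) * β W : ℝ) : ℂ) := by
    intro β
    have : ((adC (W : 𝔤)).restrict (hmaps β) : Module.End ℂ (wtSpace t k β)) =
        (Complex.I * β W) • (1 : Module.End ℂ (wtSpace t k β)) :=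
      LinearMap.ext fun v => Subtype.ext (adC_eq_smul v.2 W)
    rw [this, map_smul, LinearMap.trace_one, smul_eq_mul]
    push_cast
    ring
  rw [htr, Finset.sum_congr rfl fun β _ => hterm β, ← Finset.mul_sum, eq_comm, mul_eq_zero] at hsum
  have h4 := hsum.resolve_left Complex.I_ne_zero
  exact_mod_cast h4

/-- The sum of the positive roots of `𝔨` is strictly dominant. -/
lemma sum_finrank_mul_pos {α : Module.Dual ℝ t} (hα : α ∈ wts t k) {W : t}
    (hW : ∀ H : t, -B W H = α H) {H₀ : t} (hH₀ : 0 < α H₀) :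
    0 < ∑ β ∈ (finite_wts M.comm (U := k)).toFinset with 0 < β H₀,
      (Module.finrank ℂ (wtSpace t k β) : ℝ) * β W := by
  have hW0 : (W : 𝔤) ≠ 0 := fun h => by
    have := hW H₀
    rw [h, map_zero, LinearMap.zero_apply, neg_zero] at this
    exact hH₀.ne this
  have hαW : 0 < α W := by
    rw [← hW]
    linarith [D.neg_def W (M.le W.2) hW0]
  -- compare the half spaces defined by `H₀` and by a point `W - κ H₀` of the hyperplane `α = 0`
  set κ := α W / α H₀ with hκ
  have hκ0 : 0 < κ := div_pos hαW hH₀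
  have h0 := D.sum_finrank_mul_eq_zero M hα hW (H' := W - κ • H₀) (by
    rw [map_sub, map_smul, smul_eq_mul, hκ, div_mul_cancel₀ _ hH₀.ne', sub_self])
  rw [Finset.sum_filter] at h0 ⊢
  refine lt_of_lt_of_eq ?_ ((Finset.sum_sub_distrib _ _).trans ((congrArg _ h0).trans (sub_zero _)))
  have hc : ∀ β : Module.Dual ℝ t, β (W - κ • H₀) = β W - κ * β H₀ := fun β => by
    rw [map_sub, map_smul, smul_eq_mul]
  refine Finset.sum_pos' (fun β _ => ?_) ⟨α, (Set.Finite.mem_toFinset _).mpr hα, ?_⟩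
  · rw [hc]
    have hm : (0 : ℝ) ≤ Module.finrank ℂ (wtSpace t k β) := Nat.cast_nonneg _
    split_ifs with h1 h2 h2
    · simp
    · have : 0 < κ * β H₀ := mul_pos hκ0 h1
      rw [sub_zero]
      exact mul_nonneg hm (by linarith)
    · have : κ * β H₀ ≤ 0 := mul_nonpos_of_nonneg_of_nonpos hκ0.le (not_lt.mp h1)
      rw [zero_sub, ← mul_neg]
      exact mul_nonneg hm (by linarith)
    · simp
  · rw [hc, if_pos hH₀, if_neg, sub_zero]
    · refine mul_pos ?_ hαW
      exact Nat.cast_pos.mpr (Nat.pos_of_ne_zero fun h => hα.2 (Submodule.finrank_eq_zero.mp h))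
    · rw [hκ, div_mul_cancel₀ _ hH₀.ne', sub_self]
      exact lt_irrefl 0

end IsCartanDecomposition

end StrictDominance

/-! ### Conjugation into the torus and Weyl chambers -/

/-- A point may be moved off finitely many hyperplanes without leaving the open negative half spaces
that contain it. -/
lemma exists_regular_near {V : Type*} [AddCommGroup V] [Module ℝ V] {S : Set (Module.Dual ℝ V)}
    (hS : S.Finite) (h0 : ∀ α ∈ S, α ≠ 0) (X : V) :
    ∃ X' : V, ∀ α ∈ S, α X' ≠ 0 ∧ (α X < 0 → α X' < 0) := by
  obtain ⟨H, hH⟩ := exists_forall_ne_zero hS h0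
  have h : ∀ᶠ ε in 𝓝[>] (0 : ℝ), ∀ α ∈ S, α (X + ε • H) ≠ 0 ∧ (α X < 0 → α (X + ε • H) < 0) := by
    rw [Filter.eventually_all_finite hS]
    intro α hα
    simp only [map_add, map_smul, smul_eq_mul]
    have hc : Tendsto (fun ε : ℝ => α X + ε * α H) (𝓝[>] 0) (𝓝 (α X)) := by
      have : Continuous fun ε : ℝ => α X + ε * α H := by fun_prop
      have h1 := (this.tendsto 0).mono_left (nhdsWithin_le_nhds (s := Ioi 0))
      simpa using h1
    by_cases hX : α X = 0
    · filter_upwards [self_mem_nhdsWithin] with ε hε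
      rw [hX, zero_add]
      exact ⟨mul_ne_zero (ne_of_gt hε) (hH α hα), fun h => absurd h (lt_irrefl 0)⟩
    · filter_upwards [hc.eventually_ne hX,
        hc.eventually (p := fun r => α X < 0 → r < 0) (by
          by_cases hneg : α X < 0
          · filter_upwards [Iio_mem_nhds hneg] with r hr _ using hr
          · exact Eventually.of_forall fun _ h => absurd h hneg)] with ε h1 h2
      exact ⟨h1, h2⟩
  obtain ⟨ε, hε⟩ := h.exists
  exact ⟨_, hε⟩

/-- The second derivative is nonpositive at a maximum. -/
lemma second_deriv_nonpos_of_max {f g : ℝ → ℝ} {c : ℝ} (hf : ∀ s, HasDerivAt f (g s) s)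
    (hg : HasDerivAt g c 0) (hmax : ∀ s, f s ≤ f 0) : g 0 = 0 ∧ c ≤ 0 := by
  have hfg : deriv f = g := funext fun s => (hf s).deriv
  have h0 : g 0 = 0 :=
    IsLocalMax.hasDerivAt_eq_zero (Eventually.of_forall hmax) (hf 0)
  refine ⟨h0, not_lt.mp fun hc => ?_⟩
  have hmin := isLocalMin_of_deriv_deriv_pos (f := f) (x₀ := 0) (by rwa [hfg, hg.deriv])
    (by rw [hfg, h0]) (hf 0).continuousAt
  have hconst : f =ᶠ[𝓝 0] fun _ => f 0 := by
    filter_upwards [hmin] with s hs using le_antisymm (hmax s) hs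
  have h1 := hconst.deriv.deriv_eq
  rw [hfg, hg.deriv] at h1
  simp at h1
  exact hc.ne' h1

lemma IsMaximalTorus.isMaximalAbelian (hT : IsMaximalTorus K T) (hθ : IsCartanInvolution E K θ) :
    IsMaximalAbelian (kPart E θ) (lieOf E T) where
  le := hT.lieOf_le hθ
  comm _ hX _ hY := hT.lie_eq_zero hX hY
  mem X hX h := hT.mem_lieOf_of_lie_eq_zero hθ hX fun H hH => by
    rw [← lie_skew, h H hH, neg_zero]

lemma weightSpace_eq_wtSpace (U : Submodule ℝ (LieAlg E G)) (α : Module.Dual ℝ (lieOf E T)) :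
    weightSpace T U α = wtSpace (lieOf E T) U α := by
  ext v
  simp only [weightSpace, wtSpace, Submodule.mem_inf, Submodule.mem_iInf,
    Module.End.mem_eigenspace_iff, ad_one_tmul_apply]

lemma weights_eq_wts (U : Submodule ℝ (LieAlg E G)) : weights T U = wts (lieOf E T) U := by
  ext α
  simp only [weights, wts, weightSpace_eq_wtSpace]

/-- The functionals that are differentials of characters of `T` are those that are integral on the
unit lattice. -/
lemma mem_characterLattice_iff (hT : IsMaximalTorus K T) {μ : Module.Dual ℝ (lieOf E T)} :
    μ ∈ characterLattice E T ↔
      ∀ X : lieOf E T, expG (X : LieAlg E G) = 1 → ∃ n : ℤ, μ X = n * (2 * Real.pi) := by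
  refine ⟨?_, fun h => exists_isDifferential hT.comm hT.prop.2.1
    (fun g hg => hT.exists_expG_eq hg) μ h⟩
  rintro ⟨χ, hχ⟩ X hX
  have hmem := (mem_lieOf_iff hT.comm).mp X.2
  have h := hχ X _ (isOneParam_expG (X : LieAlg E G)) hmem 1
  have h1 : (⟨expG ((1 : ℝ) • (X : LieAlg E G)), hmem 1⟩ : T) = 1 :=
    Subtype.ext ((congrArg expG (one_smul ℝ _)).trans hX)
  rw [h1, map_one, one_mul, eq_comm, ← Circle.exp_zero, Circle.exp_eq_exp] at h
  obtain ⟨n, hn⟩ := h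
  exact ⟨n, by rw [hn, zero_add]⟩

/-- Along a one-parameter subgroup of the torus, the plane of a weight rotates. -/
lemma Ad_expG_of_rotation {H x y : LieAlg E G} {a : ℝ} (h1 : ⁅H, x⁆ = -(a • y))
    (h2 : ⁅H, y⁆ = a • x) :
    Ad E (expG (-H)) (Real.cos a • x - Real.sin a • y) = x := by
  refine eq_of_forall_dual fun l => ?_
  have hd : ∀ s : ℝ, HasDerivAt (fun s : ℝ => Real.cos (s * a) * l (Ad E (expG (s • -H)) x) -
      Real.sin (s * a) * l (Ad E (expG (s • -H)) y)) 0 s := by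
    intro s
    have hx := hasDerivAt_Ad l (-H) x s
    have hy := hasDerivAt_Ad l (-H) y s
    have hs : HasDerivAt (fun s : ℝ => s * a) a s := by
      simpa using (hasDerivAt_id s).mul_const a
    rw [neg_lie, h1, neg_neg, map_smul, map_smul, smul_eq_mul] at hx
    rw [neg_lie, h2, map_neg, map_smul, map_neg, map_smul, smul_eq_mul] at hy
    refine ((hs.cos.mul hx).sub (hs.sin.mul hy)).congr_deriv ?_
    ring
  have := is_const_of_deriv_eq_zero (fun s => (hd s).differentiableAt) (fun s => (hd s).deriv) 1 0
  simp only [one_mul, one_smul, zero_mul, zero_smul, Real.cos_zero, Real.sin_zero, expG_zero,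
    sub_zero, Ad_one] at this
  rw [map_sub, map_sub, map_smul, map_smul, map_smul, map_smul, smul_eq_mul, smul_eq_mul, this]

lemma expG_neg_eq_one {H : LieAlg E G} (h : expG H = 1) : expG (-H) = 1 := by
  rw [expG_neg, h, inv_one]

/-- The weights in `𝔭` are differentials of characters of the torus. -/
lemma wts_pPart_subset (hT : IsMaximalTorus K T) (hθ : IsCartanInvolution E K θ)
    (hB : IsInvariantForm θ B) : wts (lieOf E T) (pPart E θ) ⊆ characterLattice E T := by
  intro β hβ
  rw [mem_characterLattice_iff hT]
  intro H hH
  obtain ⟨x, hx, y, hy, hx0, hy0, hxy⟩ := exists_of_mem_wts hβ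
  rcases eq_or_ne (β H) 0 with h0 | h0
  · exact ⟨0, by simp [h0]⟩
  have h1 := Ad_expG_of_rotation (hxy H).1 (hxy H).2
  rw [expG_neg_eq_one hH, Ad_one] at h1
  have D := isCartanDecomposition hθ hB
  have h2 := (D.form_eq_of_rotation h0 (hxy H).1 (hxy H).2).1
  have h3 := congrArg (B x) h1
  rw [map_sub, map_smul, map_smul, h2, smul_zero, sub_zero, smul_eq_mul] at h3
  have h4 : Real.cos (β H) = 1 :=
    mul_right_cancel₀ (D.pos_def x hx hx0).ne' (h3.trans (one_mul _).symm)
  obtain ⟨n, hn⟩ := (Real.cos_eq_one_iff _).mp h4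
  exact ⟨n, hn.symm⟩

/-- Every element of `𝔨` is conjugate under `K` to an element of `𝔱`, which may be chosen in the
closed chamber of a given regular element. -/
lemma exists_Ad_mem (hT : IsMaximalTorus K T) (hθ : IsCartanInvolution E K θ)
    (hB : IsInvariantForm θ B) {H₀ : lieOf E T}
    (hH₀ : ∀ β ∈ wts (lieOf E T) (⊤ : Submodule ℝ (LieAlg E G)), β H₀ ≠ 0) {X : LieAlg E G}
    (hX : X ∈ kPart E θ) : ∃ g ∈ K, ∃ h : Ad E g X ∈ lieOf E T,
      ∀ β ∈ wts (lieOf E T) (kPart E θ), 0 ≤ β ⟨Ad E g X, h⟩ * β H₀ := by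
  have D := isCartanDecomposition hθ hB
  have M := hT.isMaximalAbelian hθ
  let l : LieAlg E G →ₗ[ℝ] ℝ := -(B.flip H₀)
  obtain ⟨g, hg, hmax⟩ := hθ.isCompact.exists_isMaxOn ⟨1, K.one_mem⟩
    (continuous_Ad l X).continuousOn
  -- the first and the second variation at the maximum
  have key : ∀ Y ∈ kPart E θ, B ⁅Y, Ad E g X⁆ H₀ = 0 ∧ 0 ≤ B ⁅Y, ⁅Y, Ad E g X⁆⁆ H₀ := by
    intro Y hY
    have h1 := second_deriv_nonpos_of_max (fun s => hasDerivAt_Ad l Y (Ad E g X) s)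
      (hasDerivAt_Ad l Y ⁅Y, Ad E g X⁆ 0) fun s => by
        rw [← Ad_mul, ← Ad_mul]
        refine (hmax (K.mul_mem ((hθ.expG_smul_mem_iff.mpr hY) s) hg)).trans (le_of_eq ?_)
        rw [zero_smul, expG_zero, one_mul]
    rw [zero_smul, expG_zero, Ad_one, Ad_one] at h1
    exact ⟨neg_eq_zero.mp h1.1, neg_nonpos.mp h1.2⟩
  have hXk := hθ.Ad_mem_kPart hg hX
  have hcomm : ⁅(H₀ : LieAlg E G), Ad E g X⁆ = 0 := by
    rw [← lie_skew, neg_eq_zero]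
    refine D.eq_zero_of_mem_k (D.lie_kk _ hXk _ (M.le H₀.2)) fun Y hY => ?_
    rw [D.symm, ← D.lie_left']
    exact (key Y hY).1
  have hmem : Ad E g X ∈ lieOf E T :=
    M.mem _ hXk fun H hH => D.lie_eq_zero_of_regular M hH₀ hcomm ⟨H, hH⟩
  refine ⟨g, hg, hmem, fun β hβ => ?_⟩
  obtain ⟨x, hx, y, hy, hx0, hy0, hxy⟩ := exists_of_mem_wts hβ
  have h1 := (key x hx).2
  have h2 : ⁅x, Ad E g X⁆ = β ⟨_, hmem⟩ • y := by
    rw [← lie_skew, (hxy ⟨_, hmem⟩).1, neg_neg]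
  rw [h2, lie_smul, map_smul, LinearMap.smul_apply, (D.lie_mem_of_rotation M hx hy hxy).2,
    smul_eq_mul] at h1
  have h3 := D.neg_def x hx hx0
  by_contra hneg
  have := mul_pos_of_neg_of_neg (not_le.mp hneg) h3
  linarith

/-- The pullback of a weight by an element that normalises `𝔱` is a weight. -/
lemma comp_Ad_mem_wts {t U : Submodule ℝ (LieAlg E G)} {g : G}
    (h : ∀ H : LieAlg E G, H ∈ t → Ad E g H ∈ t)
    (hinv : ∀ H ∈ t, Ad E g⁻¹ H ∈ t) (hU : ∀ x ∈ U, Ad E g⁻¹ x ∈ U)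
    {β : Module.Dual ℝ t} (hβ : β ∈ wts t U) :
    β ∘ₗ (Ad E g).restrict h ∈ wts t U := by
  obtain ⟨x, hx, y, hy, hx0, hy0, hxy⟩ := exists_of_mem_wts hβ
  refine mem_wts_of_ne_zero (fun h0 => hβ.1 (LinearMap.ext fun H => ?_)) (hU x hx) (hU y hy)
    (fun h0 => hx0 (by rw [← Ad_Ad_inv g x, h0, map_zero])) fun H => ?_
  · have h1 := LinearMap.congr_fun h0 ⟨_, hinv H H.2⟩
    have h2 : (Ad E g).restrict h ⟨_, hinv H H.2⟩ = H :=
      Subtype.ext (Ad_Ad_inv g (H : LieAlg E G))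
    rwa [LinearMap.comp_apply, h2] at h1
  · have h1 := hxy ⟨_, h H H.2⟩
    have h2 : ∀ z : LieAlg E G, ⁅(H : LieAlg E G), Ad E g⁻¹ z⁆ = Ad E g⁻¹ ⁅Ad E g H, z⁆ :=
      fun z => by rw [Ad_lie, Ad_inv_Ad]
    rw [h2, h2, h1.1, h1.2, map_neg, map_smul, map_smul]
    exact ⟨rfl, rfl⟩

/-- Weyl group elements: some `g` in `K` normalises `𝔱` and moves a given element of `𝔱` to the closed
chamber of a given regular element. -/
lemma exists_Ad_normalizer (hT : IsMaximalTorus K T) (hθ : IsCartanInvolution E K θ)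
    (hB : IsInvariantForm θ B) {H₀ : lieOf E T}
    (hH₀ : ∀ β ∈ wts (lieOf E T) (⊤ : Submodule ℝ (LieAlg E G)), β H₀ ≠ 0) (X : lieOf E T) :
    ∃ g ∈ K, ∃ h : ∀ H : LieAlg E G, H ∈ lieOf E T → Ad E g H ∈ lieOf E T,
      (∀ H ∈ lieOf E T, Ad E g⁻¹ H ∈ lieOf E T) ∧
      ∀ β ∈ wts (lieOf E T) (kPart E θ), 0 < β H₀ → 0 ≤ β ⟨Ad E g X, h X X.2⟩ := by
  have D := isCartanDecomposition hθ hB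
  have M := hT.isMaximalAbelian hθ
  obtain ⟨X', hX'⟩ := exists_regular_near (finite_wts M.comm) (fun α hα => hα.1) X
  obtain ⟨g, hg, hmem, hdom⟩ := exists_Ad_mem hT hθ hB hH₀ (M.le X'.2)
  have hinv : ∀ H ∈ lieOf E T, Ad E g⁻¹ H ∈ lieOf E T := by
    intro H hH
    refine M.mem _ (hθ.Ad_mem_kPart (K.inv_mem hg) (M.le hH)) fun H' hH' => ?_
    refine D.lie_eq_zero_of_regular M (fun β hβ => (hX' β hβ).1) ?_ ⟨H', hH'⟩
    rw [← Ad_inv_Ad g (X' : LieAlg E G), ← Ad_lie, M.comm _ hmem _ hH, map_zero]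
  have hfor : ∀ H : LieAlg E G, H ∈ lieOf E T → Ad E g H ∈ lieOf E T := by
    intro H hH
    -- the injective endomorphism `Ad g⁻¹` of `𝔱` is onto
    have hinj : Function.Injective ((Ad E g⁻¹).restrict hinv) := by
      intro Y Y' hYY'
      have h1 : Ad E g⁻¹ (Y : LieAlg E G) = Ad E g⁻¹ Y' := congrArg Subtype.val hYY'
      refine Subtype.ext ?_
      rw [← Ad_Ad_inv g (Y : LieAlg E G), h1, Ad_Ad_inv]
    obtain ⟨Y, hY⟩ := LinearMap.surjective_of_injective hinj ⟨H, hH⟩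
    have h1 : Ad E g⁻¹ (Y : LieAlg E G) = H := congrArg Subtype.val hY
    rw [← h1, Ad_Ad_inv]
    exact Y.2
  refine ⟨g, hg, hfor, hinv, fun β hβ hβ0 => ?_⟩
  let γ : Module.Dual ℝ (lieOf E T) := β ∘ₗ (Ad E g).restrict hfor
  have hγ : γ ∈ wts (lieOf E T) (kPart E θ) :=
    comp_Ad_mem_wts hfor hinv (fun x hx => hθ.Ad_mem_kPart (K.inv_mem hg) hx) hβ
  have h1 : 0 ≤ γ X' := nonneg_of_mul_nonneg_left (hdom β hβ) hβ0
  by_contra hneg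
  exact ((hX' γ (wts_mono le_top hγ)).2 (not_le.mp hneg)).not_ge h1

/-! ### The inner product on the dual of `𝔱` and projections on cones -/

namespace IsCartanDecomposition

variable {𝔤 : Type*} [LieRing 𝔤] [LieAlgebra ℝ 𝔤] [FiniteDimensional ℝ 𝔤] {t k p : Submodule ℝ 𝔤}
  {B : LinearMap.BilinForm ℝ 𝔤} (D : IsCartanDecomposition k p B) (M : IsMaximalAbelian k t)

include D M in
lemma bijective_restrict :
    Function.Bijective (fun w : t => ((-(B.restrict t)) w : Module.Dual ℝ t)) := by
  have hinj : Function.Injective (-(B.restrict t) : t →ₗ[ℝ] Module.Dual ℝ t) := by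
    intro W W' h
    refine Subtype.ext (D.eq_of_form_eq M W.2 W'.2 fun H hH => ?_)
    have := LinearMap.congr_fun h ⟨H, hH⟩
    exact neg_injective this
  exact ⟨hinj, (LinearMap.injective_iff_surjective_of_finrank_eq_finrank
    Subspace.dual_finrank_eq.symm).mp hinj⟩

/-- The vector of `𝔱` that represents a functional with respect to the positive definite form
`-B`. -/
def vec : Module.Dual ℝ t ≃ₗ[ℝ] t :=
  (LinearEquiv.ofBijective (-(B.restrict t) : t →ₗ[ℝ] Module.Dual ℝ t)
    (D.bijective_restrict M)).symm

lemma neg_form_vec (φ : Module.Dual ℝ t) (H : t) : -B (D.vec M φ) H = φ H :=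
  LinearMap.congr_fun ((LinearEquiv.ofBijective (-(B.restrict t) : t →ₗ[ℝ] Module.Dual ℝ t)
    (D.bijective_restrict M)).apply_symm_apply φ) H

lemma eq_vec {φ : Module.Dual ℝ t} {W : t} (h : ∀ H : t, -B W H = φ H) : W = D.vec M φ :=
  Subtype.ext (D.eq_of_form_eq M W.2 (D.vec M φ).2 fun H hH =>
    neg_injective ((h ⟨H, hH⟩).trans (D.neg_form_vec M φ ⟨H, hH⟩).symm))

lemma apply_vec_comm (φ ψ : Module.Dual ℝ t) : φ (D.vec M ψ) = ψ (D.vec M φ) := by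
  rw [← D.neg_form_vec M φ, ← D.neg_form_vec M ψ, D.symm]

lemma apply_vec_nonneg (φ : Module.Dual ℝ t) : 0 ≤ φ (D.vec M φ) := by
  rw [← D.neg_form_vec M φ]
  rcases eq_or_ne (D.vec M φ : 𝔤) 0 with h | h
  · rw [h, map_zero, neg_zero]
  · exact (neg_pos.mpr (D.neg_def _ (M.le (D.vec M φ).2) h)).le

/-- If a functional vanishes on the commutators, then the vector that represents it is central. -/
lemma lie_vec_eq_zero {l : Module.Dual ℝ t}
    (hl : ∀ H : t, (H : 𝔤) ∈ ⁅(⊤ : LieIdeal ℝ 𝔤), (⊤ : LieIdeal ℝ 𝔤)⁆ → l H = 0) (Y : 𝔤) :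
    ⁅Y, (D.vec M l : 𝔤)⁆ = 0 := by
  obtain ⟨Z, hZ, hZc, W, hW, hWc, hX⟩ := D.exists_center_add (M.le (D.vec M l).2)
  have hZt : Z ∈ t := M.mem Z hZ fun H _ => hZc H
  have hWt : W ∈ t := by
    rw [← add_sub_cancel_left Z W, ← hX]
    exact t.sub_mem (D.vec M l).2 hZt
  have h1 := D.neg_form_vec M l ⟨W, hWt⟩
  rw [hl ⟨W, hWt⟩ hWc, neg_eq_zero, hX, LinearMap.map_add₂, D.form_eq_zero_of_center hZc hWc,
    zero_add] at h1
  have h2 : W = 0 := by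
    by_contra hne
    exact (D.neg_def W hW hne).ne h1
  rw [hX, h2, add_zero]
  exact hZc Y

include D M in
omit [FiniteDimensional ℝ 𝔤] in
lemma wts_apply_eq_zero {U : Submodule ℝ 𝔤} {γ : Module.Dual ℝ t} (hγ : γ ∈ wts t U) {H : t}
    (hH : ∀ Y : 𝔤, ⁅Y, (H : 𝔤)⁆ = 0) : γ H = 0 := by
  obtain ⟨x, -, y, -, -, hy0, hxy⟩ := exists_of_mem_wts hγ
  have := (hxy H).1
  rw [← lie_skew, hH, neg_zero, eq_comm, neg_eq_zero, smul_eq_zero] at this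
  exact this.resolve_right hy0

end IsCartanDecomposition

section Projection

variable {k p : Submodule ℝ (LieAlg E G)} (D : IsCartanDecomposition k p B)
  (M : IsMaximalAbelian k (lieOf E T))

lemma ip_eq (φ ψ : Module.Dual ℝ (lieOf E T)) : ip B T φ ψ = φ (D.vec M ψ) := by
  unfold ip dualForm
  congr 1
  refine Eq.trans ?_ (Function.leftInverse_invFun (D.bijective_restrict M).1 (D.vec M ψ))
  congr 1
  exact LinearMap.ext fun H => (D.neg_form_vec M ψ H).symm

include D M in
/-- At the projection `c` of `v` on a set that contains the ray `c + s φ`, the vector `v - c` makes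
an obtuse angle with `φ`. -/
lemma apply_vec_nonpos_of_isProjection {C : Set (Module.Dual ℝ (lieOf E T))}
    {v c φ : Module.Dual ℝ (lieOf E T)} (h : IsProjection B T C v c)
    (hφ : ∀ s : ℝ, 0 ≤ s → c + s • φ ∈ C) : (v - c) (D.vec M φ) ≤ 0 := by
  by_contra! hpos
  have key : ∀ s : ℝ, 0 ≤ s → 2 * s * (v - c) (D.vec M φ) ≤ s * s * φ (D.vec M φ) := by
    intro s hs
    have e : ∀ w : Module.Dual ℝ (lieOf E T), (w - s • φ) (D.vec M (w - s • φ)) =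
        w (D.vec M w) - 2 * s * w (D.vec M φ) + s * s * φ (D.vec M φ) := by
      intro w
      simp only [map_sub, map_smul, LinearMap.sub_apply, LinearMap.smul_apply, smul_eq_mul,
        D.apply_vec_comm M φ w]
      ring
    have h1 := h.2 _ (hφ s hs)
    rw [ip_eq D M, ip_eq D M, ← sub_sub, e] at h1
    linarith
  have hn := D.apply_vec_nonneg M φ
  set a := (v - c) (D.vec M φ)
  set b := φ (D.vec M φ)
  have hs : 0 < a / (b + 1) := by positivity
  have h1 := key (a / (b + 1)) hs.le
  have h2 : 2 * a ≤ a / (b + 1) * b := by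
    refine le_of_mul_le_mul_left ?_ hs
    linarith
  have h3 : a / (b + 1) * b ≤ a := by
    rw [div_mul_eq_mul_div, div_le_iff₀ (by linarith)]
    nlinarith
  linarith

include D M in
/-- A point `c` of a set is the projection of `v` if `v - c` is orthogonal to `c` and makes an
obtuse angle with all vectors of the set. -/
lemma isProjection_of_apply_vec {C : Set (Module.Dual ℝ (lieOf E T))}
    {v c : Module.Dual ℝ (lieOf E T)} (hc : c ∈ C) (h0 : (v - c) (D.vec M c) = 0)
    (h : ∀ φ ∈ C, (v - c) (D.vec M φ) ≤ 0) : IsProjection B T C v c := by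
  refine ⟨hc, fun c' hc' => ?_⟩
  rw [ip_eq D M, ip_eq D M]
  have h1 := h c' hc'
  have h2 := D.apply_vec_nonneg M (c - c')
  have h3 := D.apply_vec_comm M (c - c') (v - c)
  have e : v - c' = (v - c) + (c - c') := by abel
  rw [e]
  set w := v - c
  have h4 : w (D.vec M (c - c')) = - w (D.vec M c') := by
    rw [map_sub, map_sub, h0, zero_sub]
  rw [map_add, LinearMap.add_apply, map_add, map_add, h3, h4]
  linarith

end Projection

/-! ### The sums of the positive roots -/

section TwoRho

variable {k p : Submodule ℝ (LieAlg E G)} (D : IsCartanDecomposition k p B)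
  (M : IsMaximalAbelian k (lieOf E T))
  {P Pk : Set (Module.Dual ℝ (lieOf E T))}

include M in
open Classical in
/-- The sum of the weights in `P` may be taken over all weights in `𝔤` that lie in `P`. -/
lemma twoRho_apply {U : Submodule ℝ (LieAlg E G)} {Q : Set (Module.Dual ℝ (lieOf E T))}
    (hP : P ⊆ wts (lieOf E T) (⊤ : Submodule ℝ (LieAlg E G)))
    (hQ : Q = P ∩ wts (lieOf E T) U) (X : lieOf E T) :
    twoRho T U Q X =
      ∑ γ ∈ (finite_wts M.comm (U := (⊤ : Submodule ℝ (LieAlg E G)))).toFinset with γ ∈ P,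
        (Module.finrank ℂ (wtSpace (lieOf E T) U γ) : ℝ) * γ X := by
  rw [twoRho, finsum_mem_eq_sum_of_inter_support_eq (t :=
    (finite_wts M.comm (U := (⊤ : Submodule ℝ (LieAlg E G)))).toFinset.filter fun γ => γ ∈ P),
    LinearMap.sum_apply]
  · refine Finset.sum_congr rfl fun γ _ => ?_
    rw [LinearMap.smul_apply, smul_eq_mul, weightSpace_eq_wtSpace]
  · ext γ
    simp only [Finset.coe_filter, Set.Finite.mem_toFinset, mem_inter_iff, mem_ofPred_eq,
      Function.mem_support, hQ]
    constructor
    · rintro ⟨⟨h1, h2⟩, h3⟩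
      exact ⟨⟨hP h1, h1⟩, h3⟩
    · rintro ⟨⟨h1, h2⟩, h3⟩
      refine ⟨⟨h2, h1.1, fun hbot => h3 ?_⟩, h3⟩
      rw [weightSpace_eq_wtSpace, hbot, finrank_bot, Nat.cast_zero, zero_smul]

include D M in
open Classical in
lemma twoRho_sub_twoRho_apply (hP : P ⊆ wts (lieOf E T) (⊤ : Submodule ℝ (LieAlg E G)))
    (hPk : Pk = P ∩ wts (lieOf E T) k) (X : lieOf E T) :
    (twoRho T (⊤ : Submodule ℝ (LieAlg E G)) P - twoRho T k Pk) X =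
      ∑ γ ∈ (finite_wts M.comm (U := (⊤ : Submodule ℝ (LieAlg E G)))).toFinset with γ ∈ P,
        (Module.finrank ℂ (wtSpace (lieOf E T) p γ) : ℝ) * γ X := by
  rw [LinearMap.sub_apply, twoRho_apply M hP (inter_eq_left.mpr hP).symm, twoRho_apply M hP hPk,
    ← Finset.sum_sub_distrib]
  refine Finset.sum_congr rfl fun γ _ => ?_
  rw [D.finrank_wtSpace_top M]
  push_cast
  ring

lemma IsPositiveSystem.subset {V : Type*} [AddCommGroup V] [Module ℝ V]
    {Δ P : Set (Module.Dual ℝ V)} (h : IsPositiveSystem Δ P) : P ⊆ Δ := by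
  obtain ⟨H, -, rfl⟩ := h
  exact fun α hα => hα.1

lemma IsPositiveSystem.mem_or_neg_mem {V : Type*} [AddCommGroup V] [Module ℝ V]
    {Δ P : Set (Module.Dual ℝ V)} (h : IsPositiveSystem Δ P) {α : Module.Dual ℝ V} (hα : α ∈ Δ)
    (hα' : -α ∈ Δ) : α ∈ P ∨ -α ∈ P := by
  obtain ⟨H, h0, rfl⟩ := h
  rcases lt_or_gt_of_ne (h0 α hα) with h1 | h1
  · exact Or.inr ⟨hα', by simpa using h1⟩
  · exact Or.inl ⟨hα, h1⟩

lemma IsPositiveSystem.neg_notMem {V : Type*} [AddCommGroup V] [Module ℝ V]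
    {Δ P : Set (Module.Dual ℝ V)} (h : IsPositiveSystem Δ P) {α : Module.Dual ℝ V} (hα : α ∈ P) :
    -α ∉ P := by
  obtain ⟨H, h0, rfl⟩ := h
  intro h1
  have h2 := h1.2
  rw [LinearMap.neg_apply] at h2
  linarith [hα.2]

/-- `2 ρ_c` is strictly dominant. -/
lemma twoRho_apply_vec_pos (hPk : IsPositiveSystem (wts (lieOf E T) k) Pk)
    {α : Module.Dual ℝ (lieOf E T)} (hα : α ∈ Pk) : 0 < twoRho T k Pk (D.vec M α) := by
  classical
  obtain ⟨H, h0, rfl⟩ := hPk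
  refine (D.sum_finrank_mul_pos M hα.1 (D.neg_form_vec M α) hα.2).trans_eq (Eq.symm ?_)
  rw [twoRho, finsum_mem_eq_sum_of_inter_support_eq (t :=
    (finite_wts M.comm (U := k)).toFinset.filter fun γ => 0 < γ H), LinearMap.sum_apply]
  · refine Finset.sum_congr rfl fun γ _ => ?_
    rw [LinearMap.smul_apply, smul_eq_mul, weightSpace_eq_wtSpace]
  · congr 1
    ext γ
    simp

include D M in
/-- The strict dominance of `2 ρ_c` forces a positive system for which `μ + 2 ρ_c` is dominant to
extend the given positive system of `𝔨`. -/
lemma positiveSystem_eq_inter (hPk : IsPositiveSystem (wts (lieOf E T) k) Pk)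
    (hP : IsPositiveSystem (wts (lieOf E T) (⊤ : Submodule ℝ (LieAlg E G))) P)
    {μ : Module.Dual ℝ (lieOf E T)} (hμ : μ ∈ chamber B T Pk)
    (hμP : μ + twoRho T k Pk ∈ chamber B T P) : Pk = P ∩ wts (lieOf E T) k := by
  have h1 : ∀ γ ∈ P, γ ∈ wts (lieOf E T) k → γ ∈ Pk := by
    intro γ hγ hγk
    refine (hPk.mem_or_neg_mem hγk (neg_mem_wts hγk)).resolve_right fun hneg => ?_
    have h2 := hμP γ hγ
    have h3 := hμ _ hneg
    have h4 := twoRho_apply_vec_pos D M hPk hneg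
    rw [ip_eq D M] at h2 h3
    rw [map_neg, map_neg] at h3 h4
    rw [LinearMap.add_apply] at h2
    linarith
  refine Subset.antisymm (fun γ hγ => ?_) fun γ hγ => h1 γ hγ.1 hγ.2
  have hγk := hPk.subset hγ
  refine ⟨(hP.mem_or_neg_mem (wts_mono le_top hγk) (neg_mem_wts (wts_mono le_top hγk))).resolve_right
    fun hneg => hPk.neg_notMem hγ (h1 _ hneg (neg_mem_wts hγk)), hγk⟩

include D M in
/-- A functional that vanishes on the commutators is orthogonal to all weights. -/
lemma wts_apply_vec_eq_zero {U : Submodule ℝ (LieAlg E G)} {l γ : Module.Dual ℝ (lieOf E T)}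
    (hl : ∀ H : lieOf E T, (H : LieAlg E G) ∈
      ⁅(⊤ : LieIdeal ℝ (LieAlg E G)), (⊤ : LieIdeal ℝ (LieAlg E G))⁆ → l H = 0)
    (hγ : γ ∈ wts (lieOf E T) U) : γ (D.vec M l) = 0 :=
  D.wts_apply_eq_zero M hγ fun Y => D.lie_vec_eq_zero M hl Y

include D M in
/-- If `λ_u(μ) = l` vanishes on the commutators, then `l` and `μ` agree on the part of `𝔱` that
commutes with `𝔭`: the orthogonal projection `ψ` of `μ - l` to this part can be added to `l` without
leaving the chamber, and it is orthogonal to the weights in `𝔭`. -/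
lemma apply_eq_of_isLambdaU (hPk : IsPositiveSystem (wts (lieOf E T) k) Pk)
    (hP : IsPositiveSystem (wts (lieOf E T) (⊤ : Submodule ℝ (LieAlg E G))) P)
    {μ l : Module.Dual ℝ (lieOf E T)} (hμ : μ ∈ chamber B T Pk)
    (hμP : μ + twoRho T k Pk ∈ chamber B T P)
    (hproj : IsProjection B T (chamber B T P)
      (μ + twoRho T k Pk - twoRho T (⊤ : Submodule ℝ (LieAlg E G)) P) l)
    (hl : ∀ H : lieOf E T, (H : LieAlg E G) ∈
      ⁅(⊤ : LieIdeal ℝ (LieAlg E G)), (⊤ : LieIdeal ℝ (LieAlg E G))⁆ → l H = 0)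
    {H : lieOf E T} (hH : (H : LieAlg E G) ∈ D.centralIdeal) : μ H = l H := by
  classical
  have hPeq := positiveSystem_eq_inter D M hPk hP hμ hμP
  let c : Submodule ℝ (lieOf E T) := D.centralIdeal.toSubmodule.comap (lieOf E T).subtype
  have hmemc : ∀ H : lieOf E T, H ∈ c ↔ (H : LieAlg E G) ∈ D.centralIdeal := fun H => Iff.rfl
  obtain ⟨R, hR, hRid, hRo⟩ := exists_orthogonal_add (b := -(B.restrict (lieOf E T)))
    (fun x y => congrArg Neg.neg (D.symm _ _)) (c := c) (fun x _ hx0 =>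
      neg_pos.mpr (D.neg_def x (M.le x.2) fun h => hx0 (Subtype.ext h)))
  have hRo' : ∀ z ∈ c, ∀ x : lieOf E T, B (z : LieAlg E G) ((x - R x : lieOf E T) : LieAlg E G) = 0 :=
    fun z hz x => neg_eq_zero.mp (hRo z hz x)
  have hform : ∀ φ : Module.Dual ℝ (lieOf E T), ∀ z ∈ c,
      φ z = -B (R (D.vec M φ) : LieAlg E G) z := by
    intro φ z hz
    have h1 := hRo' z hz (D.vec M φ)
    rw [AddSubgroupClass.coe_sub, map_sub, sub_eq_zero] at h1
    rw [← D.neg_form_vec M φ, D.symm, h1, D.symm]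
  set w := D.vec M (μ - l) with hw
  let ψ : Module.Dual ℝ (lieOf E T) := (μ - l) ∘ₗ R
  have hvec : D.vec M ψ = R w := by
    refine (D.eq_vec M fun H => ?_).symm
    have h1 := hRo' _ (hR w) H
    rw [AddSubgroupClass.coe_sub, map_sub, sub_eq_zero] at h1
    rw [h1]
    exact (hform (μ - l) _ (hR H)).symm
  -- the weights in `𝔭` vanish on `c`
  have hp : ∀ γ ∈ wts (lieOf E T) p, ∀ z ∈ c, γ z = 0 := by
    intro γ hγ z hz
    obtain ⟨x, hx, y, hy, hx0, hy0, hxy⟩ := exists_of_mem_wts hγ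
    have := (hxy z).1
    rw [((hmemc z).mp hz).2 x hx, eq_comm, neg_eq_zero, smul_eq_zero] at this
    exact this.resolve_right hy0
  have hlγ : ∀ γ ∈ P, l (D.vec M γ) = 0 := fun γ hγ => by
    rw [D.apply_vec_comm M]
    exact wts_apply_vec_eq_zero D M hl (hP.subset hγ)
  have hray : ∀ s : ℝ, 0 ≤ s → l + s • ψ ∈ chamber B T P := by
    intro s hs γ hγ
    rw [ip_eq D M, LinearMap.add_apply, hlγ γ hγ, zero_add, LinearMap.smul_apply, smul_eq_mul,
      D.apply_vec_comm M, hvec]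
    refine mul_nonneg hs ?_
    rcases D.wts_top_cases M (hP.subset hγ) with h | ⟨hγk, h⟩
    · rw [h _ (hR w)]
    · have h1 : γ (w - R w) = 0 := h _ fun H' hH' hH'u => hRo' ⟨H', hH'⟩ hH'u w
      rw [map_sub, sub_eq_zero] at h1
      rw [← h1, hw, D.apply_vec_comm M, LinearMap.sub_apply, hlγ γ hγ, sub_zero, ← ip_eq D M]
      exact hμ γ (hPeq.ge ⟨hγ, hγk⟩)
  have h1 := apply_vec_nonpos_of_isProjection D M hproj hray
  have h2 : (twoRho T (⊤ : Submodule ℝ (LieAlg E G)) P - twoRho T k Pk) (R w) = 0 := by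
    rw [twoRho_sub_twoRho_apply D M hP.subset hPeq]
    refine Finset.sum_eq_zero fun γ _ => ?_
    by_cases hγ : γ ∈ wts (lieOf E T) p
    · rw [hp γ hγ _ (hR w), mul_zero]
    · by_cases hγ0 : γ = 0
      · rw [hγ0, LinearMap.zero_apply, mul_zero]
      · have : wtSpace (lieOf E T) p γ = ⊥ := by
          by_contra hne
          exact hγ ⟨hγ0, hne⟩
        rw [this, finrank_bot, Nat.cast_zero, zero_mul]
  have h3 : (μ - l) (R w) ≤ 0 := by
    rw [hvec] at h1
    have e : μ + twoRho T k Pk - twoRho T (⊤ : Submodule ℝ (LieAlg E G)) P - l =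
        (μ - l) - (twoRho T (⊤ : Submodule ℝ (LieAlg E G)) P - twoRho T k Pk) := by abel
    rwa [e, LinearMap.sub_apply, h2, sub_zero] at h1
  have h4 : (R w : LieAlg E G) = 0 := by
    by_contra hne
    have h5 := D.neg_def _ (M.le (R w).2) hne
    rw [hform (μ - l) _ (hR w)] at h3
    linarith
  have h6 := hform (μ - l) H hH
  rw [← hw, h4, map_zero, LinearMap.zero_apply, neg_zero, LinearMap.sub_apply] at h6
  exact sub_eq_zero.mp h6

end TwoRho

/-! ### The group generated by the compact simple factors -/

lemma form_Ad_left (hB : IsInvariantForm θ B) (g : G) (X Y : LieAlg E G) :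
    B (Ad E g X) Y = B X (Ad E g⁻¹ Y) := by
  rw [← hB.ad_invariant g⁻¹, Ad_inv_Ad]

lemma compactFactors_le (hθ : IsCartanInvolution E K θ) (hB : IsInvariantForm θ B) :
    compactFactors E G ≤ (isCartanDecomposition hθ hB).centralIdeal :=
  (isCartanDecomposition hθ hB).sSup_le_centralIdeal

lemma compactFactors_le_commutator :
    compactFactors E G ≤ ⁅(⊤ : LieIdeal ℝ (LieAlg E G)), (⊤ : LieIdeal ℝ (LieAlg E G))⁆ :=
  sSup_le fun _ hJ => hJ.1

/-- The elements of `G_c` are exponentials of elements of `𝔤_c`. -/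
lemma exists_expG_eq_of_mem_Gc (hθ : IsCartanInvolution E K θ) (hB : IsInvariantForm θ B) {z : G}
    (hz : z ∈ Gc E G) : ∃ X ∈ compactFactors E G, expG X = z := by
  have D := isCartanDecomposition hθ hB
  have hle := compactFactors_le hθ hB
  -- `Ad (exp X)` fixes the orthogonal complement of the ideal, and hence preserves the ideal
  have hfix : ∀ X ∈ compactFactors E G, ∀ Y, (∀ Z ∈ compactFactors E G, B Z Y = 0) →
      Ad E (expG X) Y = Y := by
    intro X hX Y hY
    refine Ad_expG_of_lie_eq_zero (D.nondegenerate fun Z => ?_)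
    rw [D.lie_left, D.symm, hY _ (lie_mem_left ℝ _ _ X Z hX), neg_zero]
  obtain ⟨P, hP, -, hPo⟩ := exists_orthogonal_add (b := -B) (fun x y => by simp [D.symm x y])
    (c := (compactFactors E G).toSubmodule)
    (fun x hx hx0 => by simpa using D.neg_def x (hle hx).1 hx0)
  have hPo' : ∀ Z ∈ compactFactors E G, ∀ Y, B Z (Y - P Y) = 0 := fun Z hZ Y =>
    neg_eq_zero.mp (hPo Z hZ Y)
  have hmem : ∀ X ∈ compactFactors E G, ∀ Y ∈ compactFactors E G,
      Ad E (expG X) Y ∈ compactFactors E G := by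
    intro X hX Y hY
    set V := Ad E (expG X) Y with hV
    have hVk : V ∈ kPart E θ := hθ.Ad_mem_kPart (hθ.expG_mem (hle hX).1) (hle hY).1
    have h1 : B V (V - P V) = 0 := by
      rw [hV, form_Ad_left hB, ← hV, ← expG_neg,
        hfix _ (neg_mem hX) _ fun Z hZ => hPo' Z hZ V]
      exact hPo' Y hY V
    have h2 : V - P V = 0 := by
      by_contra hne
      refine (D.neg_def _ ((kPart E θ).sub_mem hVk (hle (hP V)).1) hne).ne ?_
      rw [LinearMap.map_sub₂, h1, hPo' _ (hP V), sub_zero]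
    rw [sub_eq_zero.mp h2]
    exact hP V
  let e := lieEquiv E G
  let b : LinearMap.BilinForm ℝ E := (-B).compl₁₂ e.symm.toLinearMap e.symm.toLinearMap
  have hb : ∀ x y, b x y = -B (e.symm x) (e.symm y) := fun x y => rfl
  let c : Submodule ℝ E := (compactFactors E G).toSubmodule.comap e.symm.toLinearMap
  have hc : IsCompactIdeal G c b := by
    refine ⟨fun x y => ?_, fun g x y => ?_, fun x hx hx0 => ?_, fun x hx y hy => ?_,
      fun x hx y hy => ?_⟩
    · rw [hb, hb, D.symm]
    · rw [hb, hb, AdE_apply, AdE_apply]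
      exact congrArg Neg.neg (hB.ad_invariant g _ _)
    · rw [hb]
      exact neg_pos.mpr (D.neg_def _ (hle hx).1 fun h => hx0 (by simpa using h))
    · exact hmem _ hx _ hy
    · refine hfix _ hx _ fun Z hZ => ?_
      exact neg_eq_zero.mp (hy (e Z) hZ)
  have hz' : z ∈ Subgroup.closure (expE E G '' c) := by
    refine (Subgroup.closure_mono ?_ : Gc E G ≤ _) hz
    rintro g ⟨X, hX, γ, hγ, rfl⟩
    refine ⟨e X, hX, ?_⟩
    rw [hγ.eq_expG, one_smul]
    exact expE_lieEquiv X
  obtain ⟨x, hx, rfl⟩ := hc.exists_expE_eq hz'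
  exact ⟨e.symm x, hx, rfl⟩

lemma expG_mem_Gc {X : LieAlg E G} (hX : X ∈ compactFactors E G) : expG X ∈ Gc E G :=
  Subgroup.subset_closure ⟨X, hX, _, isOneParam_expG X, congrArg expG (one_smul ℝ X)⟩

/-! ### From parameters to characters of `Z_c / F_c` -/

/-- A functional with isotropy group `G` vanishes on the commutators. -/
lemma lie_eq_zero_of_isotropy_eq_univ {l : Module.Dual ℝ (LieAlg E G)}
    (h : isotropy E l = Set.univ) (X Y : LieAlg E G) : l ⁅X, Y⁆ = 0 := by
  have hinv : ∀ (g : G) (X : LieAlg E G), l (Ad E g X) = l X := fun g X => by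
    have h1 : g⁻¹ ∈ isotropy E l := h.ge trivial
    have h2 := h1 X
    rwa [inv_inv] at h2
  have h1 := hasDerivAt_Ad l X Y 0
  rw [funext fun s : ℝ => hinv (expG (s • X)) Y] at h1
  have h2 := h1.unique (hasDerivAt_const (0 : ℝ) (l Y))
  rwa [hinv] at h2

/-- The inclusion of the Lie algebra of `Z_c` in that of `T`. -/
lemma IsHarishChandraClass.lieOf_Zc_le (hG : IsHarishChandraClass E G)
    (hθ : IsCartanInvolution E K θ) (hT : IsMaximalTorus K T) :
    lieOf E (Zc E K) ≤ lieOf E T := fun X hX => by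
  have h := (hG.mem_lieOf_Zc_iff hθ).mp hX
  exact hT.mem_lieOf_of_lie_eq_zero hθ h.2 fun H _ => by rw [← lie_skew, h.1, neg_zero]

/-- If `l` has a `G`-invariant extension and agrees on the elements that commute with `𝔭` with the
differential of a character of `T`, then it is the differential of a character of `Z_c / F_c`: the
restriction of the character of `T` to `Z_c` is trivial on `F_c`, because `F_c` consists of
exponentials of elements of the compact factors, where `l` vanishes. -/
lemma mem_centralDifferentials (hG : IsHarishChandraClass E G) (hθ : IsCartanInvolution E K θ)
    (hB : IsInvariantForm θ B) (hT : IsMaximalTorus K T) {μ l : Module.Dual ℝ (lieOf E T)}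
    {l' : Module.Dual ℝ (LieAlg E G)} (hμ : μ ∈ characterLattice E T)
    (hl' : ∀ H : lieOf E T, l' H = l H) (hinv : isotropy E l' = Set.univ)
    (hμl : ∀ H : lieOf E T, (H : LieAlg E G) ∈ (isCartanDecomposition hθ hB).centralIdeal →
      μ H = l H) : l ∈ centralDifferentials E K T := by
  have D := isCartanDecomposition hθ hB
  have M := hT.isMaximalAbelian hθ
  have hlie := lie_eq_zero_of_isotropy_eq_univ hinv
  have hl : ∀ H : lieOf E T, (H : LieAlg E G) ∈
      ⁅(⊤ : LieIdeal ℝ (LieAlg E G)), (⊤ : LieIdeal ℝ (LieAlg E G))⁆ → l H = 0 := fun H hH => by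
    rw [← hl']
    exact dual_eq_zero_of_mem_commutator hlie hH
  obtain ⟨χ, hχ⟩ := hμ
  have hle := hG.Zc_le hθ hT
  have hχexp : ∀ (X : lieOf E T) (z : T), expG (X : LieAlg E G) = z → χ z = Circle.exp (μ X) := by
    intro X z hz
    have h := hχ X _ (isOneParam_expG (X : LieAlg E G)) ((mem_lieOf_iff hT.comm).mp X.2) 1
    rw [one_mul] at h
    rw [← h]
    congr 1
    exact Subtype.ext (hz.symm.trans (congrArg expG (one_smul ℝ _).symm))
  let ι : Zc E K →ₜ* T :=
    { toMonoidHom := Subgroup.inclusion hle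
      continuous_toFun := continuous_inclusion hle }
  have htriv : ∀ z : Zc E K, z ∈ (Fc E G).subgroupOf (Zc E K) → (χ.comp ι) z = 1 := by
    rintro z ⟨⟨z', -, hz'⟩, hzZ⟩
    have hzG : (z : G) ∈ Gc E G := by
      rw [← show (z' : G) = z from hz']
      exact z'.2
    obtain ⟨X, hX, hXz⟩ := exists_expG_eq_of_mem_Gc hθ hB hzG
    have hXu := compactFactors_le hθ hB hX
    -- conjugate `X` into the torus
    obtain ⟨H₀, hH₀⟩ := exists_forall_ne_zero (finite_wts M.comm (U := ⊤)) fun α hα => hα.1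
    obtain ⟨g, hg, hmem, -⟩ := exists_Ad_mem hT hθ hB hH₀ hXu.1
    have hzc : (z : G) * g = g * z := comm_of_mem_centerIdentity hzZ g
    have hzg : expG (Ad E g X) = ι z := by
      rw [← conj_expG, hXz, ← hzc, mul_inv_cancel_right]
      rfl
    have hu : Ad E g X ∈ D.centralIdeal := by
      refine ⟨hθ.Ad_mem_kPart hg hXu.1, fun Y hY => ?_⟩
      rw [← Ad_Ad_inv g Y, ← Ad_lie, hXu.2 _ (hθ.Ad_mem_pPart (K.inv_mem hg) hY), map_zero]
    have h1 : l ⟨_, hmem⟩ = 0 := by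
      have h2 : g⁻¹ ∈ isotropy E l' := hinv.ge trivial
      have h3 := h2 X
      rw [inv_inv] at h3
      rw [← hl', h3]
      exact dual_eq_zero_of_mem_commutator hlie (compactFactors_le_commutator hX)
    change χ (ι z) = 1
    rw [hχexp ⟨_, hmem⟩ (ι z) hzg, hμl ⟨_, hmem⟩ hu, h1, Circle.exp_zero]
  let χ' : (Zc E K ⧸ (Fc E G).subgroupOf (Zc E K)) →ₜ* Circle :=
    { toMonoidHom := QuotientGroup.lift _ (χ.comp ι).toMonoidHom htriv
      continuous_toFun := (χ.comp ι).continuous_toFun.quotient_lift _ }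
  have hlieZ := hG.lieOf_Zc_le hθ hT
  refine ⟨χ', l ∘ₗ Submodule.inclusion hlieZ, fun X γ hγ hγmem s => ?_, fun X hz ht => rfl, hl⟩
  have hX := (hG.mem_lieOf_Zc_iff hθ).mp X.2
  have h1 := hχ ⟨X, hlieZ X.2⟩ γ hγ (fun s => hle (hγmem s)) s
  rw [hμl ⟨X, hlieZ X.2⟩ ⟨hX.2, fun Y _ => by rw [← lie_skew]; exact neg_eq_zero.mpr (hX.1 Y)⟩] at h1
  exact h1

/-! ### From characters of `Z_c / F_c` to parameters -/

/-- The differential of a character of `Z_c / F_c` takes values in `2 π ℤ` on the elements of `𝔱`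
that commute with `𝔭` and have trivial exponential. -/
lemma apply_mem_of_mem_centralDifferentials (hG : IsHarishChandraClass E G)
    (hθ : IsCartanInvolution E K θ) (hB : IsInvariantForm θ B) (hT : IsMaximalTorus K T)
    {l : Module.Dual ℝ (lieOf E T)} (hl : l ∈ centralDifferentials E K T) {H : lieOf E T}
    (hH : (H : LieAlg E G) ∈ (isCartanDecomposition hθ hB).centralIdeal)
    (hexp : expG (H : LieAlg E G) = 1) : ∃ n : ℤ, l H = n * (2 * Real.pi) := by
  obtain ⟨χ, φ, hχ, hlφ, hl0⟩ := hl
  have D := isCartanDecomposition hθ hB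
  have M := hT.isMaximalAbelian hθ
  have := hG.reductive
  obtain ⟨Z, hZ, hZc, W, hW, hWc, hZW⟩ := D.exists_center_add hH.1
  have hZu : Z ∈ D.centralIdeal :=
    ⟨hZ, fun Y _ => by rw [← lie_skew]; exact neg_eq_zero.mpr (hZc Y)⟩
  have hWeq : W = (H : LieAlg E G) - Z := by rw [hZW, add_sub_cancel_left]
  have hWu : W ∈ D.centralIdeal := hWeq ▸ sub_mem hH hZu
  have hWf : W ∈ compactFactors E G := D.centralIdeal_inf_le_sSup ⟨hWu, hWc⟩
  have hZl : Z ∈ lieOf E (Zc E K) := (hG.mem_lieOf_Zc_iff hθ).mpr ⟨hZc, hZ⟩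
  have hZt : Z ∈ lieOf E T := hG.lieOf_Zc_le hθ hT hZl
  have hWt : W ∈ lieOf E T := hWeq ▸ (lieOf E T).sub_mem H.2 hZt
  have hlH : l H = φ ⟨Z, hZl⟩ := by
    have h1 : H = ⟨Z, hZt⟩ + ⟨W, hWt⟩ := Subtype.ext hZW
    rw [h1, map_add, hl0 ⟨W, hWt⟩ hWc, add_zero, hlφ Z hZl hZt]
  have hexpZ : expG Z = expG (-W) := by
    have h1 : expG (Z + W) = expG Z * expG W := expG_add (by
      rw [← lie_skew]; exact neg_eq_zero.mpr (hZc W))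
    rw [← hZW, hexp] at h1
    rw [expG_neg]
    exact eq_inv_of_mul_eq_one_left h1.symm
  have hmem := (mem_lieOf_iff (E := E) (Zc_comm (E := E) (K := K))).mp hZl
  have h1 := hχ ⟨Z, hZl⟩ _ (isOneParam_expG Z) hmem 1
  have hF : (⟨expG ((1 : ℝ) • Z), hmem 1⟩ : Zc E K) ∈ (Fc E G).subgroupOf (Zc E K) := by
    have hz := (hmem 1).1
    refine ⟨⟨⟨expG ((1 : ℝ) • Z), ?_⟩, ?_, rfl⟩, hz⟩
    · rw [one_smul, hexpZ]
      exact expG_mem_Gc (neg_mem hWf)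
    · exact Subgroup.mem_center_iff.mpr fun g => Subtype.ext (comm_of_mem_centerIdentity hz g).symm
  have h2 : toZcModFc E K ⟨expG ((1 : ℝ) • Z), hmem 1⟩ = 1 := (QuotientGroup.eq_one_iff _).mpr hF
  rw [ContinuousMonoidHom.comp_toFun, h2, map_one, one_mul, eq_comm, ← Circle.exp_zero,
    Circle.exp_eq_exp] at h1
  obtain ⟨n, hn⟩ := h1
  exact ⟨n, by rw [hlH, hn, zero_add]⟩

/-- A functional on `𝔱` that takes values in `2 π ℤ` on the elements commuting with `𝔭` that have
trivial exponential agrees on the elements commuting with `𝔭` with the differential of a character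
of `T`. -/
lemma exists_mem_characterLattice_eq (hθ : IsCartanInvolution E K θ) (hB : IsInvariantForm θ B)
    (hT : IsMaximalTorus K T) {l : Module.Dual ℝ (lieOf E T)}
    (hl : ∀ H : lieOf E T, (H : LieAlg E G) ∈ (isCartanDecomposition hθ hB).centralIdeal →
      expG (H : LieAlg E G) = 1 → ∃ n : ℤ, l H = n * (2 * Real.pi)) :
    ∃ μ ∈ characterLattice E T, ∀ H : lieOf E T,
      (H : LieAlg E G) ∈ (isCartanDecomposition hθ hB).centralIdeal → μ H = l H := by
  let A : Subgroup G :=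
    { carrier := {g | g ∈ T ∧ ∀ Y ∈ pPart E θ, Ad E g Y = Y}
      mul_mem' := fun {g h} hg hh => ⟨T.mul_mem hg.1 hh.1, fun Y hY => by
        rw [Ad_mul, hh.2 Y hY, hg.2 Y hY]⟩
      one_mem' := ⟨T.one_mem, fun Y _ => Ad_one Y⟩
      inv_mem' := fun {g} hg => ⟨T.inv_mem hg.1, fun Y hY => by
        nth_rewrite 1 [← hg.2 Y hY]
        exact Ad_inv_Ad g Y⟩ }
  have hAT : A ≤ T := fun g hg => hg.1
  have hAcomm : ∀ x ∈ A, ∀ y ∈ A, x * y = y * x := fun x hx y hy => hT.comm x hx.1 y hy.1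
  have hAcl : IsClosed (A : Set G) := by
    have h1 : (A : Set G) = (T : Set G) ∩
        ⋂ Y ∈ pPart E θ, ⋂ l : LieAlg E G →ₗ[ℝ] ℝ, {g | l (Ad E g Y) = l Y} := by
      ext g
      simp only [mem_inter_iff, mem_iInter, mem_ofPred_eq, SetLike.mem_coe]
      exact ⟨fun h => ⟨h.1, fun Y hY l => congrArg l (h.2 Y hY)⟩,
        fun h => ⟨h.1, fun Y hY => eq_of_forall_dual fun l => h.2 Y hY l⟩⟩
    rw [h1]
    exact hT.prop.2.1.isClosed.inter (isClosed_biInter fun Y _ => isClosed_iInter fun l =>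
      isClosed_eq (continuous_Ad l Y) continuous_const)
  have hAlie : ∀ X : LieAlg E G, X ∈ lieOf E T → (X ∈ lieOf E A ↔
      X ∈ (isCartanDecomposition hθ hB).centralIdeal) := by
    intro X hX
    rw [mem_lieOf_iff hAcomm]
    constructor
    · exact fun h => ⟨hT.lieOf_le hθ hX, fun Y hY => lie_eq_zero_of_Ad fun t => (h t).2 Y hY⟩
    · refine fun h t => ⟨(mem_lieOf_iff hT.comm).mp hX t, fun Y hY => Ad_expG_of_lie_eq_zero ?_⟩
      rw [smul_lie, h.2 Y hY, smul_zero]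
  obtain ⟨μ, hμ, h⟩ := exists_mem_characterLattice hT.comm hT.prop.2.1
    (fun g hg => hT.exists_expG_eq hg) hAT hAcl l fun X hX => hl X ((hAlie X X.2).mp hX)
  exact ⟨μ, hμ, fun H hH => h H ((hAlie H H.2).mpr hH)⟩

/-- A functional on `𝔱` that agrees with `l` on the elements commuting with `𝔭` may be changed by an
integral combination of weights in `𝔭` so that it differs from `l` by a combination of these weights
with coefficients in `[0, 1)`; in particular the difference is at most the sum of the positive
values of these weights. -/
lemma exists_mem_characterLattice_sub_le (hθ : IsCartanInvolution E K θ)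
    (hB : IsInvariantForm θ B) (hT : IsMaximalTorus K T) {μ l : Module.Dual ℝ (lieOf E T)}
    (hμ : μ ∈ characterLattice E T) (hμl : ∀ H : lieOf E T,
      (H : LieAlg E G) ∈ (isCartanDecomposition hθ hB).centralIdeal → μ H = l H) :
    ∃ ν ∈ characterLattice E T, ∀ X : lieOf E T, (ν - l) X ≤
      ∑ β ∈ (finite_wts (hT.isMaximalAbelian hθ).comm (U := pPart E θ)).toFinset,
        max (β X) 0 := by
  have D := isCartanDecomposition hθ hB
  have M := hT.isMaximalAbelian hθ
  set F := (finite_wts (hT.isMaximalAbelian hθ).comm (U := pPart E θ)).toFinset with hF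
  have hmemF : ∀ β, β ∈ F ↔ β ∈ wts (lieOf E T) (pPart E θ) := fun β => Set.Finite.mem_toFinset _
  have hspan : μ - l ∈ Submodule.span ℝ (Set.range fun β : F => (β : Module.Dual ℝ (lieOf E T))) := by
    refine mem_span_of_iInf_ker_le_ker fun H hH => ?_
    rw [LinearMap.mem_ker, LinearMap.sub_apply, hμl H, sub_self]
    refine ⟨M.le H.2, fun X hX => D.lie_eq_zero_of_forall_wts M (fun β hβ => ?_) hX⟩
    exact LinearMap.mem_ker.mp ((Submodule.mem_iInf _).mp hH ⟨β, (hmemF β).mpr hβ⟩)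
  rw [Submodule.mem_span_range_iff_exists_fun] at hspan
  obtain ⟨x, hx⟩ := hspan
  refine ⟨μ - ∑ β : F, ((⌊x β⌋ : ℤ) : ℝ) • (β : Module.Dual ℝ (lieOf E T)), ?_, fun X => ?_⟩
  · rw [mem_characterLattice_iff hT] at hμ ⊢
    intro X hX
    obtain ⟨n, hn⟩ := hμ X hX
    have h1 : ∀ β : F, ∃ m : ℤ, (β : Module.Dual ℝ (lieOf E T)) X = m * (2 * Real.pi) := fun β =>
      (mem_characterLattice_iff hT).mp (wts_pPart_subset hT hθ hB ((hmemF β).mp β.2)) X hX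
    choose m hm using h1
    refine ⟨n - ∑ β : F, ⌊x β⌋ * m β, ?_⟩
    rw [LinearMap.sub_apply, LinearMap.sum_apply, hn]
    push_cast
    rw [sub_mul, Finset.sum_mul]
    congr 1
    refine Finset.sum_congr rfl fun β _ => ?_
    rw [LinearMap.smul_apply, hm, smul_eq_mul]
    ring
  · have h1 : μ - ∑ β : F, ((⌊x β⌋ : ℤ) : ℝ) • (β : Module.Dual ℝ (lieOf E T)) - l =
        ∑ β : F, Int.fract (x β) • (β : Module.Dual ℝ (lieOf E T)) := by
      rw [sub_right_comm, ← hx, ← Finset.sum_sub_distrib]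
      refine Finset.sum_congr rfl fun β _ => ?_
      rw [← sub_smul]
      rfl
    rw [h1, LinearMap.sum_apply, ← Finset.sum_coe_sort F]
    refine Finset.sum_le_sum fun β _ => ?_
    rw [LinearMap.smul_apply, smul_eq_mul]
    have h2 := Int.fract_nonneg (x β)
    have h3 := (Int.fract_lt_one (x β)).le
    rcases le_total ((β : Module.Dual ℝ (lieOf E T)) X) 0 with h | h
    · exact (mul_nonpos_of_nonneg_of_nonpos h2 h).trans (le_max_right _ _)
    · exact (mul_le_of_le_one_left h h3).trans (le_max_left _ _)

/-- The functional of the preceding lemma may be replaced by its dominant conjugate. -/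
lemma exists_dominant_sub_le (hG : IsHarishChandraClass E G) (hθ : IsCartanInvolution E K θ)
    (hB : IsInvariantForm θ B) (hT : IsMaximalTorus K T) {Pk : Set (Module.Dual ℝ (lieOf E T))}
    (hPk : IsPositiveSystem (weights T (kPart E θ)) Pk) {ν l : Module.Dual ℝ (lieOf E T)}
    (hl : ∀ H : lieOf E T, (H : LieAlg E G) ∈
      ⁅(⊤ : LieIdeal ℝ (LieAlg E G)), (⊤ : LieIdeal ℝ (LieAlg E G))⁆ → l H = 0)
    (hν : ν ∈ characterLattice E T) (hνl : ∀ X : lieOf E T, (ν - l) X ≤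
      ∑ β ∈ (finite_wts (hT.isMaximalAbelian hθ).comm (U := pPart E θ)).toFinset, max (β X) 0) :
    ∃ μ ∈ characterLattice E T, μ ∈ chamber B T Pk ∧ ∀ X : lieOf E T, (μ - l) X ≤
      ∑ β ∈ (finite_wts (hT.isMaximalAbelian hθ).comm (U := pPart E θ)).toFinset,
        max (β X) 0 := by
  have D := isCartanDecomposition hθ hB
  have M := hT.isMaximalAbelian hθ
  rw [weights_eq_wts] at hPk
  obtain ⟨H₁, hH₁, rfl⟩ := hPk
  -- the chamber of `𝔨` is defined by an element on which no weight in `𝔤` vanishes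
  obtain ⟨H₀, hH₀⟩ := exists_regular_near (finite_wts M.comm (U := ⊤)) (fun α hα => hα.1) H₁
  obtain ⟨g, hg, hfor, hinv, hdom⟩ := exists_Ad_normalizer hT hθ hB (fun β hβ => (hH₀ β hβ).1)
    (D.vec M ν)
  let w : lieOf E T →ₗ[ℝ] lieOf E T := (Ad E g).restrict hfor
  let w' : lieOf E T →ₗ[ℝ] lieOf E T := (Ad E g⁻¹).restrict hinv
  have hww' : ∀ H, w (w' H) = H := fun H => Subtype.ext (Ad_Ad_inv g (H : LieAlg E G))
  have hw'w : ∀ H, w' (w H) = H := fun H => Subtype.ext (Ad_inv_Ad g (H : LieAlg E G))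
  have hvec : D.vec M (ν ∘ₗ w') = w (D.vec M ν) := by
    refine (D.eq_vec M fun H => ?_).symm
    rw [LinearMap.comp_apply, ← D.neg_form_vec M ν]
    exact congrArg Neg.neg (form_Ad_left hB g _ _)
  refine ⟨ν ∘ₗ w', ?_, fun α hα => ?_, fun X => ?_⟩
  · rw [mem_characterLattice_iff hT] at hν ⊢
    intro X hX
    refine hν (w' X) ?_
    change expG (Ad E g⁻¹ (X : LieAlg E G)) = 1
    rw [← conj_expG, hX, mul_one, mul_inv_cancel]
  · rw [ip_eq D M, D.apply_vec_comm M, hvec]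
    refine hdom α hα.1 ?_
    by_contra hneg
    have h1 := (hH₀ _ (wts_mono le_top (neg_mem_wts hα.1))).2 (by
      rw [LinearMap.neg_apply]
      exact neg_neg_of_pos hα.2)
    rw [LinearMap.neg_apply] at h1
    linarith
  · have h1 : l (w' X) = l X := by
      rw [← D.neg_form_vec M l, ← D.neg_form_vec M l]
      congr 1
      refine (form_Ad_left hB g _ _).symm.trans ?_
      rw [hG.Ad_eq_self g (D.lie_vec_eq_zero M hl)]
      rfl
    have h2 := hνl (w' X)
    rw [LinearMap.sub_apply, h1] at h2
    refine h2.trans (le_of_eq ?_)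
    refine Finset.sum_bij' (fun β _ => β ∘ₗ w') (fun β _ => β ∘ₗ w) ?_ ?_ ?_ ?_ ?_
    · intro β hβ
      rw [Set.Finite.mem_toFinset] at hβ ⊢
      refine comp_Ad_mem_wts hinv (fun H hH => by rw [inv_inv]; exact hfor H hH)
        (fun x hx => ?_) hβ
      rw [inv_inv]
      exact hθ.Ad_mem_pPart hg hx
    · intro β hβ
      rw [Set.Finite.mem_toFinset] at hβ ⊢
      exact comp_Ad_mem_wts hfor hinv (fun x hx => hθ.Ad_mem_pPart (K.inv_mem hg) hx) hβ
    · exact fun β _ => LinearMap.ext fun H => congrArg β (hw'w H)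
    · exact fun β _ => LinearMap.ext fun H => congrArg β (hww' H)
    · exact fun β _ => rfl

/-- If `μ - l` is bounded by the sum of the positive values of the weights in `𝔭`, then
`l = λ_u(μ)`. -/
lemma isLambdaU_of_sub_le (hθ : IsCartanInvolution E K θ) (hB : IsInvariantForm θ B)
    (hT : IsMaximalTorus K T) {Pk : Set (Module.Dual ℝ (lieOf E T))}
    (hPk : IsPositiveSystem (weights T (kPart E θ)) Pk) {μ l : Module.Dual ℝ (lieOf E T)}
    (hl : ∀ H : lieOf E T, (H : LieAlg E G) ∈
      ⁅(⊤ : LieIdeal ℝ (LieAlg E G)), (⊤ : LieIdeal ℝ (LieAlg E G))⁆ → l H = 0)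
    (hμ : μ ∈ chamber B T Pk) (hμl : ∀ X : lieOf E T, (μ - l) X ≤
      ∑ β ∈ (finite_wts (hT.isMaximalAbelian hθ).comm (U := pPart E θ)).toFinset, max (β X) 0) :
    IsLambdaU θ B T Pk μ l := by
  classical
  have D := isCartanDecomposition hθ hB
  have M := hT.isMaximalAbelian hθ
  rw [weights_eq_wts] at hPk
  obtain ⟨H₀, hH₀⟩ := exists_regular_near (finite_wts M.comm (U := ⊤)) (fun α hα => hα.1)
    (D.vec M (μ + twoRho T (kPart E θ) Pk))
  obtain ⟨P, hPdef⟩ : ∃ P, P = {γ ∈ wts (lieOf E T) (⊤ : Submodule ℝ (LieAlg E G)) | 0 < γ H₀} :=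
    ⟨_, rfl⟩
  have hP : IsPositiveSystem (wts (lieOf E T) (⊤ : Submodule ℝ (LieAlg E G))) P :=
    ⟨H₀, fun α hα => (hH₀ α hα).1, hPdef⟩
  have hμP : μ + twoRho T (kPart E θ) Pk ∈ chamber B T P := by
    intro γ hγ
    rw [ip_eq D M, D.apply_vec_comm M]
    by_contra hneg
    rw [hPdef] at hγ
    exact lt_asymm hγ.2 ((hH₀ γ hγ.1).2 (not_le.mp hneg))
  have hPeq := positiveSystem_eq_inter D M hPk hP hμ hμP
  have hlγ : ∀ {U} {γ}, γ ∈ wts (lieOf E T) U → γ (D.vec M l) = 0 := fun hγ =>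
    wts_apply_vec_eq_zero D M hl hγ
  refine ⟨P, by rwa [weights_eq_wts], hμP, isProjection_of_apply_vec D M (fun γ hγ => ?_) ?_ ?_⟩
  · rw [ip_eq D M, D.apply_vec_comm M, hlγ (hP.subset hγ)]
  all_goals
    have e : μ + twoRho T (kPart E θ) Pk - twoRho T (⊤ : Submodule ℝ (LieAlg E G)) P - l =
        (μ - l) - (twoRho T (⊤ : Submodule ℝ (LieAlg E G)) P - twoRho T (kPart E θ) Pk) := by abel
    rw [e]
  · rw [LinearMap.sub_apply, twoRho_sub_twoRho_apply D M hP.subset hPeq, Finset.sum_eq_zero, sub_zero]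
    · have h1 := hμl (D.vec M l)
      have h2 := hμl (-D.vec M l)
      rw [Finset.sum_eq_zero] at h1 h2
      · rw [map_neg] at h2
        linarith
      · intro β hβ
        rw [map_neg, hlγ ((Set.Finite.mem_toFinset _).mp hβ), neg_zero, max_self]
      · intro β hβ
        rw [hlγ ((Set.Finite.mem_toFinset _).mp hβ), max_self]
    · intro γ hγ
      rw [hlγ ((Set.Finite.mem_toFinset _).mp (Finset.mem_filter.mp hγ).1), mul_zero]
  · intro φ hφ
    have hpos : ∀ γ ∈ P, 0 ≤ γ (D.vec M φ) := fun γ hγ => by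
      have h1 := hφ γ hγ
      rwa [ip_eq D M, D.apply_vec_comm M] at h1
    rw [LinearMap.sub_apply, sub_nonpos, twoRho_sub_twoRho_apply D M hP.subset hPeq]
    refine (hμl _).trans ?_
    have h1 : ∀ β ∈ (finite_wts (hT.isMaximalAbelian hθ).comm (U := pPart E θ)).toFinset,
        max (β (D.vec M φ)) 0 = if β ∈ P then β (D.vec M φ) else 0 := by
      intro β hβ
      have hβ' := (Set.Finite.mem_toFinset _).mp hβ
      split_ifs with h
      · exact max_eq_left (hpos β h)
      · have h2 := (hP.mem_or_neg_mem (wts_mono le_top hβ')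
          (neg_mem_wts (wts_mono le_top hβ'))).resolve_left h
        have h3 := hpos _ h2
        rw [LinearMap.neg_apply] at h3
        exact max_eq_right (by linarith)
    rw [Finset.sum_congr rfl h1, ← Finset.sum_filter]
    have hnn : ∀ γ, 0 ≤ (Module.finrank ℂ (wtSpace (lieOf E T) (pPart E θ) γ) : ℝ) := fun γ =>
      Nat.cast_nonneg _
    refine (Finset.sum_le_sum fun β hβ => ?_).trans
      (Finset.sum_le_sum_of_subset_of_nonneg (fun β hβ => ?_) fun γ hγ _ =>
        mul_nonneg (hnn γ) (hpos γ (Finset.mem_filter.mp hγ).2))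
    · rw [Finset.mem_filter, Set.Finite.mem_toFinset] at hβ
      refine le_mul_of_one_le_left (hpos β hβ.2) ?_
      exact Nat.one_le_cast.mpr (Nat.pos_of_ne_zero fun h =>
        hβ.1.2 (Submodule.finrank_eq_zero.mp h))
    · rw [Finset.mem_filter, Set.Finite.mem_toFinset] at hβ ⊢
      exact ⟨wts_mono le_top hβ.1, hβ.2⟩

/-- The extension by zero of a functional that vanishes on the commutators is represented by a
central element, and hence is fixed by `G`. -/
lemma exists_isZeroExtension (hG : IsHarishChandraClass E G) (hθ : IsCartanInvolution E K θ)
    (hB : IsInvariantForm θ B) (hT : IsMaximalTorus K T) {l : Module.Dual ℝ (lieOf E T)}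
    (hl : ∀ H : lieOf E T, (H : LieAlg E G) ∈
      ⁅(⊤ : LieIdeal ℝ (LieAlg E G)), (⊤ : LieIdeal ℝ (LieAlg E G))⁆ → l H = 0) :
    ∃ l', IsZeroExtension E θ T l l' ∧ isotropy E l' = Set.univ := by
  have D := isCartanDecomposition hθ hB
  have M := hT.isMaximalAbelian hθ
  have hc := D.lie_vec_eq_zero M hl
  have hlie : ∀ X Y : LieAlg E G, (-B (D.vec M l)) ⁅X, Y⁆ = 0 := fun X Y => by
    rw [LinearMap.neg_apply, D.form_eq_zero_of_center hc (lie_mem_commutator X Y), neg_zero]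
  refine ⟨-B (D.vec M l), ⟨fun H => D.neg_form_vec M l H, fun H _ X _ => hlie H X, fun X hX => ?_⟩,
    Set.eq_univ_of_forall fun g X => hG.dual_Ad_eq g⁻¹ hlie X⟩
  rw [LinearMap.neg_apply, D.orthogonal _ (M.le (D.vec M l).2) X hX, neg_zero]

end RealReductive

end

theorem proposition6p13 {E : Type*} [NormedAddCommGroup E] [NormedSpace ℝ E]
    [FiniteDimensional ℝ E] {G : Type*} [TopologicalSpace G] [ChartedSpace E G] [Group G]
    [LieGroup 𝓘(ℝ, E) ∞ G] [T2Space G] (hG : IsHarishChandraClass E G)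
    (K : Subgroup G) (θ : G →* G) (hθ : IsCartanInvolution E K θ)
    (B : LinearMap.BilinForm ℝ (LieAlg E G)) (hB : IsInvariantForm θ B)
    (T : Subgroup G) (hT : IsMaximalTorus K T)
    (Pk : Set (Module.Dual ℝ (lieOf E T))) (hPk : IsPositiveSystem (weights T (kPart E θ)) Pk) :
    LambdaUz θ B T Pk = centralDifferentials E K T := by
  have D := isCartanDecomposition hθ hB
  have M := hT.isMaximalAbelian hθ
  refine Set.Subset.antisymm ?_ fun l hl => ?_
  · rintro l ⟨⟨μ, hμ, hμk, P, hP, hμP, hproj⟩, l', hl', hinv⟩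
    rw [weights_eq_wts] at hPk hP
    refine mem_centralDifferentials hG hθ hB hT hμ hl'.1 hinv fun H hH =>
      apply_eq_of_isLambdaU D M hPk hP hμk hμP hproj (fun H hH => ?_) hH
    rw [← hl'.1]
    exact dual_eq_zero_of_mem_commutator (lie_eq_zero_of_isotropy_eq_univ hinv) hH
  · obtain ⟨-, -, -, -, hl0⟩ := id hl
    obtain ⟨μ₀, hμ₀, hμ₀l⟩ := exists_mem_characterLattice_eq hθ hB hT fun H hH hexp =>
      apply_mem_of_mem_centralDifferentials hG hθ hB hT hl hH hexp
    obtain ⟨ν, hν, hνl⟩ := exists_mem_characterLattice_sub_le hθ hB hT hμ₀ hμ₀l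
    obtain ⟨μ, hμ, hμk, hμl⟩ := exists_dominant_sub_le hG hθ hB hT hPk hl0 hν hνl
    exact ⟨⟨μ, hμ, hμk, isLambdaU_of_sub_le hθ hB hT hPk hl0 hμk hμl⟩,
      exists_isZeroExtension hG hθ hB hT hl0⟩
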